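/- Let $n\ge h\ge 1$ and $m\ge 0$ be integers, let $|x|_h=(x_1^2+\dots+x_h^2)^{1/2}$ for $x\in\mathbb R^n$, and put $Q=n+m(n-h)$, where $Q<2n$. Let $\mathbb G^n$ be $\mathbb R^n$ with Lebesgue measure and with the Carnot–Carathéodory distance $d_C$ of the vector fields $X_i=\partial_{x_i}$ ($1\le i\le h$), $X_i=|x|_h^m\,\partial_{x_i}$ ($h<i\le n$): $d_C(x,y)$ is the infimum of $\int_0^1\|\gamma'(t)\|\,dt$ over absolutely continuous curves $\gamma:[0,1]\to\mathbb R^n$ from $x$ to $y$ with $\gamma'(t)\in\mathrm{span}\{X_i(\gamma(t))\}$ for a.e. $t$, where $\|\cdot\|$ is the norm on the span for which the nonzero $X_i$ are orthonormal. Let $B(x_0,r)=\{x: d_C(x,x_0)<r\}$. Let $p\in(1,\infty)$, $s\in(0,1)$. Let $W^{s,p}(\mathbb G^n)$ be the set of $u\in L^p(\mathbb R^n)$ with $\iint d_C(x,y)^{-Q-sp}|u(x)-u(y)|^p\,dx\,dy<\infty$ (integrals without a domain are over the whole space). Let $\Omega\subset\mathbb G^n$ be a bounded open set, and let $W^{s,p}_0(\Omega)$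 be the set of functions in $W^{s,p}(\mathbb G^n)$ that vanish a.e. outside $\Omega$. For $g\in W^{s,p}(\mathbb G^n)$, a function $u\in W^{s,p}(\mathbb G^n)$ is a weak subsolution (supersolution) of the problem $\mathcal Lu=0$ in $\Omega$, $u=g$ in $\mathbb G^n\setminus\Omega$, if $(g-u)_-\in W_0^{s,p}(\Omega)$ (respectively $(g-u)_+\in W_0^{s,p}(\Omega)$) and $$\iint d_C(x,y)^{-Q-sp}|u(x)-u(y)|^{p-2}(u(x)-u(y))(\eta(x)-\eta(y))\,dx\,dy\le 0\quad(\text{respectively }\ge 0)$$ for every nonnegative $\eta\in W^{s,p}_0(\Omega)$; it is a weak solution if it is both. For a function $w$ let $$\mathrm{Tail}(w;x_0,R)=\Big[R^{sp}\int_{\mathbb G^n\setminus B(x_0,R)}|w(x)|^{p-1}d_C(x,x_0)^{-Q-sp}\,dx\Big]^{1/(p-1)}.$$ Then there is a constant $c>0$ that depends only on $n,h,m,p,s$ such that the following holds. Let $\Omega$ and $g$ be as above, and let $u$ be a weak solution of the problem such that $u\ge 0$ a.e. in $B(x_0,R)\subset\Omega$, where $R>0$. Let $a,d>0$, $b>1$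 and $$v=\min\{(\log(a+d)-\log(u+d))_+,\ \log b\}.$$ Then for every $r>0$ with $B_r=B(x_0,r)\subset B(x_0,R/2)$, writing $(v)_{B_r}=\frac1{|B_r|}\int_{B_r}v\,dx$ for the mean value of $v$ over $B_r$ and $u_-=\max\{-u,0\}$, $$\frac1{|B_r|}\int_{B_r}|v-(v)_{B_r}|^p\,dx\le c\,(|x_0|_h+r)^{-m(n-h)}\Big\{d^{1-p}\Big(\frac rR\Big)^{sp}r^{Q-n}\,\mathrm{Tail}(u_-;x_0,R)^{p-1}+(|x_0|_h+2r)^{m(n-h)}\Big\}.$$ -/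

import Mathlib

open MeasureTheory
open scoped ENNReal

noncomputable section

namespace Grushin

/-- The partial norm `|x|_h`: the Euclidean norm of the first `h` coordinates of `x`. -/
def hNorm {n : ℕ} (h : ℕ) (x : EuclideanSpace ℝ (Fin n)) : ℝ :=
  Real.sqrt (∑ i : Fin n, if (i : ℕ) < h then x i ^ 2 else 0)

/-- The coefficient of the `i`-th vector field: `1` for the first `h` directions and
`|x|_h ^ m` for the other `n - h` directions. -/
def coeff {n : ℕ} (h m : ℕ) (i : Fin n) (x : EuclideanSpace ℝ (Fin n)) : ℝ :=
  if (i : ℕ) < h then 1 else hNorm h x ^ m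

/-- The Grushin vector fields: `∂/∂x_i` in the first `h` directions and `|x|_h ^ m ∂/∂x_i` in the
other ones. -/
def field {n : ℕ} (h m : ℕ) (i : Fin n) (x : EuclideanSpace ℝ (Fin n)) :
    EuclideanSpace ℝ (Fin n) :=
  EuclideanSpace.single i (coeff h m i x)

/-- The length of a tangent vector `v ∈ span {X_1(x), …, X_n(x)}` at `x`, in the metric that makes
the nonzero ones among the `X_i(x)` orthonormal. If `X_i(x) = 0`, then `v i = 0` for such a `v`, and
the corresponding summand is `(0 / 0) ^ 2 = 0`. -/
def tangentNorm {n : ℕ} (h m : ℕ) (x v : EuclideanSpace ℝ (Fin n)) : ℝ :=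
  Real.sqrt (∑ i : Fin n, (v i / coeff h m i x) ^ 2)

/-- `γ`, restricted to `[0,1]`, is an absolutely continuous horizontal curve from `x` to `y`. -/
structure IsHorizontalCurve {n : ℕ} (h m : ℕ) (x y : EuclideanSpace ℝ (Fin n))
    (γ : ℝ → EuclideanSpace ℝ (Fin n)) : Prop where
  absCont : AbsolutelyContinuousOnInterval γ 0 1
  source : γ 0 = x
  target : γ 1 = y
  horizontal : ∀ᵐ t ∂(volume.restrict (Set.Icc (0 : ℝ) 1)),
    deriv γ t ∈ Submodule.span ℝ (Set.range fun i : Fin n => field h m i (γ t))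

/-- The length of a horizontal curve (possibly infinite). -/
def curveLength {n : ℕ} (h m : ℕ) (γ : ℝ → EuclideanSpace ℝ (Fin n)) : ℝ≥0∞ :=
  ∫⁻ t in Set.Icc (0 : ℝ) 1, ENNReal.ofReal (tangentNorm h m (γ t) (deriv γ t))

/-- The Carnot–Carathéodory distance of the Grushin-type space. -/
def ccDist {n : ℕ} (h m : ℕ) (x y : EuclideanSpace ℝ (Fin n)) : ℝ :=
  (⨅ (γ : ℝ → EuclideanSpace ℝ (Fin n)) (_ : IsHorizontalCurve h m x y γ),
    curveLength h m γ).toReal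

/-- The open Carnot–Carathéodory ball. -/
def ccBall {n : ℕ} (h m : ℕ) (x₀ : EuclideanSpace ℝ (Fin n)) (r : ℝ) :
    Set (EuclideanSpace ℝ (Fin n)) :=
  {x | ccDist h m x x₀ < r}

/-- The homogeneous dimension `Q = n + m (n - h)`. -/
def homDim (n h m : ℕ) : ℝ := (n : ℝ) + (m : ℝ) * ((n : ℝ) - (h : ℝ))

/-- The singular kernel `d_C(x,y) ^ (-Q - s p)`. -/
def kernel {n : ℕ} (h m : ℕ) (s p : ℝ) (x y : EuclideanSpace ℝ (Fin n)) : ℝ :=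
  ccDist h m x y ^ (-(homDim n h m) - s * p)

/-- The `p`-th power of the Gagliardo seminorm. -/
def gagliardoEnergy {n : ℕ} (h m : ℕ) (s p : ℝ) (u : EuclideanSpace ℝ (Fin n) → ℝ) : ℝ≥0∞ :=
  ∫⁻ x, ∫⁻ y, ENNReal.ofReal (kernel h m s p x y * |u x - u y| ^ p)

/-- Membership in the fractional Sobolev space `W^{s,p}` on the whole Grushin-type space. -/
def MemW {n : ℕ} (h m : ℕ) (s p : ℝ) (u : EuclideanSpace ℝ (Fin n) → ℝ) : Prop :=
  MemLp u (ENNReal.ofReal p) volume ∧ gagliardoEnergy h m s p u < ∞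

/-- Membership in `W₀^{s,p}(Ω)`: functions in `W^{s,p}` that vanish a.e. outside `Ω`. -/
def MemW₀ {n : ℕ} (h m : ℕ) (s p : ℝ) (Ω : Set (EuclideanSpace ℝ (Fin n)))
    (u : EuclideanSpace ℝ (Fin n) → ℝ) : Prop :=
  MemW h m s p u ∧ ∀ᵐ x, x ∉ Ω → u x = 0

/-- The weak form
`∬ d_C(x,y)^(-Q-sp) |u(x)-u(y)|^(p-2) (u(x)-u(y)) (η(x)-η(y)) dx dy`. -/
def weakForm {n : ℕ} (h m : ℕ) (s p : ℝ) (u η : EuclideanSpace ℝ (Fin n) → ℝ) : ℝ :=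
  ∫ x, ∫ y, kernel h m s p x y * |u x - u y| ^ (p - 2) * (u x - u y) * (η x - η y)

/-- Weak subsolutions of `ℒu = 0` in `Ω`, `u = g` outside `Ω`. -/
structure IsWeakSubsolution {n : ℕ} (h m : ℕ) (s p : ℝ) (Ω : Set (EuclideanSpace ℝ (Fin n)))
    (g u : EuclideanSpace ℝ (Fin n) → ℝ) : Prop where
  memW : MemW h m s p u
  boundary : MemW₀ h m s p Ω (fun x => max (-(g x - u x)) 0)
  weak : ∀ η : EuclideanSpace ℝ (Fin n) → ℝ, MemW₀ h m s p Ω η → (∀ x, 0 ≤ η x) →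
    weakForm h m s p u η ≤ 0

/-- Weak supersolutions of `ℒu = 0` in `Ω`, `u = g` outside `Ω`. -/
structure IsWeakSupersolution {n : ℕ} (h m : ℕ) (s p : ℝ) (Ω : Set (EuclideanSpace ℝ (Fin n)))
    (g u : EuclideanSpace ℝ (Fin n) → ℝ) : Prop where
  memW : MemW h m s p u
  boundary : MemW₀ h m s p Ω (fun x => max (g x - u x) 0)
  weak : ∀ η : EuclideanSpace ℝ (Fin n) → ℝ, MemW₀ h m s p Ω η → (∀ x, 0 ≤ η x) →
    0 ≤ weakForm h m s p u η

/-- Weak solutions: both sub- and supersolutions. -/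
def IsWeakSolution {n : ℕ} (h m : ℕ) (s p : ℝ) (Ω : Set (EuclideanSpace ℝ (Fin n)))
    (g u : EuclideanSpace ℝ (Fin n) → ℝ) : Prop :=
  IsWeakSubsolution h m s p Ω g u ∧ IsWeakSupersolution h m s p Ω g u

/-- The nonlocal tail of `v` with respect to the ball `B(x₀, R)`. -/
def tail {n : ℕ} (h m : ℕ) (s p : ℝ) (v : EuclideanSpace ℝ (Fin n) → ℝ)
    (x₀ : EuclideanSpace ℝ (Fin n)) (R : ℝ) : ℝ :=
  (R ^ (s * p) * ∫ x in (ccBall h m x₀ R)ᶜ, |v x| ^ (p - 1) * kernel h m s p x x₀) ^ (1 / (p - 1))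

/-- The truncated logarithm `min {(log (a + d) - log (u + d))₊, log b}`. -/
def truncLog {n : ℕ} (a b d : ℝ) (u : EuclideanSpace ℝ (Fin n) → ℝ)
    (x : EuclideanSpace ℝ (Fin n)) : ℝ :=
  min (max (Real.log (a + d) - Real.log (u x + d)) 0) (Real.log b)

end Grushin

end

/-! Write `μ = m (n - h)`, so that `Q = n + μ`. The proof splits according to the sign of `p (1 - s)
- μ`.

If `p (1 - s) > μ`, the nonlocal logarithmic estimate applies. The weak inequality is tested with `φ
^ p (u₊ + d) ^ (1 - p)`, where `φ` is a cutoff for `B_r`; only the supersolution property is needed.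
On `B_r × B_r` the integrand is at most `-(p - 1)` times the Gagliardo density of `log (u + d)`
(`log_rpow_le`). Elsewhere a discrete Picone inequality bounds it by the density of `φ`, plus a term
in `u₋` that lives outside `B(x₀, R)` and becomes the tail (`test_integrand_le`,
`lintegral_tail_le`). Hence the logarithmic energy on `B_r` is bounded by the energy of `φ` plus a
tail term (`log_estimate`). Since `v` is a 1-Lipschitz function of `log (u + d)` and the kernel is
at least `(2 r) ^ (-Q - s p)` off the diagonal of `B_r × B_r`, Jensen's inequality turns this into
the oscillation bound.

The energy of `φ` is computed from the ball-box comparison: `|B(x, t)|` is comparable to `t ^ n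
(|x|_h + t) ^ μ`. Dyadic shells then give the integrals of `d_C(x, ·) ^ α` inside and outside a
ball. Inside, the exponent is `α = -Q - s p + p`, and the required condition `α + n > 0` is exactly
`p (1 - s) > μ`.

If `p (1 - s) ≤ μ`, the kernel is too singular away from `{|x|_h = 0}`, where `d_C` is bounded by a
multiple of the Euclidean distance and `Q + s p ≥ n + p`. Finite energy forces `u` to be constant
along almost all increments in a half-space, hence zero by `L^p` integrability (`MemW.ae_eq_zero`).
Then `v` is constant a.e. and the left side vanishes. -/

/-! ### Absolute continuity under composition -/

namespace AbsolutelyContinuousOnInterval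

/-- Absolute continuity is preserved by precomposition with a monotone or antitone Lipschitz map. -/
theorem comp_lipschitz_monotone {X : Type*} [PseudoMetricSpace X] {f : ℝ → X} {g : ℝ → ℝ}
    {a b c d K : ℝ} (hf : AbsolutelyContinuousOnInterval f c d)
    (hg : Monotone g ∨ Antitone g) (hK : ∀ x y, dist (g x) (g y) ≤ K * dist x y)
    (hmaps : ∀ x ∈ Set.uIcc a b, g x ∈ Set.uIcc c d) :
    AbsolutelyContinuousOnInterval (fun t => f (g t)) a b := by
  rw [absolutelyContinuousOnInterval_iff] at hf ⊢
  intro ε hε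
  obtain ⟨δ, hδ, H⟩ := hf ε hε
  -- `K` is not assumed positive, so `|K| + 1` serves as the Lipschitz constant.
  refine ⟨δ / (|K| + 1), by positivity, fun E hE hlen => ?_⟩
  refine H (E.1, fun i => (g (E.2 i).1, g (E.2 i).2)) ⟨?_, ?_⟩ ?_
  · intro i hi
    exact ⟨hmaps _ (hE.1 i hi).1, hmaps _ (hE.1 i hi).2⟩
  · intro i hi j hj hij
    have := hE.2 hi hj hij
    -- Disjointness reads `min (max, max) ≤ max (min, min)`. An antitone map reverses the inequality
    -- and exchanges min with max, so the condition keeps its form.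
    simp only [Function.onFun, Set.uIoc, Set.Ioc_disjoint_Ioc] at this ⊢
    rcases hg with hg | hg
    · have h2 := hg this
      simpa only [hg.map_max, hg.map_min] using h2
    · have h2 := hg this
      simp only [hg.map_max, hg.map_min] at h2
      exact h2
  · calc ∑ i ∈ Finset.range E.1, dist (g (E.2 i).1) (g (E.2 i).2)
        ≤ ∑ i ∈ Finset.range E.1, (|K| + 1) * dist (E.2 i).1 (E.2 i).2 := by
          refine Finset.sum_le_sum fun i _ => (hK _ _).trans ?_
          gcongr
          linarith [le_abs_self K]
      _ = (|K| + 1) * ∑ i ∈ Finset.range E.1, dist (E.2 i).1 (E.2 i).2 := by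
          rw [Finset.mul_sum]
      _ < (|K| + 1) * (δ / (|K| + 1)) := by gcongr
      _ = δ := by field_simp

/-- Absolute continuity is preserved by postcomposition with a nonexpansive map. -/
theorem nonexpansive_comp {X Y : Type*} [PseudoMetricSpace X] [PseudoMetricSpace Y] {f : ℝ → X}
    {g : X → Y} {a b : ℝ} (hf : AbsolutelyContinuousOnInterval f a b)
    (hg : ∀ x y, dist (g x) (g y) ≤ dist x y) :
    AbsolutelyContinuousOnInterval (fun t => g (f t)) a b := by
  rw [absolutelyContinuousOnInterval_iff] at hf ⊢
  intro ε hε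
  obtain ⟨δ, hδ, H⟩ := hf ε hε
  exact ⟨δ, hδ, fun E hE hlen =>
    (Finset.sum_le_sum fun i _ => hg _ _).trans_lt (H E hE hlen)⟩

end AbsolutelyContinuousOnInterval

/-! ### Tangent norm, coefficients and partial norm -/

namespace Grushin

variable {n : ℕ}

theorem sqrt_sum_sq_le_sum_abs {ι : Type*} (s : Finset ι) (f : ι → ℝ) :
    √(∑ i ∈ s, f i ^ 2) ≤ ∑ i ∈ s, |f i| := by
  rw [Real.sqrt_le_left (Finset.sum_nonneg fun _ _ => abs_nonneg _)]
  simpa only [sq_abs] using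
    Finset.sum_sq_le_sq_sum_of_nonneg (s := s) (f := fun i => |f i|) fun _ _ => abs_nonneg _

/-- The Carnot–Carathéodory distance as an extended nonnegative real number. -/
noncomputable def ccEDist (h m : ℕ) (x y : EuclideanSpace ℝ (Fin n)) : ℝ≥0∞ :=
  ⨅ (γ : ℝ → EuclideanSpace ℝ (Fin n)) (_ : IsHorizontalCurve h m x y γ), curveLength h m γ

/-- Symmetry, the triangle inequality and the curve bounds are proved in `ℝ≥0∞`, where no finiteness
is needed; `ccEDist_ne_top` later transfers them to the real distance. -/
theorem ccDist_eq_toReal (h m : ℕ) (x y : EuclideanSpace ℝ (Fin n)) :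
    ccDist h m x y = (ccEDist h m x y).toReal := rfl

theorem tangentNorm_smul (h m : ℕ) (x v : EuclideanSpace ℝ (Fin n)) (c : ℝ) :
    tangentNorm h m x (c • v) = |c| * tangentNorm h m x v := by
  unfold tangentNorm
  rw [← Real.sqrt_sq_eq_abs, ← Real.sqrt_mul (sq_nonneg c), Finset.mul_sum]
  congr 1
  refine Finset.sum_congr rfl fun i _ => ?_
  simp only [PiLp.smul_apply, smul_eq_mul]
  ring

theorem tangentNorm_nonneg (h m : ℕ) (x v : EuclideanSpace ℝ (Fin n)) :
    0 ≤ tangentNorm h m x v := Real.sqrt_nonneg _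

theorem hNorm_nonneg (h : ℕ) (x : EuclideanSpace ℝ (Fin n)) : 0 ≤ hNorm h x := Real.sqrt_nonneg _

theorem coeff_nonneg (h m : ℕ) (i : Fin n) (x : EuclideanSpace ℝ (Fin n)) : 0 ≤ coeff h m i x := by
  unfold coeff
  split_ifs
  · exact zero_le_one
  · exact pow_nonneg (hNorm_nonneg h x) m

/-- Horizontality is essential where a coefficient vanishes: the quotient in `tangentNorm` is then 0
by convention and says nothing about `v i`, but membership in the span forces `v i = 0`. -/
theorem abs_apply_le_of_mem_span {h m : ℕ} {x v : EuclideanSpace ℝ (Fin n)}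
    (hv : v ∈ Submodule.span ℝ (Set.range fun i : Fin n => field h m i x)) (i : Fin n) :
    |v i| ≤ coeff h m i x * tangentNorm h m x v := by
  have hzero : coeff h m i x = 0 → v i = 0 := by
    intro h0
    induction hv using Submodule.span_induction with
    | mem w hw =>
      obtain ⟨j, rfl⟩ := hw
      simp only [field, PiLp.single_apply]
      split_ifs with hij
      · rw [← hij, h0]
      · rfl
    | zero => simp
    | add w z _ _ hw hz => simp [hw, hz]
    | smul c w _ hw => simp [hw]
  by_cases h0 : coeff h m i x = 0
  · simp [hzero h0, h0]
  · have h1 : |v i / coeff h m i x| ≤ tangentNorm h m x v := by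
      rw [← Real.sqrt_sq_eq_abs]
      exact Real.sqrt_le_sqrt (Finset.single_le_sum (f := fun j => (v j / coeff h m j x) ^ 2)
        (fun j _ => sq_nonneg _) (Finset.mem_univ i))
    have h2 : 0 < coeff h m i x := lt_of_le_of_ne (coeff_nonneg h m i x) (Ne.symm h0)
    rwa [abs_div, abs_of_pos h2, div_le_iff₀' h2] at h1

theorem hNorm_eq_norm (h : ℕ) (x : EuclideanSpace ℝ (Fin n)) :
    hNorm h x = ‖(WithLp.toLp 2 fun i : Fin n => if (i : ℕ) < h then x i else 0 :
      EuclideanSpace ℝ (Fin n))‖ := by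
  rw [EuclideanSpace.norm_eq, hNorm]
  congr 1
  refine Finset.sum_congr rfl fun i _ => ?_
  by_cases hi : (i : ℕ) < h <;> simp [hi]

theorem abs_apply_le_hNorm (h : ℕ) (x : EuclideanSpace ℝ (Fin n)) {i : Fin n} (hi : (i : ℕ) < h) :
    |x i| ≤ hNorm h x := by
  rw [hNorm_eq_norm]
  have := PiLp.norm_apply_le (WithLp.toLp 2 fun i : Fin n => if (i : ℕ) < h then x i else 0 :
      EuclideanSpace ℝ (Fin n)) i
  simpa [hi] using this

/-- `hNorm` is the Euclidean norm of a projection, hence subadditive. The coordinatewise form suits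
curves, which are estimated one coordinate at a time. -/
theorem hNorm_le_add_sum (h : ℕ) (x y : EuclideanSpace ℝ (Fin n)) :
    hNorm h y ≤ hNorm h x + ∑ i : Fin n, if (i : ℕ) < h then |y i - x i| else 0 := by
  have key : hNorm h y ≤ hNorm h x + hNorm h (y - x) := by
    simp only [hNorm_eq_norm]
    refine le_trans (le_of_eq ?_) (norm_add_le _ _)
    congr 1
    ext i
    simp only [PiLp.add_apply, PiLp.sub_apply]
    split_ifs <;> simp
  refine key.trans (add_le_add le_rfl ?_)
  have h1 : hNorm h (y - x) = √(∑ i : Fin n, (if (i : ℕ) < h then y i - x i else 0) ^ 2) := by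
    unfold hNorm
    congr 1
    refine Finset.sum_congr rfl fun i _ => ?_
    split_ifs <;> simp
  rw [h1]
  refine (sqrt_sum_sq_le_sum_abs _ _).trans (le_of_eq (Finset.sum_congr rfl fun i _ => ?_))
  split_ifs <;> simp

theorem hNorm_congr {h : ℕ} {x y : EuclideanSpace ℝ (Fin n)}
    (hxy : ∀ i : Fin n, (i : ℕ) < h → x i = y i) : hNorm h x = hNorm h y := by
  unfold hNorm
  congr 1
  refine Finset.sum_congr rfl fun i _ => ?_
  split_ifs with hi
  · rw [hxy i hi]
  · rfl

/-! ### Reparametrization -/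

theorem ae_comp_affine {P : ℝ → Prop} (hP : ∀ᵐ t, P t) {c : ℝ} (hc : c ≠ 0) (e : ℝ) :
    ∀ᵐ t, P (c * t + e) := by
  have h1 : Measure.QuasiMeasurePreserving (fun t : ℝ => c * t) volume volume := by
    refine ⟨measurable_const_mul c, ?_⟩
    rw [Real.map_volume_mul_left hc]
    exact Measure.smul_absolutelyContinuous
  have h2 : Measure.QuasiMeasurePreserving (fun t : ℝ => t + e) volume volume :=
    (measurePreserving_add_right volume e).quasiMeasurePreserving
  exact (h2.comp h1).ae hP

theorem deriv_comp_affine (γ : ℝ → EuclideanSpace ℝ (Fin n)) (c e t : ℝ) :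
    deriv (fun t => γ (c * t + e)) t = c • deriv γ (c * t + e) := by
  rw [deriv_comp_mul_left c (fun t => γ (t + e)) t, deriv_comp_add_const]

/-- Change of variables: the factor `|c|` from the homogeneity of `tangentNorm` is the Jacobian.
Agreement on an open set suffices, because it determines the derivative there; this serves each half
of a concatenation. -/
theorem lintegral_tangentNorm_affine (h m : ℕ) {γ γ' : ℝ → EuclideanSpace ℝ (Fin n)} {c : ℝ}
    (hc : c ≠ 0) (e : ℝ) {s : Set ℝ} (hs : IsOpen s)
    (hγ : Set.EqOn γ' (fun t => γ (c * t + e)) s)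
    (hmaps : ∀ t ∈ s, c * t + e ∈ Set.Icc (0 : ℝ) 1) :
    ∫⁻ t in s, ENNReal.ofReal (tangentNorm h m (γ' t) (deriv γ' t)) ≤ curveLength h m γ := by
  have h1 : ∫⁻ t in s, ENNReal.ofReal (tangentNorm h m (γ' t) (deriv γ' t)) =
      ∫⁻ t in (fun t => c * t + e) '' s, ENNReal.ofReal (tangentNorm h m (γ t) (deriv γ t)) := by
    rw [lintegral_image_eq_lintegral_abs_deriv_mul hs.measurableSet (f' := fun _ => c)]
    · refine setLIntegral_congr_fun hs.measurableSet fun t ht => ?_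
      have hev : γ' =ᶠ[nhds t] fun t => γ (c * t + e) := hγ.eventuallyEq_of_mem (hs.mem_nhds ht)
      rw [hev.deriv_eq, hev.eq_of_nhds, deriv_comp_affine, tangentNorm_smul,
        ENNReal.ofReal_mul (abs_nonneg c)]
    · intro t _
      simpa using (((hasDerivAt_id t).const_mul c).add_const e).hasDerivWithinAt
    · intro t _ t' _ htt
      have : c * t = c * t' := by simpa using htt
      exact mul_left_cancel₀ hc this
  rw [h1]
  refine lintegral_mono_set ?_
  rintro _ ⟨t, ht, rfl⟩
  exact hmaps t ht

theorem ae_horizontal_affine {h m : ℕ} {x y : EuclideanSpace ℝ (Fin n)}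
    {γ γ' : ℝ → EuclideanSpace ℝ (Fin n)} (hγ₁ : IsHorizontalCurve h m x y γ) {c : ℝ}
    (hc : c ≠ 0) (e : ℝ) {s : Set ℝ} (hs : IsOpen s)
    (hγ : Set.EqOn γ' (fun t => γ (c * t + e)) s)
    (hmaps : ∀ t ∈ s, c * t + e ∈ Set.Icc (0 : ℝ) 1) :
    ∀ᵐ t, t ∈ s →
      deriv γ' t ∈ Submodule.span ℝ (Set.range fun i : Fin n => field h m i (γ' t)) := by
  have h1 := hγ₁.horizontal
  rw [ae_restrict_iff' measurableSet_Icc] at h1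
  filter_upwards [ae_comp_affine h1 hc e] with t ht hts
  have hev : γ' =ᶠ[nhds t] fun t => γ (c * t + e) := hγ.eventuallyEq_of_mem (hs.mem_nhds hts)
  rw [hev.deriv_eq, hev.eq_of_nhds, deriv_comp_affine]
  exact Submodule.smul_mem _ _ (ht (hmaps t hts))

theorem ae_ne_real (a : ℝ) : ∀ᵐ t : ℝ, t ≠ a := by simp [ae_iff]

theorem IsHorizontalCurve.reverse {h m : ℕ} {x y : EuclideanSpace ℝ (Fin n)}
    {γ : ℝ → EuclideanSpace ℝ (Fin n)} (hγ : IsHorizontalCurve h m x y γ) :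
    IsHorizontalCurve h m y x (fun t => γ (-1 * t + 1)) where
  absCont := by
    refine hγ.absCont.comp_lipschitz_monotone (K := 1) (Or.inr fun s t hst => ?_) (fun s t => ?_)
      fun t ht => ?_
    · simp only; linarith
    · simp only [Real.dist_eq, one_mul]
      rw [show -1 * s + 1 - (-1 * t + 1) = -(s - t) by ring, abs_neg]
    · rw [Set.uIcc_of_le zero_le_one] at ht ⊢
      exact ⟨by linarith [ht.2], by linarith [ht.1]⟩
  source := by simpa using hγ.target
  target := by simpa using hγ.source
  horizontal := by
    rw [ae_restrict_iff' measurableSet_Icc]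
    filter_upwards [ae_horizontal_affine hγ (c := -1) (by norm_num) 1 (s := Set.Ioo 0 1) isOpen_Ioo
      (Set.eqOn_refl _ _) (fun t ht => ⟨by linarith [ht.2], by linarith [ht.1]⟩),
      ae_ne_real 0, ae_ne_real 1] with t ht h0 h1 htI
    exact ht ⟨lt_of_le_of_ne htI.1 h0.symm, lt_of_le_of_ne htI.2 h1⟩

theorem ccEDist_symm_le (h m : ℕ) (x y : EuclideanSpace ℝ (Fin n)) :
    ccEDist h m y x ≤ ccEDist h m x y := by
  refine le_iInf₂ fun γ hγ => (iInf₂_le _ hγ.reverse).trans ?_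
  refine le_trans (le_of_eq ?_) (lintegral_tangentNorm_affine h m (γ := γ) (c := -1) (by norm_num) 1
    (s := Set.Ioo 0 1) isOpen_Ioo (Set.eqOn_refl _ _)
    (fun t ht => ⟨by linarith [ht.2], by linarith [ht.1]⟩))
  exact setLIntegral_congr Ioo_ae_eq_Icc.symm

theorem ccEDist_comm (h m : ℕ) (x y : EuclideanSpace ℝ (Fin n)) :
    ccEDist h m x y = ccEDist h m y x :=
  le_antisymm (ccEDist_symm_le h m y x) (ccEDist_symm_le h m x y)

/-- The concatenation of two curves `[0,1] → ℝⁿ` that meet at `y`. -/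
def concat (y : EuclideanSpace ℝ (Fin n)) (γ₁ γ₂ : ℝ → EuclideanSpace ℝ (Fin n)) (t : ℝ) :
    EuclideanSpace ℝ (Fin n) :=
  -- On each half of `[0,1]` one summand is frozen at `y` and cancels. A sum of monotone Lipschitz
  -- reparametrizations is absolutely continuous, so no gluing argument is needed.
  γ₁ (min (2 * t) 1) + γ₂ (max (2 * t - 1) 0) - y

theorem concat_eqOn_left {y : EuclideanSpace ℝ (Fin n)} {γ₁ γ₂ : ℝ → EuclideanSpace ℝ (Fin n)}
    (h₂ : γ₂ 0 = y) : Set.EqOn (concat y γ₁ γ₂) (fun t => γ₁ (2 * t + 0)) (Set.Ioo 0 (1 / 2)) := by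
  intro t ht
  have h1 : 2 * t ≤ 1 := by linarith [ht.2]
  simp [concat, h₂, h1]

theorem concat_eqOn_right {y : EuclideanSpace ℝ (Fin n)} {γ₁ γ₂ : ℝ → EuclideanSpace ℝ (Fin n)}
    (h₁ : γ₁ 1 = y) :
    Set.EqOn (concat y γ₁ γ₂) (fun t => γ₂ (2 * t + -1)) (Set.Ioo (1 / 2) 1) := by
  intro t ht
  have h1 : 1 ≤ 2 * t := by linarith [ht.1]
  have h2 : 0 ≤ 2 * t - 1 := by linarith
  simp only [concat, min_eq_right h1, h₁, max_eq_left h2]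
  rw [add_sub_cancel_left, sub_eq_add_neg]

theorem ae_mem_Icc_cases : ∀ᵐ t : ℝ, t ∈ Set.Icc (0 : ℝ) 1 →
    t ∈ Set.Ioo (0 : ℝ) (1 / 2) ∨ t ∈ Set.Ioo (1 / 2 : ℝ) 1 := by
  filter_upwards [ae_ne_real 0, ae_ne_real 1, ae_ne_real (1 / 2)] with t h0 h1 h2 ht
  rcases lt_or_gt_of_ne h2 with h | h
  · exact Or.inl ⟨lt_of_le_of_ne ht.1 h0.symm, h⟩
  · exact Or.inr ⟨h, lt_of_le_of_ne ht.2 h1⟩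

theorem IsHorizontalCurve.concat {h m : ℕ} {x y z : EuclideanSpace ℝ (Fin n)}
    {γ₁ γ₂ : ℝ → EuclideanSpace ℝ (Fin n)} (h₁ : IsHorizontalCurve h m x y γ₁)
    (h₂ : IsHorizontalCurve h m y z γ₂) : IsHorizontalCurve h m x z (concat y γ₁ γ₂) where
  absCont := by
    have e : Grushin.concat y γ₁ γ₂ =
        fun t => γ₁ (min (2 * t) 1) + γ₂ (max (2 * t - 1) 0) - y := rfl
    rw [e]
    refine AbsolutelyContinuousOnInterval.fun_sub (AbsolutelyContinuousOnInterval.fun_add ?_ ?_)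
      (LipschitzOnWith.absolutelyContinuousOnInterval
        (LipschitzWith.const y).lipschitzOnWith)
    · refine h₁.absCont.comp_lipschitz_monotone (K := 2) (Or.inl fun s t hst => ?_) (fun s t => ?_)
        fun t ht => ?_
      · exact min_le_min (by linarith) le_rfl
      · rw [Real.dist_eq, Real.dist_eq]
        refine (abs_min_sub_min_le_max _ _ _ _).trans ?_
        simp only [sub_self, abs_zero]
        rw [← mul_sub, abs_mul, abs_two]
        exact max_le le_rfl (by positivity)
      · rw [Set.uIcc_of_le zero_le_one] at ht ⊢
        exact ⟨le_min (by linarith [ht.1]) zero_le_one, min_le_right _ _⟩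
    · refine h₂.absCont.comp_lipschitz_monotone (K := 2) (Or.inl fun s t hst => ?_) (fun s t => ?_)
        fun t ht => ?_
      · exact max_le_max (by linarith) le_rfl
      · rw [Real.dist_eq, Real.dist_eq]
        refine (abs_max_sub_max_le_max _ _ _ _).trans ?_
        simp only [sub_self, abs_zero]
        rw [show 2 * s - 1 - (2 * t - 1) = 2 * (s - t) by ring, abs_mul, abs_two]
        exact max_le le_rfl (by positivity)
      · rw [Set.uIcc_of_le zero_le_one] at ht ⊢
        exact ⟨le_max_right _ _, max_le (by linarith [ht.2]) zero_le_one⟩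
  source := by simp [Grushin.concat, h₁.source, h₂.source]
  target := by
    have : (2 : ℝ) - 1 = 1 := by norm_num
    simp [Grushin.concat, h₁.target, h₂.target, this]
  horizontal := by
    rw [ae_restrict_iff' measurableSet_Icc]
    filter_upwards [ae_mem_Icc_cases,
      ae_horizontal_affine h₁ (c := 2) (by norm_num) 0 (s := Set.Ioo 0 (1 / 2)) isOpen_Ioo
        (concat_eqOn_left h₂.source) (fun t ht => ⟨by linarith [ht.1], by linarith [ht.2]⟩),
      ae_horizontal_affine h₂ (c := 2) (by norm_num) (-1) (s := Set.Ioo (1 / 2) 1) isOpen_Ioo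
        (concat_eqOn_right h₁.target) (fun t ht => ⟨by linarith [ht.1], by linarith [ht.2]⟩)]
      with t hc hl hr ht
    exact (hc ht).elim hl hr

theorem curveLength_concat_le {h m : ℕ} {x y z : EuclideanSpace ℝ (Fin n)}
    {γ₁ γ₂ : ℝ → EuclideanSpace ℝ (Fin n)} (h₁ : IsHorizontalCurve h m x y γ₁)
    (h₂ : IsHorizontalCurve h m y z γ₂) :
    curveLength h m (concat y γ₁ γ₂) ≤ curveLength h m γ₁ + curveLength h m γ₂ := by
  unfold curveLength
  calc _ ≤ ∫⁻ t in Set.Ioo (0 : ℝ) (1 / 2) ∪ Set.Ioo (1 / 2 : ℝ) 1, ENNReal.ofReal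
        (tangentNorm h m (concat y γ₁ γ₂ t) (deriv (concat y γ₁ γ₂) t)) :=
        lintegral_mono_set' (by
          filter_upwards [ae_mem_Icc_cases] with t ht hI
          exact ht hI)
    _ ≤ _ := (lintegral_union_le _ _ _).trans (add_le_add
        (lintegral_tangentNorm_affine h m (c := 2) (by norm_num) 0 isOpen_Ioo
          (concat_eqOn_left h₂.source) (fun t ht => ⟨by linarith [ht.1], by linarith [ht.2]⟩))
        (lintegral_tangentNorm_affine h m (c := 2) (by norm_num) (-1) isOpen_Ioo
          (concat_eqOn_right h₁.target) (fun t ht => ⟨by linarith [ht.1], by linarith [ht.2]⟩)))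

theorem ccEDist_triangle (h m : ℕ) (x y z : EuclideanSpace ℝ (Fin n)) :
    ccEDist h m x z ≤ ccEDist h m x y + ccEDist h m y z := by
  unfold ccEDist
  rw [ENNReal.iInf₂_add]
  refine le_iInf₂ fun γ₁ h₁ => ?_
  rw [ENNReal.add_iInf₂]
  exact le_iInf₂ fun γ₂ h₂ => (iInf₂_le _ (h₁.concat h₂)).trans (curveLength_concat_le h₁ h₂)

/-- The weight of the `i`-th coordinate direction at points of partial norm `ρ`. -/
def weight (h m : ℕ) (ρ : ℝ) (i : Fin n) : ℝ := if (i : ℕ) < h then 1 else ρ ^ m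

theorem weight_pos (h m : ℕ) {ρ : ℝ} (hρ : 0 < ρ) (i : Fin n) : 0 < weight h m ρ i := by
  unfold weight
  split_ifs <;> positivity

theorem weight_mono (h m : ℕ) {ρ ρ' : ℝ} (hρ : 0 ≤ ρ) (hle : ρ ≤ ρ') (i : Fin n) :
    weight h m ρ i ≤ weight h m ρ' i := by
  unfold weight
  split_ifs
  · exact le_rfl
  · exact pow_le_pow_left₀ hρ hle m

theorem coeff_eq_weight (h m : ℕ) (i : Fin n) (x : EuclideanSpace ℝ (Fin n)) :
    coeff h m i x = weight h m (hNorm h x) i := rfl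

/-! ### Upper bounds from explicit curves -/

/-- The segment from `x` to `x + v` is horizontal with constant coefficients in the directions in
which it moves; its length is bounded by the sum of the absolute components. -/
theorem ccEDist_add_le (h m : ℕ) (x v : EuclideanSpace ℝ (Fin n)) (κ : Fin n → ℝ)
    (hκ : ∀ i, 0 < κ i) (hc : ∀ i, v i ≠ 0 → ∀ t : ℝ, coeff h m i (x + t • v) = κ i) :
    ccEDist h m x (x + v) ≤ ENNReal.ofReal (∑ i, |v i| / κ i) := by
  have hderiv : ∀ t : ℝ, deriv (fun t : ℝ => x + t • v) t = v := fun t => by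
    simpa using (((hasDerivAt_id t).smul_const v).const_add x).deriv
  have hcurve : IsHorizontalCurve h m x (x + v) (fun t : ℝ => x + t • v) := by
    refine ⟨?_, by simp, by simp, Filter.Eventually.of_forall fun t => ?_⟩
    · exact ContDiffOn.absolutelyContinuousOnInterval (by fun_prop)
    · rw [hderiv]
      have : v = ∑ i, (v i / κ i) • field h m i (x + t • v) := by
        ext j
        rw [WithLp.ofLp_sum, Finset.sum_apply]
        simp only [field, PiLp.smul_apply, PiLp.single_apply, smul_eq_mul]
        rw [Finset.sum_eq_single j]
        · simp only [if_true]
          by_cases hj : v j = 0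
          · simp [hj]
          · rw [hc j hj t, div_mul_cancel₀ _ (hκ j).ne']
        · intro i _ hij
          simp [hij.symm]
        · simp
      rw [this]
      exact Submodule.sum_mem _ fun i _ =>
        Submodule.smul_mem _ _ (Submodule.subset_span ⟨i, by rw [← this]⟩)
  refine (iInf₂_le _ hcurve).trans ?_
  unfold curveLength
  calc _ ≤ ∫⁻ t in Set.Icc (0 : ℝ) 1, ENNReal.ofReal (∑ i, |v i| / κ i) := by
        refine lintegral_mono fun t => ENNReal.ofReal_le_ofReal ?_
        simp only [hderiv]
        refine (sqrt_sum_sq_le_sum_abs _ _).trans (Finset.sum_le_sum fun i _ => ?_)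
        rw [abs_div]
        by_cases hi : v i = 0
        · simp [hi]
        · rw [hc i hi t, abs_of_pos (hκ i)]
    _ = _ := by simp

theorem ccEDist_add_le_of_first (h m : ℕ) (x v : EuclideanSpace ℝ (Fin n))
    (hv : ∀ i : Fin n, ¬ (i : ℕ) < h → v i = 0) :
    ccEDist h m x (x + v) ≤ ENNReal.ofReal (∑ i, |v i|) := by
  have := ccEDist_add_le h m x v (fun _ => 1) (fun _ => one_pos) fun i hi t => by
    have : (i : ℕ) < h := by by_contra h'; exact hi (hv i h')
    simp [coeff, this]
  simpa using this

/-- Motion in the last coordinates leaves `|x|_h` unchanged, so the coefficients stay constant along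
the segment. -/
theorem ccEDist_add_le_of_last (h m : ℕ) (x v : EuclideanSpace ℝ (Fin n)) (hx : 0 < hNorm h x)
    (hv : ∀ i : Fin n, (i : ℕ) < h → v i = 0) :
    ccEDist h m x (x + v) ≤ ENNReal.ofReal (∑ i, |v i| / weight h m (hNorm h x) i) := by
  refine ccEDist_add_le h m x v _ (weight_pos h m hx) fun i _ t => ?_
  rw [coeff_eq_weight]
  congr 1
  refine hNorm_congr fun j hj => ?_
  simp [hv j hj]

theorem hNorm_mono {h : ℕ} {x y : EuclideanSpace ℝ (Fin n)}
    (hxy : ∀ i : Fin n, (i : ℕ) < h → |x i| ≤ |y i|) : hNorm h x ≤ hNorm h y := by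
  unfold hNorm
  refine Real.sqrt_le_sqrt (Finset.sum_le_sum fun i _ => ?_)
  split_ifs with hi
  · exact sq_le_sq.mpr (hxy i hi)
  · exact le_rfl

/-- The path steps away from the degenerate set by `ρ` in a first direction, then moves in the last
directions, where the coefficient is now bounded below, and finally corrects the first coordinates.
The initial step and its correction cost the `2 * ρ`. -/
theorem ccEDist_le {h : ℕ} (m : ℕ) (hh : 1 ≤ h) (hn : h ≤ n) (x y : EuclideanSpace ℝ (Fin n))
    {ρ : ℝ} (hρ : 0 < ρ) :
    ccEDist h m x y ≤
      ENNReal.ofReal (2 * ρ + ∑ i, |y i - x i| / weight h m ((hNorm h x + ρ) / 2) i) := by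
  set i₀ : Fin n := ⟨0, by omega⟩ with hi₀
  have hi₀h : (i₀ : ℕ) < h := by simp [hi₀]; omega
  -- The sign of the step is that of `x i₀`, so `|x|_h` does not decrease.
  obtain ⟨σ, hσ, hσx⟩ : ∃ σ : ℝ, |σ| = ρ ∧ |x i₀ + σ| = |x i₀| + ρ := by
    rcases le_total 0 (x i₀) with h0 | h0
    · exact ⟨ρ, abs_of_pos hρ, by rw [abs_of_nonneg h0, abs_of_nonneg (by linarith)]⟩
    · exact ⟨-ρ, by rw [abs_neg, abs_of_pos hρ],
        by rw [abs_of_nonpos h0, abs_of_nonpos (by linarith)]; ring⟩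
  set e : EuclideanSpace ℝ (Fin n) := EuclideanSpace.single i₀ σ with he
  have he_apply : ∀ i, e i = if i = i₀ then σ else 0 := fun i => by
    rw [he, PiLp.single_apply]
  -- Both `hNorm h x` and `ρ` are lower bounds; their mean is one too.
  have hnorm : (hNorm h x + ρ) / 2 ≤ hNorm h (x + e) := by
    have h1 : hNorm h x ≤ hNorm h (x + e) := hNorm_mono fun i _ => by
      rw [PiLp.add_apply, he_apply]
      split_ifs with hi
      · rw [hi, hσx]; linarith
      · simp
    have h2 : ρ ≤ hNorm h (x + e) := by
      have := abs_apply_le_hNorm h (x + e) hi₀h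
      rw [PiLp.add_apply, he_apply, if_pos rfl, hσx] at this
      linarith [abs_nonneg (x i₀)]
    linarith
  have hpos : 0 < (hNorm h x + ρ) / 2 := by linarith [hNorm_nonneg h x]
  set w : EuclideanSpace ℝ (Fin n) :=
    WithLp.toLp 2 fun i : Fin n => if (i : ℕ) < h then 0 else y i - x i with hw
  set u : EuclideanSpace ℝ (Fin n) :=
    WithLp.toLp 2 fun i : Fin n => if (i : ℕ) < h then y i - x i - e i else 0 with hu
  have hsum : x + e + w + u = y := by
    ext i
    simp only [PiLp.add_apply, hw, hu]
    split_ifs with hi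
    · ring
    · have : e i = 0 := by
        rw [he_apply, if_neg]
        rintro rfl
        exact hi hi₀h
      rw [this]; ring
  have hsume : ∑ i, |e i| = ρ := by
    simp only [he_apply]
    rw [Finset.sum_eq_single i₀] <;> simp +contextual [hσ]
  have b1 : ccEDist h m x (x + e) ≤ ENNReal.ofReal ρ := by
    rw [← hsume]
    refine ccEDist_add_le_of_first h m x e fun i hi => ?_
    rw [he_apply, if_neg]
    rintro rfl
    exact hi hi₀h
  have b2 := ccEDist_add_le_of_last h m (x + e) w (hpos.trans_le hnorm)
    fun i hi => by simp [hw, hi]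
  have b3 := ccEDist_add_le_of_first h m (x + e + w) u fun i hi => by simp [hu, hi]
  rw [hsum] at b3
  refine (ccEDist_triangle h m x (x + e) y).trans ((add_le_add b1
    ((ccEDist_triangle h m (x + e) (x + e + w) y).trans (add_le_add b2 b3))).trans ?_)
  rw [← ENNReal.ofReal_add, ← ENNReal.ofReal_add hρ.le]
  · refine ENNReal.ofReal_le_ofReal ?_
    have : ∑ i, |w i| / weight h m (hNorm h (x + e)) i + ∑ i, |u i| ≤
        ∑ i, (|y i - x i| / weight h m ((hNorm h x + ρ) / 2) i + |e i|) := by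
      rw [← Finset.sum_add_distrib]
      refine Finset.sum_le_sum fun i _ => ?_
      by_cases hi : (i : ℕ) < h
      · simp only [hw, hu, hi, if_true, weight, abs_zero, zero_add, div_one]
        exact abs_sub _ _
      · simp only [hw, hu, hi, if_false, abs_zero, add_zero]
        have h1 : |y i - x i| / weight h m (hNorm h (x + e)) i ≤
            |y i - x i| / weight h m ((hNorm h x + ρ) / 2) i :=
          div_le_div_of_nonneg_left (abs_nonneg _) (weight_pos h m hpos i)
            (weight_mono h m hpos.le hnorm i)
        linarith [abs_nonneg (e i)]
    rw [Finset.sum_add_distrib, hsume] at this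
    linarith
  · exact add_nonneg (Finset.sum_nonneg fun i _ => div_nonneg (abs_nonneg _)
      (weight_pos h m (hpos.trans_le hnorm) i).le) (Finset.sum_nonneg fun i _ => abs_nonneg _)
  · exact Finset.sum_nonneg fun i _ => div_nonneg (abs_nonneg _)
      (weight_pos h m (hpos.trans_le hnorm) i).le
  · exact Finset.sum_nonneg fun i _ => abs_nonneg _

/-! ### Lower bounds -/

theorem _root_.AbsolutelyContinuousOnInterval.apply {γ : ℝ → EuclideanSpace ℝ (Fin n)} {a b : ℝ}
    (hγ : AbsolutelyContinuousOnInterval γ a b) (j : Fin n) :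
    AbsolutelyContinuousOnInterval (fun t => γ t j) a b := by
  refine hγ.nonexpansive_comp (g := fun z : EuclideanSpace ℝ (Fin n) => z j) fun a b => ?_
  rw [dist_eq_norm, dist_eq_norm, ← PiLp.sub_apply]
  exact PiLp.norm_apply_le (a - b) j

theorem deriv_apply {γ : ℝ → EuclideanSpace ℝ (Fin n)} {t : ℝ} (hγ : DifferentiableAt ℝ γ t)
    (i : Fin n) : deriv (fun t => γ t i) t = deriv γ t i := by
  have := (EuclideanSpace.proj (𝕜 := ℝ) i).hasFDerivAt.comp_hasDerivAt t hγ.hasDerivAt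
  exact this.deriv

/-- Fundamental theorem of calculus for the absolutely continuous coordinate, whose derivative is at
most the coefficient times the speed. -/
theorem IsHorizontalCurve.abs_apply_sub_le {h m : ℕ} {x y : EuclideanSpace ℝ (Fin n)}
    {γ : ℝ → EuclideanSpace ℝ (Fin n)} (hγ : IsHorizontalCurve h m x y γ)
    (hfin : curveLength h m γ ≠ ∞) {i : Fin n} {M : ℝ}
    (hM : ∀ t ∈ Set.Icc (0 : ℝ) 1, coeff h m i (γ t) ≤ M) {t : ℝ} (ht : t ∈ Set.Icc (0 : ℝ) 1) :
    |γ t i - x i| ≤ M * (curveLength h m γ).toReal := by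
  have hM0 : 0 ≤ M := (coeff_nonneg h m i (γ 0)).trans (hM 0 ⟨le_rfl, zero_le_one⟩)
  have hAC : ∀ j, AbsolutelyContinuousOnInterval (fun t => γ t j) 0 1 := fun j =>
    hγ.absCont.apply j
  have hFTC := ((hAC i).mono (c := 0) (d := t) (by
    rw [Set.uIcc_of_le ht.1, Set.uIcc_of_le zero_le_one]
    exact Set.Icc_subset_Icc_right ht.2)).integral_deriv_eq_sub
  rw [hγ.source] at hFTC
  rw [← hFTC, intervalIntegral.integral_of_le ht.1, ← Real.norm_eq_abs]
  refine (norm_integral_le_lintegral_norm _).trans ?_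
  have hle : ∫⁻ τ in Set.Ioc 0 t, ENNReal.ofReal ‖deriv (fun t => γ t i) τ‖ ≤
      ENNReal.ofReal M * curveLength h m γ := by
    unfold curveLength
    rw [← lintegral_const_mul' _ _ ENNReal.ofReal_ne_top]
    refine (lintegral_mono_set (t := Set.Icc 0 1)
      (Set.Ioc_subset_Icc_self.trans (Set.Icc_subset_Icc_right ht.2))).trans ?_
    refine lintegral_mono_ae ?_
    rw [ae_restrict_iff' measurableSet_Icc]
    have hdiff : ∀ᵐ τ, ∀ j, τ ∈ Set.uIcc (0 : ℝ) 1 → DifferentiableAt ℝ (fun t => γ t j) τ :=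
      ae_all_iff.mpr fun j => (hAC j).ae_differentiableAt
    have hhor := hγ.horizontal
    rw [ae_restrict_iff' measurableSet_Icc] at hhor
    filter_upwards [hdiff, hhor] with τ hd hs hτ
    have hd' : DifferentiableAt ℝ γ τ := differentiableAt_euclidean.mpr fun j => hd j (by
      rwa [Set.uIcc_of_le zero_le_one])
    rw [deriv_apply hd', ← ENNReal.ofReal_mul hM0]
    refine ENNReal.ofReal_le_ofReal ((abs_apply_le_of_mem_span (hs hτ) i).trans ?_)
    exact mul_le_mul_of_nonneg_right (hM τ hτ) (tangentNorm_nonneg _ _ _ _)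
  refine (ENNReal.toReal_mono (ENNReal.mul_ne_top ENNReal.ofReal_ne_top hfin) hle).trans ?_
  rw [ENNReal.toReal_mul, ENNReal.toReal_ofReal hM0]

theorem IsHorizontalCurve.hNorm_le {h m : ℕ} {x y : EuclideanSpace ℝ (Fin n)}
    {γ : ℝ → EuclideanSpace ℝ (Fin n)} (hγ : IsHorizontalCurve h m x y γ)
    (hfin : curveLength h m γ ≠ ∞) {t : ℝ} (ht : t ∈ Set.Icc (0 : ℝ) 1) :
    hNorm h (γ t) ≤ hNorm h x + n * (curveLength h m γ).toReal := by
  refine (hNorm_le_add_sum h x (γ t)).trans (add_le_add le_rfl ?_)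
  calc _ ≤ ∑ _i : Fin n, (curveLength h m γ).toReal := by
        refine Finset.sum_le_sum fun i _ => ?_
        split_ifs with hi
        · simpa using hγ.abs_apply_sub_le hfin (i := i) (M := 1) (fun t _ => by simp [coeff, hi]) ht
        · exact ENNReal.toReal_nonneg
    _ = _ := by simp

theorem ccEDist_ne_top {h : ℕ} (m : ℕ) (hh : 1 ≤ h) (hn : h ≤ n)
    (x y : EuclideanSpace ℝ (Fin n)) : ccEDist h m x y ≠ ∞ :=
  ne_top_of_le_ne_top ENNReal.ofReal_ne_top (ccEDist_le m hh hn x y one_pos)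

theorem ccDist_nonneg (h m : ℕ) (x y : EuclideanSpace ℝ (Fin n)) : 0 ≤ ccDist h m x y :=
  ENNReal.toReal_nonneg

theorem ccDist_comm (h m : ℕ) (x y : EuclideanSpace ℝ (Fin n)) :
    ccDist h m x y = ccDist h m y x := by
  rw [ccDist_eq_toReal, ccEDist_comm, ccDist_eq_toReal]

theorem ccDist_triangle {h : ℕ} (m : ℕ) (hh : 1 ≤ h) (hn : h ≤ n)
    (x y z : EuclideanSpace ℝ (Fin n)) :
    ccDist h m x z ≤ ccDist h m x y + ccDist h m y z := by
  simp only [ccDist_eq_toReal]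
  rw [← ENNReal.toReal_add (ccEDist_ne_top m hh hn x y) (ccEDist_ne_top m hh hn y z)]
  exact ENNReal.toReal_mono (ENNReal.add_ne_top.mpr
    ⟨ccEDist_ne_top m hh hn x y, ccEDist_ne_top m hh hn y z⟩) (ccEDist_triangle h m x y z)

theorem ccDist_le {h : ℕ} (m : ℕ) (hh : 1 ≤ h) (hn : h ≤ n) (x y : EuclideanSpace ℝ (Fin n))
    {ρ : ℝ} (hρ : 0 < ρ) :
    ccDist h m x y ≤ 2 * ρ + ∑ i, |y i - x i| / weight h m ((hNorm h x + ρ) / 2) i := by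
  have hpos : 0 < (hNorm h x + ρ) / 2 := by linarith [hNorm_nonneg h x]
  refine ENNReal.toReal_le_of_le_ofReal (add_nonneg (by linarith) ?_) (ccEDist_le m hh hn x y hρ)
  exact Finset.sum_nonneg fun i _ => div_nonneg (abs_nonneg _) (weight_pos h m hpos i).le

/-- This puts balls inside anisotropic boxes: a curve of length less than `ρ` keeps `|γ|_h` below
`|x|_h + n ρ`, which bounds every coefficient along it. -/
theorem abs_sub_le_of_ccDist_lt {h : ℕ} (m : ℕ) (hh : 1 ≤ h) (hn : h ≤ n)
    {x y : EuclideanSpace ℝ (Fin n)} {ρ : ℝ} (hd : ccDist h m x y < ρ) (i : Fin n) :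
    |y i - x i| ≤ weight h m (hNorm h x + n * ρ) i * ρ := by
  have hρ : 0 < ρ := (ccDist_nonneg h m x y).trans_lt hd
  have h1 : ccEDist h m x y < ENNReal.ofReal ρ := by
    rwa [ENNReal.lt_ofReal_iff_toReal_lt (ccEDist_ne_top m hh hn x y)]
  obtain ⟨γ, hγ, hlen⟩ : ∃ γ, ∃ _ : IsHorizontalCurve h m x y γ,
      curveLength h m γ < ENNReal.ofReal ρ := by
    simpa only [ccEDist, iInf_lt_iff] using h1
  have hfin : curveLength h m γ ≠ ∞ := (hlen.trans ENNReal.ofReal_lt_top).ne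
  have hL : (curveLength h m γ).toReal ≤ ρ :=
    ENNReal.toReal_le_of_le_ofReal hρ.le hlen.le
  have hx0 := hNorm_nonneg h x
  have hw : 0 ≤ weight h m (hNorm h x + n * ρ) i := by
    unfold weight
    split_ifs <;> positivity
  have := hγ.abs_apply_sub_le hfin (i := i) (M := weight h m (hNorm h x + n * ρ) i)
    (fun t ht => by
      rw [coeff_eq_weight]
      refine weight_mono h m (hNorm_nonneg _ _) ((hγ.hNorm_le hfin ht).trans ?_) i
      gcongr) (t := 1) ⟨zero_le_one, le_rfl⟩
  rw [hγ.target] at this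
  exact this.trans (mul_le_mul_of_nonneg_left hL hw)

theorem abs_sub_le_ccDist {h : ℕ} (m : ℕ) (hh : 1 ≤ h) (hn : h ≤ n)
    (x y : EuclideanSpace ℝ (Fin n)) {i : Fin n} (hi : (i : ℕ) < h) :
    |y i - x i| ≤ ccDist h m x y := by
  refine le_of_forall_gt_imp_ge_of_dense fun ρ hρ => ?_
  simpa [weight, hi] using abs_sub_le_of_ccDist_lt m hh hn hρ i

theorem ccDist_pos {h : ℕ} (m : ℕ) (hh : 1 ≤ h) (hn : h ≤ n) {x y : EuclideanSpace ℝ (Fin n)}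
    (hxy : x ≠ y) : 0 < ccDist h m x y := by
  refine lt_of_le_of_ne (ccDist_nonneg h m x y) fun h0 => hxy ?_
  ext i
  -- At distance 0 the box estimate holds for every `ρ > 0`, and its right side tends to 0.
  have hlim : Filter.Tendsto (fun ρ : ℝ => weight h m (hNorm h x + n * ρ) i * ρ)
      (nhdsWithin 0 (Set.Ioi 0)) (nhds (weight h m (hNorm h x + n * 0) i * 0)) := by
    refine Filter.Tendsto.mono_left (Continuous.tendsto ?_ 0) nhdsWithin_le_nhds
    unfold weight
    split_ifs <;> fun_prop
  rw [mul_zero] at hlim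
  have h1 : |y i - x i| ≤ 0 := by
    refine ge_of_tendsto hlim ?_
    filter_upwards [self_mem_nhdsWithin] with ρ hρ
    exact abs_sub_le_of_ccDist_lt m hh hn (by rw [← h0]; exact hρ) i
  have h2 := abs_nonpos_iff.mp h1
  linarith

/-- Supplies points at every prescribed distance from a centre, so that a ball determines its
radius. -/
theorem ccDist_add_single {h : ℕ} (m : ℕ) (hh : 1 ≤ h) (hn : h ≤ n)
    (x : EuclideanSpace ℝ (Fin n)) {i : Fin n} (hi : (i : ℕ) < h) (t : ℝ) :
    ccDist h m x (x + EuclideanSpace.single i t) = |t| := by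
  refine le_antisymm ?_ ?_
  · refine ENNReal.toReal_le_of_le_ofReal (abs_nonneg t)
      ((ccEDist_add_le_of_first h m x _ fun j hj => ?_).trans ?_)
    · rw [PiLp.single_apply, if_neg]
      rintro rfl
      exact hj hi
    · refine ENNReal.ofReal_le_ofReal (le_of_eq ?_)
      simp only [PiLp.single_apply]
      rw [Finset.sum_eq_single i] <;> simp +contextual
  · simpa [PiLp.single_apply] using
      abs_sub_le_ccDist m hh hn x (x + EuclideanSpace.single i t) hi

theorem tendsto_ccDist {h : ℕ} (m : ℕ) (hh : 1 ≤ h) (hn : h ≤ n)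
    (x : EuclideanSpace ℝ (Fin n)) :
    Filter.Tendsto (fun y => ccDist h m x y) (nhds x) (nhds 0) := by
  rw [tendsto_order]
  refine ⟨fun a ha => Filter.Eventually.of_forall fun y => ha.trans_le (ccDist_nonneg h m x y),
    fun ε hε => ?_⟩
  have hlim : Filter.Tendsto (fun y : EuclideanSpace ℝ (Fin n) =>
      2 * (ε / 4) + ∑ i, |y i - x i| / weight h m ((hNorm h x + ε / 4) / 2) i) (nhds x)
      (nhds (2 * (ε / 4) + ∑ i, |x i - x i| / weight h m ((hNorm h x + ε / 4) / 2) i)) := by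
    refine Continuous.tendsto ?_ x
    fun_prop
  simp only [sub_self, abs_zero, zero_div, Finset.sum_const_zero, add_zero] at hlim
  filter_upwards [hlim.eventually_lt_const (show 2 * (ε / 4) < ε by linarith)] with y hy
  exact (ccDist_le m hh hn x y (by linarith)).trans_lt hy

theorem continuous_ccDist {h : ℕ} (m : ℕ) (hh : 1 ≤ h) (hn : h ≤ n) :
    Continuous fun z : EuclideanSpace ℝ (Fin n) × EuclideanSpace ℝ (Fin n) =>
      ccDist h m z.1 z.2 := by
  rw [continuous_iff_continuousAt]
  rintro ⟨x, y⟩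
  rw [ContinuousAt, tendsto_iff_dist_tendsto_zero]
  have h1 : Filter.Tendsto (fun z : EuclideanSpace ℝ (Fin n) × EuclideanSpace ℝ (Fin n) =>
      ccDist h m x z.1 + ccDist h m y z.2) (nhds (x, y)) (nhds (0 + 0)) :=
    ((tendsto_ccDist m hh hn x).comp (continuous_fst.tendsto (x, y))).add
      ((tendsto_ccDist m hh hn y).comp (continuous_snd.tendsto (x, y)))
  rw [add_zero] at h1
  refine squeeze_zero (fun _ => dist_nonneg) (fun z => ?_) h1
  rw [Real.dist_eq, abs_le]
  have t1 := ccDist_triangle m hh hn x z.1 y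
  have t2 := ccDist_triangle m hh hn z.1 z.2 y
  have t3 := ccDist_triangle m hh hn z.1 x z.2
  have t4 := ccDist_triangle m hh hn x y z.2
  rw [ccDist_comm h m z.2 y] at t2
  rw [ccDist_comm h m z.1 x] at t3
  constructor <;> linarith

theorem measurable_ccDist {h : ℕ} (m : ℕ) (hh : 1 ≤ h) (hn : h ≤ n) :
    Measurable fun z : EuclideanSpace ℝ (Fin n) × EuclideanSpace ℝ (Fin n) =>
      ccDist h m z.1 z.2 :=
  (continuous_ccDist m hh hn).measurable

theorem measurableSet_ccBall {h : ℕ} (m : ℕ) (hh : 1 ≤ h) (hn : h ≤ n)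
    (x₀ : EuclideanSpace ℝ (Fin n)) (r : ℝ) : MeasurableSet (ccBall h m x₀ r) := by
  have h1 := (measurable_ccDist m hh hn).comp
    (measurable_id.prodMk (measurable_const (a := x₀)))
  exact measurableSet_lt h1 measurable_const

/-- Inclusion of concentric balls is inclusion of radii. -/
theorem le_of_ccBall_subset {h : ℕ} (m : ℕ) (hh : 1 ≤ h) (hn : h ≤ n)
    {x₀ : EuclideanSpace ℝ (Fin n)} {r ρ : ℝ} (hρ : 0 ≤ ρ)
    (hsub : ccBall h m x₀ r ⊆ ccBall h m x₀ ρ) : r ≤ ρ := by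
  by_contra! hlt
  have hi : ((⟨0, by omega⟩ : Fin n) : ℕ) < h := by simp; omega
  have hd := ccDist_add_single m hh hn x₀ hi ρ
  rw [ccDist_comm, abs_of_nonneg hρ] at hd
  have := hsub (show x₀ + EuclideanSpace.single _ ρ ∈ ccBall h m x₀ r from hd.trans_lt hlt)
  exact absurd hd (ne_of_lt this)

/-! ### Volumes of balls -/

theorem volume_box (x : EuclideanSpace ℝ (Fin n)) (w : Fin n → ℝ) :
    volume {y : EuclideanSpace ℝ (Fin n) | ∀ i, |y i - x i| ≤ w i} =
      ∏ i, ENNReal.ofReal (2 * w i) := by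
  have h1 : {y : EuclideanSpace ℝ (Fin n) | ∀ i, |y i - x i| ≤ w i} =
      (@WithLp.ofLp 2 (Fin n → ℝ)) ⁻¹' Set.Icc (fun i => x i - w i) (fun i => x i + w i) := by
    ext y
    simp only [Set.mem_ofPred_eq, Set.mem_preimage, Set.mem_Icc, Pi.le_def, abs_le, ← forall_and]
    refine forall_congr' fun i => ?_
    constructor <;> rintro ⟨h1, h2⟩ <;> constructor <;> linarith
  rw [h1, (PiLp.volume_preserving_ofLp (Fin n)).measure_preimage
    measurableSet_Icc.nullMeasurableSet, Real.volume_Icc_pi]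
  refine Finset.prod_congr rfl fun i _ => ?_
  congr 1
  ring

theorem prod_weight {h : ℕ} (m : ℕ) (hn : h ≤ n) (ρ : ℝ) :
    ∏ i : Fin n, weight h m ρ i = ρ ^ (m * (n - h)) := by
  unfold weight
  rw [Fin.prod_univ_eq_prod_range (fun i => if i < h then (1 : ℝ) else ρ ^ m) n]
  obtain ⟨k, rfl⟩ := Nat.exists_eq_add_of_le hn
  rw [Finset.prod_range_add]
  rw [Finset.prod_congr rfl (g := fun _ => (1 : ℝ))]
  · simp [pow_mul]
  · intro i hi
    simp [Finset.mem_range.mp hi]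

theorem prod_ofReal_weight {h : ℕ} (m : ℕ) (hn : h ≤ n) {A ρ : ℝ} (hA : 0 ≤ A) (hρ : 0 < ρ) :
    ∏ i : Fin n, ENNReal.ofReal (2 * (weight h m ρ i * A)) =
      ENNReal.ofReal ((2 * A) ^ n * ρ ^ (m * (n - h))) := by
  rw [← ENNReal.ofReal_prod_of_nonneg fun i _ =>
    mul_nonneg zero_le_two (mul_nonneg (weight_pos h m hρ i).le hA)]
  congr 1
  rw [← prod_weight m hn ρ]
  simp only [mul_comm _ A, ← mul_assoc]
  rw [Finset.prod_mul_distrib]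
  simp

theorem volume_ccBall_le {h : ℕ} (m : ℕ) (hh : 1 ≤ h) (hn : h ≤ n)
    (x₀ : EuclideanSpace ℝ (Fin n)) {r : ℝ} (hr : 0 < r) :
    volume (ccBall h m x₀ r) ≤ ENNReal.ofReal
      (2 ^ n * (n : ℝ) ^ (m * (n - h)) * (r ^ n * (hNorm h x₀ + r) ^ (m * (n - h)))) := by
  have hx := hNorm_nonneg h x₀
  have hn1 : (1 : ℝ) ≤ n := by exact_mod_cast hh.trans hn
  calc volume (ccBall h m x₀ r)
      ≤ volume {y : EuclideanSpace ℝ (Fin n) |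
          ∀ i, |y i - x₀ i| ≤ weight h m (hNorm h x₀ + n * r) i * r} := by
        refine measure_mono fun y hy i => abs_sub_le_of_ccDist_lt m hh hn ?_ i
        rw [ccDist_comm]
        exact hy
    _ = ENNReal.ofReal ((2 * r) ^ n * (hNorm h x₀ + n * r) ^ (m * (n - h))) := by
        rw [volume_box, prod_ofReal_weight m hn hr.le (by positivity)]
    _ ≤ _ := by
        refine ENNReal.ofReal_le_ofReal ?_
        have : hNorm h x₀ + n * r ≤ n * (hNorm h x₀ + r) := by nlinarith
        calc (2 * r) ^ n * (hNorm h x₀ + n * r) ^ (m * (n - h))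
            ≤ (2 * r) ^ n * (n * (hNorm h x₀ + r)) ^ (m * (n - h)) := by gcongr
          _ = _ := by rw [mul_pow, mul_pow]; ring

theorem volume_ccBall_ge {h : ℕ} (m : ℕ) (hh : 1 ≤ h) (hn : h ≤ n)
    (x₀ : EuclideanSpace ℝ (Fin n)) {r : ℝ} (hr : 0 < r) :
    ENNReal.ofReal ((1 / (n : ℝ)) ^ n * (1 / 16) ^ (m * (n - h)) *
      (r ^ n * (hNorm h x₀ + r) ^ (m * (n - h)))) ≤ volume (ccBall h m x₀ r) := by
  have hx := hNorm_nonneg h x₀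
  have hn0 : (0 : ℝ) < n := by exact_mod_cast (hh.trans hn : 0 < n)
  -- `ccDist_le` is used with `ρ = r / 8` and a box of sides `r / (2 n)` times the weights: the
  -- total is at most `r / 4 + r / 2 < r`.
  have hpos : 0 < (hNorm h x₀ + r / 8) / 2 := by positivity
  calc _ ≤ ENNReal.ofReal
        ((2 * (r / (2 * n))) ^ n * ((hNorm h x₀ + r / 8) / 2) ^ (m * (n - h))) := by
        refine ENNReal.ofReal_le_ofReal ?_
        have h1 : 1 / 16 * (hNorm h x₀ + r) ≤ (hNorm h x₀ + r / 8) / 2 := by linarith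
        calc (1 / (n : ℝ)) ^ n * (1 / 16) ^ (m * (n - h)) *
              (r ^ n * (hNorm h x₀ + r) ^ (m * (n - h)))
            = (1 / n * r) ^ n * (1 / 16 * (hNorm h x₀ + r)) ^ (m * (n - h)) := by
              rw [mul_pow, mul_pow]; ring
          _ ≤ (1 / n * r) ^ n * ((hNorm h x₀ + r / 8) / 2) ^ (m * (n - h)) := by gcongr
          _ = _ := by congr 2; field_simp
    _ = volume {y : EuclideanSpace ℝ (Fin n) |
          ∀ i, |y i - x₀ i| ≤ weight h m ((hNorm h x₀ + r / 8) / 2) i * (r / (2 * n))} := by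
        rw [volume_box, prod_ofReal_weight m hn (by positivity) hpos]
    _ ≤ volume (ccBall h m x₀ r) := by
        refine measure_mono fun y hy => ?_
        change ccDist h m y x₀ < r
        rw [ccDist_comm]
        refine (ccDist_le m hh hn x₀ y (show 0 < r / 8 by positivity)).trans_lt ?_
        have : ∑ i, |y i - x₀ i| / weight h m ((hNorm h x₀ + r / 8) / 2) i ≤
            ∑ _i : Fin n, r / (2 * n) :=
          Finset.sum_le_sum fun i _ => (div_le_iff₀' (weight_pos h m hpos i)).mpr (hy i)
        have h2 : ∑ _i : Fin n, r / (2 * n) = r / 2 := by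
          simp only [Finset.sum_const, Finset.card_univ, Fintype.card_fin, nsmul_eq_mul]
          field_simp
        linarith

theorem volume_ccBall_lt_top {h : ℕ} (m : ℕ) (hh : 1 ≤ h) (hn : h ≤ n)
    (x₀ : EuclideanSpace ℝ (Fin n)) {r : ℝ} (hr : 0 < r) : volume (ccBall h m x₀ r) < ∞ :=
  (volume_ccBall_le m hh hn x₀ hr).trans_lt ENNReal.ofReal_lt_top

/-! ### Integrals of powers of the distance -/

theorem rpow_le_of_mem_Icc {t τ α : ℝ} (ht : 0 < t) (h1 : t ≤ τ) (h2 : τ ≤ 2 * t) :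
    τ ^ α ≤ 2 ^ |α| * t ^ α := by
  have hτ : 0 < τ := ht.trans_le h1
  have h3 : 1 ≤ τ / t := (one_le_div ht).mpr h1
  have h4 : τ / t ≤ 2 := (div_le_iff₀ ht).mpr h2
  have h5 : (τ / t) ^ α ≤ 2 ^ |α| :=
    (Real.rpow_le_rpow_of_exponent_le h3 (le_abs_self α)).trans
      (Real.rpow_le_rpow (by positivity) h4 (abs_nonneg α))
  calc τ ^ α = (τ / t) ^ α * t ^ α := by
        rw [← Real.mul_rpow (by positivity) ht.le, div_mul_cancel₀ _ ht.ne']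
    _ ≤ _ := by gcongr

/-- On a shell the power is comparable to `t ^ α`, and the shell lies in the open ball of radius `3
t`. -/
theorem lintegral_shell_le {h : ℕ} (m : ℕ) (hh : 1 ≤ h) (hn : h ≤ n) (α : ℝ) :
    ∃ C : ℝ, 0 < C ∧ ∀ (x : EuclideanSpace ℝ (Fin n)) (t : ℝ), 0 < t →
      ∫⁻ y in {y | t ≤ ccDist h m x y ∧ ccDist h m x y ≤ 2 * t},
        ENNReal.ofReal (ccDist h m x y ^ α) ≤
        ENNReal.ofReal (C * (t ^ (α + n) * (hNorm h x + t) ^ (m * (n - h)))) := by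
  have hn0 : (0 : ℝ) < n := by exact_mod_cast (hh.trans hn : 0 < n)
  refine ⟨2 ^ |α| * (2 ^ n * (n : ℝ) ^ (m * (n - h)) * (3 ^ n * 3 ^ (m * (n - h)))),
    by positivity, fun x t ht => ?_⟩
  have hx := hNorm_nonneg h x
  have hmeas : MeasurableSet {y | t ≤ ccDist h m x y ∧ ccDist h m x y ≤ 2 * t} := by
    have h1 := (measurable_ccDist m hh hn).comp
      ((measurable_const (a := x)).prodMk measurable_id)
    exact (measurableSet_le measurable_const h1).inter (measurableSet_le h1 measurable_const)
  calc _ ≤ ∫⁻ y in {y | t ≤ ccDist h m x y ∧ ccDist h m x y ≤ 2 * t},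
        ENNReal.ofReal (2 ^ |α| * t ^ α) :=
        setLIntegral_mono' hmeas fun y hy =>
          ENNReal.ofReal_le_ofReal (rpow_le_of_mem_Icc ht hy.1 hy.2)
    _ = ENNReal.ofReal (2 ^ |α| * t ^ α) *
          volume {y | t ≤ ccDist h m x y ∧ ccDist h m x y ≤ 2 * t} := by
        rw [setLIntegral_const]
    _ ≤ ENNReal.ofReal (2 ^ |α| * t ^ α) * ENNReal.ofReal (2 ^ n * (n : ℝ) ^ (m * (n - h)) *
          ((3 * t) ^ n * (hNorm h x + 3 * t) ^ (m * (n - h)))) := by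
        gcongr
        refine (measure_mono fun y hy => ?_).trans
          (volume_ccBall_le m hh hn x (show 0 < 3 * t by positivity))
        change ccDist h m y x < 3 * t
        rw [ccDist_comm]
        linarith [hy.2]
    _ = ENNReal.ofReal (2 ^ |α| * t ^ α * (2 ^ n * (n : ℝ) ^ (m * (n - h)) *
          ((3 * t) ^ n * (hNorm h x + 3 * t) ^ (m * (n - h))))) := by
        rw [← ENNReal.ofReal_mul (by positivity)]
    _ ≤ _ := by
        refine ENNReal.ofReal_le_ofReal ?_
        calc _ ≤ 2 ^ |α| * t ^ α * (2 ^ n * (n : ℝ) ^ (m * (n - h)) *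
              ((3 * t) ^ n * (3 * (hNorm h x + t)) ^ (m * (n - h)))) := by
              gcongr
              linarith
          _ = _ := by
              rw [Real.rpow_add ht, Real.rpow_natCast, mul_pow, mul_pow]
              ring

/-- The shells cover `S` up to the centre, a null set since `n ≠ 0`, and their contributions are
dominated by a geometric series. -/
theorem lintegral_rpow_le_of_shells {h : ℕ} {m : ℕ} {α C M q : ℝ}
    (hC : 0 ≤ C) (hM : 0 ≤ M) (hq : 0 ≤ q) (hq1 : q < 1) {x : EuclideanSpace ℝ (Fin n)}
    (hn : n ≠ 0)
    (hshell : ∀ t : ℝ, 0 < t → ∫⁻ y in {y | t ≤ ccDist h m x y ∧ ccDist h m x y ≤ 2 * t},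
        ENNReal.ofReal (ccDist h m x y ^ α) ≤
        ENNReal.ofReal (C * (t ^ (α + n) * (hNorm h x + t) ^ (m * (n - h)))))
    {t : ℕ → ℝ} (ht : ∀ k, 0 < t k)
    (hgeom : ∀ k, t k ^ (α + n) * (hNorm h x + t k) ^ (m * (n - h)) ≤ M * q ^ k)
    {S : Set (EuclideanSpace ℝ (Fin n))}
    (hS : ∀ y ∈ S, y ≠ x → ∃ k, t k ≤ ccDist h m x y ∧ ccDist h m x y ≤ 2 * t k) :
    ∫⁻ y in S, ENNReal.ofReal (ccDist h m x y ^ α) ≤ ENNReal.ofReal (C / (1 - q) * M) := by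
  have : Nonempty (Fin n) := ⟨⟨0, Nat.pos_of_ne_zero hn⟩⟩
  have hsub : S ⊆ {x} ∪ ⋃ k, {y | t k ≤ ccDist h m x y ∧ ccDist h m x y ≤ 2 * t k} := by
    intro y hy
    by_cases hyx : y = x
    · exact Or.inl hyx
    · exact Or.inr (Set.mem_iUnion.mpr (hS y hy hyx))
  calc _ ≤ ∫⁻ y in {x} ∪ ⋃ k, {y | t k ≤ ccDist h m x y ∧ ccDist h m x y ≤ 2 * t k},
        ENNReal.ofReal (ccDist h m x y ^ α) := lintegral_mono_set hsub
    _ ≤ 0 + ∑' k, ∫⁻ y in {y | t k ≤ ccDist h m x y ∧ ccDist h m x y ≤ 2 * t k},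
        ENNReal.ofReal (ccDist h m x y ^ α) := by
        refine (lintegral_union_le _ _ _).trans (add_le_add (le_of_eq ?_) (lintegral_iUnion_le _ _))
        rw [Measure.restrict_singleton]
        simp
    _ ≤ ∑' k, ENNReal.ofReal (C * (M * q ^ k)) := by
        rw [zero_add]
        refine ENNReal.tsum_le_tsum fun k => (hshell _ (ht k)).trans ?_
        exact ENNReal.ofReal_le_ofReal (mul_le_mul_of_nonneg_left (hgeom k) hC)
    _ = ENNReal.ofReal (∑' k, C * (M * q ^ k)) := by
        rw [ENNReal.ofReal_tsum_of_nonneg fun k => by positivity]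
        exact ((summable_geometric_of_lt_one hq hq1).mul_left M).mul_left C
    _ = _ := by
        rw [tsum_mul_left, tsum_mul_left, tsum_geometric_of_lt_one hq hq1]
        congr 1
        ring

/-- For shrinking shells the factor `(|x|_h + t) ^ (m (n - h))` need not decay, as `|x|_h` may be
positive, so it is frozen at `t = ρ` and `t ^ (α + n)` alone must give convergence. -/
theorem lintegral_rpow_ball_le {h : ℕ} (m : ℕ) (hh : 1 ≤ h) (hn : h ≤ n) {α : ℝ}
    (hα : 0 < α + n) :
    ∃ C : ℝ, 0 < C ∧ ∀ (x : EuclideanSpace ℝ (Fin n)) (ρ : ℝ), 0 < ρ →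
      ∫⁻ y in {y | ccDist h m x y < ρ}, ENNReal.ofReal (ccDist h m x y ^ α) ≤
        ENNReal.ofReal (C * (ρ ^ (α + n) * (hNorm h x + ρ) ^ (m * (n - h)))) := by
  obtain ⟨C, hC, hshell⟩ := lintegral_shell_le m hh hn α
  have hq : (2 : ℝ)⁻¹ ^ (α + n) < 1 :=
    Real.rpow_lt_one (by norm_num) (by norm_num) hα
  refine ⟨C / (1 - (2 : ℝ)⁻¹ ^ (α + n)), div_pos hC (by linarith), fun x ρ hρ => ?_⟩
  have hx := hNorm_nonneg h x
  refine lintegral_rpow_le_of_shells (t := fun k => ρ * (2 : ℝ)⁻¹ ^ (k + 1)) hC.le (by positivity)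
    (by positivity) hq (by omega) (hshell x) (fun k => by positivity) (fun k => ?_) ?_
  · have h1 : (2 : ℝ)⁻¹ ^ (k + 1) ≤ 1 := pow_le_one₀ (by norm_num) (by norm_num)
    have h2 : ρ * (2 : ℝ)⁻¹ ^ (k + 1) ≤ ρ * (2 : ℝ)⁻¹ ^ k := by
      gcongr ρ * ?_
      exact pow_le_pow_of_le_one (by norm_num) (by norm_num) (Nat.le_succ k)
    calc (ρ * (2 : ℝ)⁻¹ ^ (k + 1)) ^ (α + n) *
          (hNorm h x + ρ * (2 : ℝ)⁻¹ ^ (k + 1)) ^ (m * (n - h))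
        ≤ (ρ * (2 : ℝ)⁻¹ ^ k) ^ (α + n) * (hNorm h x + ρ) ^ (m * (n - h)) := by
          gcongr
          nlinarith
      _ = _ := by
          rw [Real.mul_rpow hρ.le (by positivity), Real.rpow_pow_comm (by norm_num)]
          ring
  · intro y hy hyx
    have hd := ccDist_pos m hh hn (Ne.symm hyx)
    have hlt : ccDist h m x y < ρ := hy
    obtain ⟨k, hk1, hk2⟩ := exists_nat_pow_near_of_lt_one (x := ccDist h m x y / ρ)
      (y := (2 : ℝ)⁻¹) (by positivity) ((div_le_one hρ).mpr hlt.le) (by norm_num) (by norm_num)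
    rw [lt_div_iff₀ hρ] at hk1
    rw [div_le_iff₀ hρ] at hk2
    refine ⟨k, by linarith, hk2.trans (le_of_eq ?_)⟩
    rw [pow_succ]; ring

/-- For growing shells the factor `(|x|_h + t) ^ (m (n - h))` may grow by `2 ^ (m (n - h))` at each
step; the condition on `α` includes this growth. -/
theorem lintegral_rpow_compl_ball_le {h : ℕ} (m : ℕ) (hh : 1 ≤ h) (hn : h ≤ n) {α : ℝ}
    (hα : α + n + (m * (n - h) : ℕ) < 0) :
    ∃ C : ℝ, 0 < C ∧ ∀ (x : EuclideanSpace ℝ (Fin n)) (ρ : ℝ), 0 < ρ →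
      ∫⁻ y in {y | ρ ≤ ccDist h m x y}, ENNReal.ofReal (ccDist h m x y ^ α) ≤
        ENNReal.ofReal (C * (ρ ^ (α + n) * (hNorm h x + ρ) ^ (m * (n - h)))) := by
  obtain ⟨C, hC, hshell⟩ := lintegral_shell_le m hh hn α
  have hq : (2 : ℝ) ^ (α + n + (m * (n - h) : ℕ)) < 1 :=
    Real.rpow_lt_one_of_one_lt_of_neg (by norm_num) hα
  refine ⟨C / (1 - (2 : ℝ) ^ (α + n + (m * (n - h) : ℕ))), div_pos hC (by linarith),
    fun x ρ hρ => ?_⟩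
  have hx := hNorm_nonneg h x
  refine lintegral_rpow_le_of_shells (t := fun k => ρ * 2 ^ k) hC.le (by positivity)
    (by positivity) hq (by omega) (hshell x) (fun k => by positivity) (fun k => ?_) ?_
  · have h1 : (1 : ℝ) ≤ 2 ^ k := one_le_pow₀ (by norm_num)
    calc (ρ * 2 ^ k) ^ (α + n) * (hNorm h x + ρ * 2 ^ k) ^ (m * (n - h))
        ≤ (ρ * 2 ^ k) ^ (α + n) * (2 ^ k * (hNorm h x + ρ)) ^ (m * (n - h)) := by
          gcongr
          nlinarith
      _ = _ := by
          rw [Real.mul_rpow hρ.le (by positivity), mul_pow, Real.rpow_add (by norm_num)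
            (α + n) ((m * (n - h) : ℕ) : ℝ), Real.rpow_natCast, mul_pow,
            Real.rpow_pow_comm zero_le_two, pow_right_comm]
          ring
  · intro y hy _
    have hle : ρ ≤ ccDist h m x y := hy
    obtain ⟨k, hk1, hk2⟩ := exists_nat_pow_near (x := ccDist h m x y / ρ)
      (y := (2 : ℝ)) ((one_le_div hρ).mpr hle) (by norm_num)
    rw [le_div_iff₀ hρ] at hk1
    rw [div_lt_iff₀ hρ] at hk2
    refine ⟨k, by linarith, hk2.le.trans (le_of_eq ?_)⟩
    rw [pow_succ]; ring

/-! ### Pointwise inequalities -/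

theorem add_rpow_le_two_rpow_mul {s t q : ℝ} (hs : 0 ≤ s) (ht : 0 ≤ t) (hq : 0 ≤ q) :
    (s + t) ^ q ≤ 2 ^ q * (s ^ q + t ^ q) := by
  have h1 : s + t ≤ 2 * max s t := by
    linarith [le_max_left s t, le_max_right s t]
  have h2 : (max s t) ^ q ≤ s ^ q + t ^ q := by
    have := Real.rpow_nonneg hs q
    have := Real.rpow_nonneg ht q
    rcases max_choice s t with h | h <;> rw [h] <;> linarith
  calc (s + t) ^ q ≤ (2 * max s t) ^ q := Real.rpow_le_rpow (by positivity) h1 hq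
    _ = 2 ^ q * (max s t) ^ q := Real.mul_rpow zero_le_two (le_max_of_le_left hs)
    _ ≤ _ := by gcongr

/-- At `w = 0` the value of `0 ^ (p - 2)` is irrelevant because it is multiplied by 0, and `0 ^ (p -
1) = 0`. -/
theorem abs_rpow_sub_two_mul_self {p w : ℝ} (hp : 1 < p) (hw : 0 ≤ w) :
    |w| ^ (p - 2) * w = w ^ (p - 1) := by
  rcases hw.eq_or_lt with rfl | hw
  · rw [mul_zero, Real.zero_rpow (by linarith)]
  · rw [abs_of_pos hw, show p - 1 = p - 2 + 1 by ring, Real.rpow_add_one hw.ne']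

theorem abs_abs_rpow_mul_mul_le {p : ℝ} (hp : 1 < p) (w z : ℝ) :
    |(|w| ^ (p - 2) * w * z)| ≤ |w| ^ p + |z| ^ p := by
  have h0 : |(|w| ^ (p - 2) * w * z)| = |w| ^ (p - 1) * |z| := by
    rw [abs_mul, abs_mul, abs_of_nonneg (Real.rpow_nonneg (abs_nonneg w) _),
      ← abs_rpow_sub_two_mul_self hp (abs_nonneg w), abs_abs]
  have key : ∀ a : ℝ, 0 ≤ a → a ^ (p - 1) * a = a ^ p := fun a ha => by
    rw [← Real.rpow_add_one' ha (by linarith)]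
    congr 1; ring
  have hw := Real.rpow_nonneg (abs_nonneg w) p
  have hz := Real.rpow_nonneg (abs_nonneg z) p
  rw [h0]
  rcases le_total |w| |z| with h | h
  · calc |w| ^ (p - 1) * |z| ≤ |z| ^ (p - 1) * |z| := by
          gcongr
      _ = |z| ^ p := key _ (abs_nonneg z)
      _ ≤ _ := by linarith
  · calc |w| ^ (p - 1) * |z| ≤ |w| ^ (p - 1) * |w| := by gcongr
      _ = |w| ^ p := key _ (abs_nonneg w)
      _ ≤ _ := by linarith

/-- A discrete Picone inequality. -/
theorem discrete_picone_of_le {p a b α β : ℝ} (hp : 1 < p) (hb : 0 < b) (hab : b ≤ a)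
    (hα : 0 ≤ α) (hβ : 0 ≤ β) :
    (a - b) ^ (p - 1) * (α ^ p * a ^ (1 - p) - β ^ p * b ^ (1 - p)) ≤ |α - β| ^ p := by
  have ha : 0 < a := hb.trans_le hab
  have hR : 0 ≤ |α - β| ^ p := Real.rpow_nonneg (abs_nonneg _) p
  -- For `α ≤ β` the bracket is nonpositive, and nothing remains to be proved.
  rcases le_or_gt α β with hle | hlt
  · refine le_trans (mul_nonpos_of_nonneg_of_nonpos
      (Real.rpow_nonneg (by linarith) _) (sub_nonpos.mpr ?_)) hR
    exact mul_le_mul (Real.rpow_le_rpow hα hle (by linarith))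
      (Real.rpow_le_rpow_of_nonpos hb hab (by linarith)) (by positivity) (by positivity)
  rcases hab.eq_or_lt with rfl | hab
  · rw [sub_self, Real.zero_rpow (by linarith), zero_mul]
    exact hR
  obtain ⟨l, rfl⟩ : ∃ l, b = l * a := ⟨b / a, by field_simp⟩
  have hl : 0 < l := by
    by_contra! h
    exact absurd hb (not_lt.mpr (mul_nonpos_of_nonpos_of_nonneg h ha.le))
  have hl1 : 0 < 1 - l := by nlinarith
  -- With `l = b / a`, convexity of the `p`-th power at `α = l (β / l) + (1 - l) ((α - β) / (1 -
  -- l))` gives `α ^ p ≤ l ^ (1 - p) β ^ p + (1 - l) ^ (1 - p) (α - β) ^ p`; multiplication by `(1 -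
  -- l) ^ (p - 1)` is the claim.
  have hconv := (convexOn_rpow hp.le).2 (x := β / l) (y := (α - β) / (1 - l))
    (Set.mem_Ici.mpr (by positivity))
    (Set.mem_Ici.mpr (div_nonneg (by linarith) hl1.le)) hl.le hl1.le (by ring)
  simp only [smul_eq_mul] at hconv
  rw [mul_div_cancel₀ _ hl.ne', mul_div_cancel₀ _ hl1.ne', add_sub_cancel,
    Real.div_rpow hβ hl.le, Real.div_rpow (by linarith) hl1.le] at hconv
  have pw : ∀ x : ℝ, 0 < x → ∀ z : ℝ, x * (z / x ^ p) = x ^ (1 - p) * z := fun x hx z => by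
    rw [Real.rpow_sub hx, Real.rpow_one]; ring
  have inv : ∀ x : ℝ, 0 < x → x ^ (p - 1) * x ^ (1 - p) = 1 := fun x hx => by
    rw [← Real.rpow_add hx]; simp
  rw [pw l hl, pw _ hl1] at hconv
  rw [show a - l * a = (1 - l) * a by ring, Real.mul_rpow hl1.le ha.le, Real.mul_rpow hl.le ha.le,
    abs_of_pos (by linarith : 0 < α - β)]
  have hθ : 0 < (1 - l) ^ (p - 1) := Real.rpow_pos_of_pos hl1 _
  have h1 := mul_le_mul_of_nonneg_left hconv hθ.le
  calc (1 - l) ^ (p - 1) * a ^ (p - 1) *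
        (α ^ p * a ^ (1 - p) - β ^ p * (l ^ (1 - p) * a ^ (1 - p)))
      = (a ^ (p - 1) * a ^ (1 - p)) *
          ((1 - l) ^ (p - 1) * α ^ p - (1 - l) ^ (p - 1) * (l ^ (1 - p) * β ^ p)) := by ring
    _ ≤ ((1 - l) ^ (p - 1) * (1 - l) ^ (1 - p)) * (α - β) ^ p := by
        rw [inv a ha, one_mul]
        linarith
    _ = _ := by rw [inv _ hl1, one_mul]

/-- With `τ = log (a / b)` the right side is `(e^τ - 1) ^ (p - 1) (1 - e^(-(p - 1) τ))`. The
inequality `2 x ≤ e^x - e^(-x)` bounds the factors below by `τ ^ (p - 1) e^((p - 1) τ / 2)` and `(p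
- 1) τ e^(-(p - 1) τ / 2)`, whose exponentials cancel. -/
theorem log_rpow_le_of_le {p a b : ℝ} (hp : 1 < p) (hb : 0 < b) (hab : b ≤ a) :
    (p - 1) * (Real.log a - Real.log b) ^ p ≤
      (a - b) ^ (p - 1) * (b ^ (1 - p) - a ^ (1 - p)) := by
  have ha : 0 < a := hb.trans_le hab
  set τ := Real.log a - Real.log b with hτ
  have hτ0 : 0 ≤ τ := sub_nonneg.mpr (Real.log_le_log hb hab)
  have haτ : a = Real.exp τ * b := by
    rw [hτ, Real.exp_sub, Real.exp_log ha, Real.exp_log hb]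
    field_simp
  clear_value τ
  have hsinh : ∀ x : ℝ, 0 ≤ x → 2 * x ≤ Real.exp x - Real.exp (-x) := fun x hx => by
    have := Real.self_le_sinh_iff.mpr hx
    rw [Real.sinh_eq] at this
    linarith
  have h1 : τ * Real.exp (τ / 2) ≤ Real.exp τ - 1 := by
    have h2 := mul_le_mul_of_nonneg_right (hsinh (τ / 2) (by positivity)) (Real.exp_pos (τ / 2)).le
    rw [sub_mul, ← Real.exp_add, ← Real.exp_add, add_halves, neg_add_cancel, Real.exp_zero] at h2
    linarith
  have h3 : τ ^ (p - 1) * Real.exp ((p - 1) * τ / 2) ≤ (Real.exp τ - 1) ^ (p - 1) := by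
    have h4 := Real.rpow_le_rpow (by positivity) h1 (by linarith : 0 ≤ p - 1)
    rw [Real.mul_rpow hτ0 (Real.exp_pos _).le, ← Real.exp_mul] at h4
    rwa [show (p - 1) * τ / 2 = τ / 2 * (p - 1) by ring]
  have h5 : 0 ≤ 1 - Real.exp (-((p - 1) * τ)) := by
    rw [sub_nonneg, Real.exp_le_one_iff, neg_nonpos]
    exact mul_nonneg (by linarith) hτ0
  have h6 := hsinh ((p - 1) * τ / 2) (by
    have : 0 ≤ p - 1 := by linarith
    positivity)
  have hbb : b ^ (p - 1) * b ^ (1 - p) = 1 := by rw [← Real.rpow_add hb]; simp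
  have hpow : τ ^ (p - 1) * τ = τ ^ p := by
    rw [← Real.rpow_add_one' hτ0 (by linarith)]
    congr 1; ring
  calc (p - 1) * τ ^ p = τ ^ (p - 1) * (2 * ((p - 1) * τ / 2)) := by rw [← hpow]; ring
    _ ≤ τ ^ (p - 1) * (Real.exp ((p - 1) * τ / 2) - Real.exp (-((p - 1) * τ / 2))) := by
        gcongr
    _ = τ ^ (p - 1) * Real.exp ((p - 1) * τ / 2) * (1 - Real.exp (-((p - 1) * τ))) := by
        have e : Real.exp (-((p - 1) * τ / 2)) =
            Real.exp ((p - 1) * τ / 2) * Real.exp (-((p - 1) * τ)) := by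
          rw [← Real.exp_add]
          congr 1
          ring
        rw [e]
        ring
    _ ≤ (Real.exp τ - 1) ^ (p - 1) * (1 - Real.exp (-((p - 1) * τ))) := by gcongr
    _ = (b ^ (p - 1) * b ^ (1 - p)) *
          ((Real.exp τ - 1) ^ (p - 1) * (1 - Real.exp (-((p - 1) * τ)))) := by
        rw [hbb, one_mul]
    _ = _ := by
        rw [haτ, show Real.exp τ * b - b = (Real.exp τ - 1) * b by ring,
          Real.mul_rpow (by linarith [Real.one_le_exp hτ0]) hb.le,
          Real.mul_rpow (Real.exp_pos _).le hb.le, ← Real.exp_mul,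
          show τ * (1 - p) = -((p - 1) * τ) by ring]
        ring

theorem discrete_picone {p a b α β : ℝ} (hp : 1 < p) (ha : 0 < a) (hb : 0 < b)
    (hα : 0 ≤ α) (hβ : 0 ≤ β) :
    |a - b| ^ (p - 2) * (a - b) * (α ^ p * a ^ (1 - p) - β ^ p * b ^ (1 - p)) ≤ |α - β| ^ p := by
  rcases le_total b a with h | h
  · rw [abs_rpow_sub_two_mul_self hp (sub_nonneg.mpr h)]
    exact discrete_picone_of_le hp hb h hα hβ
  · have := discrete_picone_of_le hp ha h hβ hα
    rw [← abs_rpow_sub_two_mul_self hp (sub_nonneg.mpr h)] at this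
    rw [abs_sub_comm a b, abs_sub_comm α β]
    linarith

theorem log_rpow_le {p a b : ℝ} (hp : 1 < p) (ha : 0 < a) (hb : 0 < b) :
    |a - b| ^ (p - 2) * (a - b) * (a ^ (1 - p) - b ^ (1 - p)) ≤
      -((p - 1) * |Real.log a - Real.log b| ^ p) := by
  rcases le_total b a with h | h
  · have := log_rpow_le_of_le hp hb h
    rw [abs_rpow_sub_two_mul_self hp (sub_nonneg.mpr h),
      abs_of_nonneg (sub_nonneg.mpr (Real.log_le_log hb h))]
    linarith
  · have := log_rpow_le_of_le hp ha h
    rw [← abs_rpow_sub_two_mul_self hp (sub_nonneg.mpr h)] at this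
    rw [abs_sub_comm a b, abs_sub_comm (Real.log a),
      abs_of_nonneg (sub_nonneg.mpr (Real.log_le_log ha h))]
    linarith

/-- Split `U - V ≤ (U + d) + (-V)`: the power of `U + d` cancels against the test function, and for
the other summand `(U + d) ^ (1 - p) ≤ d ^ (1 - p)`. -/
theorem tail_term_le {p d U V α : ℝ} (hp : 1 < p) (hd : 0 < d) (hU : 0 ≤ U) (hV : V ≤ 0)
    (hα : 0 ≤ α) :
    |U - V| ^ (p - 2) * (U - V) * (α ^ p * (U + d) ^ (1 - p)) ≤
      2 ^ (p - 1) * α ^ p + 2 ^ (p - 1) * d ^ (1 - p) * (α ^ p * (-V) ^ (p - 1)) := by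
  have hp0 : 0 ≤ p - 1 := by linarith
  have hUd : 0 < U + d := by linarith
  have hV' : 0 ≤ -V := by linarith
  rw [abs_rpow_sub_two_mul_self hp (by linarith : 0 ≤ U - V)]
  have h1 : (U - V) ^ (p - 1) ≤ 2 ^ (p - 1) * ((U + d) ^ (p - 1) + (-V) ^ (p - 1)) :=
    (Real.rpow_le_rpow (by linarith) (by linarith : U - V ≤ (U + d) + -V) hp0).trans
      (add_rpow_le_two_rpow_mul hUd.le (by linarith) hp0)
  have h2 : (U + d) ^ (p - 1) * (U + d) ^ (1 - p) = 1 := by rw [← Real.rpow_add hUd]; simp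
  have h3 : (U + d) ^ (1 - p) ≤ d ^ (1 - p) :=
    Real.rpow_le_rpow_of_nonpos hd (by linarith) (by linarith)
  calc (U - V) ^ (p - 1) * (α ^ p * (U + d) ^ (1 - p))
      ≤ 2 ^ (p - 1) * ((U + d) ^ (p - 1) + (-V) ^ (p - 1)) * (α ^ p * (U + d) ^ (1 - p)) := by
        gcongr
    _ = 2 ^ (p - 1) * α ^ p * ((U + d) ^ (p - 1) * (U + d) ^ (1 - p)) +
          2 ^ (p - 1) * (U + d) ^ (1 - p) * (α ^ p * (-V) ^ (p - 1)) := by ring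
    _ ≤ _ := by
        rw [h2, mul_one]
        gcongr

/-- Where both values of `u` are nonnegative this is Picone's inequality. A negative value forces
the cutoff to vanish at that point, which leaves a tail term or zero. -/
theorem test_integrand_le {p d U V α β : ℝ} (hp : 1 < p) (hd : 0 < d) (hα : 0 ≤ α) (hβ : 0 ≤ β)
    (hU : α ≠ 0 → 0 ≤ U) (hV : β ≠ 0 → 0 ≤ V) :
    |U - V| ^ (p - 2) * (U - V) *
        (α ^ p * (max U 0 + d) ^ (1 - p) - β ^ p * (max V 0 + d) ^ (1 - p)) ≤
      2 ^ (p - 1) * |α - β| ^ p + 2 ^ (p - 1) * d ^ (1 - p) *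
        (α ^ p * max (-V) 0 ^ (p - 1) + β ^ p * max (-U) 0 ^ (p - 1)) := by
  have hp0 : p ≠ 0 := by linarith
  have hp1 : p - 1 ≠ 0 := by linarith
  rcases le_or_gt 0 U with hU0 | hU0 <;> rcases le_or_gt 0 V with hV0 | hV0
  · rw [max_eq_left hU0, max_eq_left hV0, max_eq_right (by linarith : -V ≤ 0),
      max_eq_right (by linarith : -U ≤ 0), Real.zero_rpow hp1]
    have := discrete_picone (p := p) (a := U + d) (b := V + d) hp (by linarith) (by linarith) hα hβ
    rw [add_sub_add_right_eq_sub] at this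
    have h2 : (1 : ℝ) ≤ 2 ^ (p - 1) := Real.one_le_rpow (by norm_num) (by linarith)
    have h3 := Real.rpow_nonneg (abs_nonneg (α - β)) p
    nlinarith
  · have hβ0 : β = 0 := by by_contra h; exact absurd (hV h) (not_le.mpr hV0)
    have := tail_term_le hp hd hU0 hV0.le hα
    rw [hβ0, max_eq_left hU0, max_eq_left (by linarith : 0 ≤ -V), Real.zero_rpow hp0, sub_zero,
      abs_of_nonneg hα]
    simpa using this
  · have hα0 : α = 0 := by by_contra h; exact absurd (hU h) (not_le.mpr hU0)
    have := tail_term_le hp hd hV0 hU0.le hβ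
    rw [hα0, max_eq_left hV0, max_eq_left (by linarith : 0 ≤ -U), Real.zero_rpow hp0, zero_sub,
      abs_neg, abs_of_nonneg hβ, abs_sub_comm U V]
    simp only [zero_mul, zero_sub, zero_add]
    linarith
  · have hα0 : α = 0 := by by_contra h; exact absurd (hU h) (not_le.mpr hU0)
    have hβ0 : β = 0 := by by_contra h; exact absurd (hV h) (not_le.mpr hV0)
    rw [hα0, hβ0]
    simp [Real.zero_rpow hp0]

theorem test_integrand_le_log {p d U V : ℝ} (hp : 1 < p) (hd : 0 < d) (hU : 0 ≤ U) (hV : 0 ≤ V) :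
    |U - V| ^ (p - 2) * (U - V) *
        (1 ^ p * (max U 0 + d) ^ (1 - p) - 1 ^ p * (max V 0 + d) ^ (1 - p)) ≤
      -((p - 1) * |Real.log (U + d) - Real.log (V + d)| ^ p) := by
  have := log_rpow_le (p := p) (a := U + d) (b := V + d) hp (by linarith) (by linarith)
  rw [add_sub_add_right_eq_sub] at this
  simpa [max_eq_left hU, max_eq_left hV] using this

theorem abs_rpow_sub_rpow_le {p α β : ℝ} (hp : 1 < p) (hα : α ∈ Set.Icc (0 : ℝ) 1)
    (hβ : β ∈ Set.Icc (0 : ℝ) 1) : |α ^ p - β ^ p| ≤ p * |α - β| := by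
  have := (convex_Icc (0 : ℝ) 1).norm_image_sub_le_of_norm_hasDerivWithin_le
    (f := fun t : ℝ => t ^ p) (f' := fun t => p * t ^ (p - 1)) (C := p)
    (fun t _ => (Real.hasDerivAt_rpow_const (Or.inr hp.le)).hasDerivWithinAt)
    (fun t ht => by
      rw [Real.norm_eq_abs, abs_of_nonneg (mul_nonneg (by linarith) (Real.rpow_nonneg ht.1 _))]
      exact mul_le_of_le_one_right (by linarith) (Real.rpow_le_one ht.1 ht.2 (by linarith)))
    hβ hα
  simpa [Real.norm_eq_abs] using this

theorem abs_rpow_sub_rpow_le_of_ge {p d a b : ℝ} (hp : 1 < p) (hd : 0 < d) (ha : d ≤ a)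
    (hb : d ≤ b) : |a ^ (1 - p) - b ^ (1 - p)| ≤ (p - 1) * d ^ (-p) * |a - b| := by
  have := (convex_Ici d).norm_image_sub_le_of_norm_hasDerivWithin_le
    (f := fun t : ℝ => t ^ (1 - p)) (f' := fun t => (1 - p) * t ^ (1 - p - 1))
    (C := (p - 1) * d ^ (-p))
    (fun t ht => (Real.hasDerivAt_rpow_const
      (Or.inl (hd.trans_le ht).ne')).hasDerivWithinAt)
    (fun t ht => by
      have ht0 : 0 < t := hd.trans_le ht
      rw [Real.norm_eq_abs, abs_mul, abs_sub_comm, abs_of_pos (by linarith : 0 < p - 1),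
        abs_of_pos (Real.rpow_pos_of_pos ht0 _), show 1 - p - 1 = -p by ring]
      exact mul_le_mul_of_nonneg_left (Real.rpow_le_rpow_of_nonpos hd ht (by linarith))
        (by linarith))
    hb ha
  simpa [Real.norm_eq_abs] using this

/-- The positive part keeps the argument of the negative power at least `d`, so the test function is
Lipschitz in the pair (cutoff, `u`) and inherits finite energy from both. -/
theorem abs_test_sub_test_le {p d U V α β : ℝ} (hp : 1 < p) (hd : 0 < d)
    (hα : α ∈ Set.Icc (0 : ℝ) 1) (hβ : β ∈ Set.Icc (0 : ℝ) 1) :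
    |α ^ p * (max U 0 + d) ^ (1 - p) - β ^ p * (max V 0 + d) ^ (1 - p)| ≤
      p * d ^ (1 - p) * |α - β| + (p - 1) * d ^ (-p) * |U - V| := by
  have hU : d ≤ max U 0 + d := by linarith [le_max_right U 0]
  have hV : d ≤ max V 0 + d := by linarith [le_max_right V 0]
  have h1 := abs_rpow_sub_rpow_le hp hα hβ
  have h2 := abs_rpow_sub_rpow_le_of_ge hp hd hU hV
  have h3 : |max U 0 + d - (max V 0 + d)| ≤ |U - V| := by
    rw [add_sub_add_right_eq_sub]
    exact (abs_max_sub_max_le_max _ _ _ _).trans (by simp)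
  have h4 : (max U 0 + d) ^ (1 - p) ≤ d ^ (1 - p) :=
    Real.rpow_le_rpow_of_nonpos hd hU (by linarith)
  have h5 : 0 ≤ (max U 0 + d) ^ (1 - p) := Real.rpow_nonneg (hd.le.trans hU) _
  have h6 : 0 ≤ β ^ p := Real.rpow_nonneg hβ.1 _
  have h7 : β ^ p ≤ 1 := Real.rpow_le_one hβ.1 hβ.2 (by linarith)
  have h8 : 0 ≤ d ^ (-p) := Real.rpow_nonneg hd.le _
  rw [show α ^ p * (max U 0 + d) ^ (1 - p) - β ^ p * (max V 0 + d) ^ (1 - p) =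
    (α ^ p - β ^ p) * (max U 0 + d) ^ (1 - p) +
      β ^ p * ((max U 0 + d) ^ (1 - p) - (max V 0 + d) ^ (1 - p)) by ring]
  refine (abs_add_le _ _).trans (add_le_add ?_ ?_)
  · rw [abs_mul, abs_of_nonneg h5]
    calc _ ≤ p * |α - β| * d ^ (1 - p) := by gcongr
      _ = _ := by ring
  · rw [abs_mul, abs_of_nonneg h6]
    calc _ ≤ 1 * ((p - 1) * d ^ (-p) * |max U 0 + d - (max V 0 + d)|) := by gcongr
      _ ≤ _ := by
        rw [one_mul]
        have : 0 ≤ p - 1 := by linarith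
        gcongr

/-! ### The kernel and the Gagliardo energy -/

theorem kernel_nonneg (h m : ℕ) (s p : ℝ) (x y : EuclideanSpace ℝ (Fin n)) :
    0 ≤ kernel h m s p x y := Real.rpow_nonneg (ccDist_nonneg h m x y) _

theorem kernel_comm (h m : ℕ) (s p : ℝ) (x y : EuclideanSpace ℝ (Fin n)) :
    kernel h m s p x y = kernel h m s p y x := by
  rw [kernel, ccDist_comm, kernel]

theorem measurable_kernel {h : ℕ} (m : ℕ) (hh : 1 ≤ h) (hn : h ≤ n) (s p : ℝ) :
    Measurable fun z : EuclideanSpace ℝ (Fin n) × EuclideanSpace ℝ (Fin n) =>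
      kernel h m s p z.1 z.2 :=
  (measurable_ccDist m hh hn).pow_const _

theorem homDim_eq {h : ℕ} (m : ℕ) (hn : h ≤ n) :
    homDim n h m = n + ((m * (n - h) : ℕ) : ℝ) := by
  unfold homDim
  push_cast [Nat.cast_sub hn]
  ring

/-- The integrand of the Gagliardo energy. -/
noncomputable def gagliardoDensity (h m : ℕ) (s p : ℝ) (u : EuclideanSpace ℝ (Fin n) → ℝ)
    (z : EuclideanSpace ℝ (Fin n) × EuclideanSpace ℝ (Fin n)) : ℝ :=
  kernel h m s p z.1 z.2 * |u z.1 - u z.2| ^ p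

theorem gagliardoDensity_nonneg (h m : ℕ) (s p : ℝ) (u : EuclideanSpace ℝ (Fin n) → ℝ)
    (z : EuclideanSpace ℝ (Fin n) × EuclideanSpace ℝ (Fin n)) :
    0 ≤ gagliardoDensity h m s p u z :=
  mul_nonneg (kernel_nonneg _ _ _ _ _ _) (Real.rpow_nonneg (abs_nonneg _) _)

theorem aemeasurable_sub {u : EuclideanSpace ℝ (Fin n) → ℝ} (hu : AEMeasurable u volume) :
    AEMeasurable (fun z : EuclideanSpace ℝ (Fin n) × EuclideanSpace ℝ (Fin n) => u z.1 - u z.2)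
      (volume.prod volume) :=
  (hu.comp_fst).sub (hu.comp_snd)

theorem aemeasurable_abs_sub_rpow {u : EuclideanSpace ℝ (Fin n) → ℝ} (hu : AEMeasurable u volume)
    (q : ℝ) :
    AEMeasurable
      (fun z : EuclideanSpace ℝ (Fin n) × EuclideanSpace ℝ (Fin n) => |u z.1 - u z.2| ^ q)
      (volume.prod volume) :=
  (measurable_norm.comp_aemeasurable (aemeasurable_sub hu)).pow_const q

theorem aemeasurable_gagliardoDensity {h : ℕ} (m : ℕ) (hh : 1 ≤ h) (hn : h ≤ n) (s p : ℝ)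
    {u : EuclideanSpace ℝ (Fin n) → ℝ} (hu : AEMeasurable u volume) :
    AEMeasurable (gagliardoDensity h m s p u) (volume.prod volume) :=
  (measurable_kernel m hh hn s p).aemeasurable.mul (aemeasurable_abs_sub_rpow hu p)

theorem gagliardoEnergy_eq {h : ℕ} (m : ℕ) (hh : 1 ≤ h) (hn : h ≤ n) (s p : ℝ)
    {u : EuclideanSpace ℝ (Fin n) → ℝ} (hu : AEMeasurable u volume) :
    gagliardoEnergy h m s p u =
      ∫⁻ z, ENNReal.ofReal (gagliardoDensity h m s p u z) ∂(volume.prod volume) := by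
  rw [lintegral_prod _ (aemeasurable_gagliardoDensity m hh hn s p hu).ennreal_ofReal]
  rfl

theorem MemW.aemeasurable {h m : ℕ} {s p : ℝ} {u : EuclideanSpace ℝ (Fin n) → ℝ}
    (hu : MemW h m s p u) : AEMeasurable u volume := hu.1.1.aemeasurable

theorem MemW.integrable_density {h m : ℕ} (hh : 1 ≤ h) (hn : h ≤ n) {s p : ℝ}
    {u : EuclideanSpace ℝ (Fin n) → ℝ} (hu : MemW h m s p u) :
    Integrable (gagliardoDensity h m s p u) (volume.prod volume) := by
  refine ⟨(aemeasurable_gagliardoDensity m hh hn s p hu.aemeasurable).aestronglyMeasurable, ?_⟩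
  rw [hasFiniteIntegral_iff_ofReal (Filter.Eventually.of_forall (gagliardoDensity_nonneg _ _ _ _ u)),
    ← gagliardoEnergy_eq m hh hn s p hu.aemeasurable]
  exact hu.2

/-- The integrand of the weak form. -/
noncomputable def weakDensity (h m : ℕ) (s p : ℝ) (u η : EuclideanSpace ℝ (Fin n) → ℝ)
    (z : EuclideanSpace ℝ (Fin n) × EuclideanSpace ℝ (Fin n)) : ℝ :=
  kernel h m s p z.1 z.2 * |u z.1 - u z.2| ^ (p - 2) * (u z.1 - u z.2) * (η z.1 - η z.2)

/-- A crude Young inequality dominates the integrand by two Gagliardo densities. Integrability on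
the product is what lets the iterated integral in `weakForm` be read as one integral. -/
theorem integrable_weakDensity {h m : ℕ} (hh : 1 ≤ h) (hn : h ≤ n) {s p : ℝ} (hp : 1 < p)
    {u η : EuclideanSpace ℝ (Fin n) → ℝ} (hu : MemW h m s p u) (hη : MemW h m s p η) :
    Integrable (weakDensity h m s p u η) (volume.prod volume) := by
  refine ((hu.integrable_density hh hn).add (hη.integrable_density hh hn)).mono'
    (AEMeasurable.aestronglyMeasurable ?_) (Filter.Eventually.of_forall fun z => ?_)
  · exact (((measurable_kernel m hh hn s p).aemeasurable.mul
      (aemeasurable_abs_sub_rpow hu.aemeasurable (p - 2))).mul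
      (aemeasurable_sub hu.aemeasurable)).mul (aemeasurable_sub hη.aemeasurable)
  · have hK := kernel_nonneg h m s p z.1 z.2
    have := abs_abs_rpow_mul_mul_le hp (u z.1 - u z.2) (η z.1 - η z.2)
    simp only [weakDensity, gagliardoDensity, Pi.add_apply, Real.norm_eq_abs]
    rw [mul_assoc, mul_assoc, abs_mul, abs_of_nonneg hK, ← mul_add, ← mul_assoc (|_| ^ _)]
    exact mul_le_mul_of_nonneg_left this hK

theorem weakForm_eq {h m : ℕ} (hh : 1 ≤ h) (hn : h ≤ n) {s p : ℝ} (hp : 1 < p)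
    {u η : EuclideanSpace ℝ (Fin n) → ℝ} (hu : MemW h m s p u) (hη : MemW h m s p η) :
    weakForm h m s p u η = ∫ z, weakDensity h m s p u η z ∂(volume.prod volume) := by
  rw [integral_prod _ (integrable_weakDensity hh hn hp hu hη)]
  rfl

/-! ### A cutoff function -/

/-- A Lipschitz cutoff that is `1` on `B(x₀, r)` and vanishes outside `B(x₀, 3 r / 2)`. -/
noncomputable def cutoff (h m : ℕ) (x₀ : EuclideanSpace ℝ (Fin n)) (r : ℝ) (x : EuclideanSpace ℝ (Fin n)) : ℝ :=
  min 1 (max 0 (3 - 2 / r * ccDist h m x x₀))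

theorem cutoff_mem_Icc (h m : ℕ) (x₀ : EuclideanSpace ℝ (Fin n)) (r : ℝ)
    (x : EuclideanSpace ℝ (Fin n)) : cutoff h m x₀ r x ∈ Set.Icc (0 : ℝ) 1 :=
  ⟨le_min zero_le_one (le_max_left _ _), min_le_left _ _⟩

theorem cutoff_eq_one {h m : ℕ} {x₀ x : EuclideanSpace ℝ (Fin n)} {r : ℝ} (hr : 0 < r)
    (hx : x ∈ ccBall h m x₀ r) : cutoff h m x₀ r x = 1 := by
  have h1 : ccDist h m x x₀ < r := hx
  have h2 : 2 / r * ccDist h m x x₀ ≤ 2 / r * r := by gcongr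
  rw [div_mul_cancel₀ _ hr.ne'] at h2
  exact min_eq_left (le_max_of_le_right (by linarith))

theorem mem_ccBall_of_cutoff_ne_zero {h m : ℕ} {x₀ x : EuclideanSpace ℝ (Fin n)} {r : ℝ}
    (hr : 0 < r) (hx : cutoff h m x₀ r x ≠ 0) : x ∈ ccBall h m x₀ (3 / 2 * r) := by
  by_contra hx'
  have h1 : 3 / 2 * r ≤ ccDist h m x x₀ := not_lt.mp hx'
  have h2 : 2 / r * (3 / 2 * r) ≤ 2 / r * ccDist h m x x₀ := by gcongr
  rw [show 2 / r * (3 / 2 * r) = 3 by field_simp] at h2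
  refine hx ?_
  rw [cutoff, max_eq_left (by linarith), min_eq_right zero_le_one]

theorem measurable_cutoff {h : ℕ} (m : ℕ) (hh : 1 ≤ h) (hn : h ≤ n)
    (x₀ : EuclideanSpace ℝ (Fin n)) (r : ℝ) : Measurable (cutoff h m x₀ r) := by
  have h1 := (measurable_ccDist m hh hn).comp
    (measurable_id.prodMk (measurable_const (a := x₀)))
  exact measurable_const.min (measurable_const.max (measurable_const.sub (h1.const_mul (2 / r))))

theorem abs_cutoff_sub_le {h : ℕ} (m : ℕ) (hh : 1 ≤ h) (hn : h ≤ n)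
    (x₀ : EuclideanSpace ℝ (Fin n)) {r : ℝ} (hr : 0 < r) (x y : EuclideanSpace ℝ (Fin n)) :
    |cutoff h m x₀ r x - cutoff h m x₀ r y| ≤ 2 / r * ccDist h m x y := by
  have t1 := ccDist_triangle m hh hn x y x₀
  have t2 := ccDist_triangle m hh hn y x x₀
  rw [ccDist_comm h m y x] at t2
  have h1 : |ccDist h m x x₀ - ccDist h m y x₀| ≤ ccDist h m x y := by
    rw [abs_le]; constructor <;> linarith
  have h2 : 0 ≤ 2 / r := by positivity
  unfold cutoff
  calc _ ≤ |max 0 (3 - 2 / r * ccDist h m x x₀) - max 0 (3 - 2 / r * ccDist h m y x₀)| :=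
        (abs_min_sub_min_le_max _ _ _ _).trans (by simp)
    _ ≤ |3 - 2 / r * ccDist h m x x₀ - (3 - 2 / r * ccDist h m y x₀)| :=
        (abs_max_sub_max_le_max _ _ _ _).trans (by simp)
    _ = 2 / r * |ccDist h m x x₀ - ccDist h m y x₀| := by
        rw [sub_sub_sub_cancel_left, ← mul_sub, abs_mul, abs_of_nonneg h2, abs_sub_comm]
    _ ≤ _ := by gcongr

theorem hNorm_le_of_mem_ccBall {h : ℕ} (m : ℕ) (hh : 1 ≤ h) (hn : h ≤ n)
    {x₀ x : EuclideanSpace ℝ (Fin n)} {r : ℝ} (hx : x ∈ ccBall h m x₀ r) :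
    hNorm h x ≤ hNorm h x₀ + n * r := by
  have hlt : ccDist h m x x₀ < r := hx
  refine (hNorm_le_add_sum h x₀ x).trans (add_le_add le_rfl ?_)
  calc _ ≤ ∑ _i : Fin n, r := by
        refine Finset.sum_le_sum fun i _ => ?_
        split_ifs with hi
        · refine (abs_sub_le_ccDist m hh hn x₀ x hi).trans ?_
          rw [ccDist_comm]; exact hlt.le
        · exact (ccDist_nonneg h m x x₀).trans hlt.le
    _ = _ := by simp

/-- At distances below `r` the Lipschitz bound gains `p` powers of the distance; at larger ones the
oscillation is at most 1. -/
theorem cutoff_density_le {h : ℕ} (m : ℕ) (hh : 1 ≤ h) (hn : h ≤ n) {s p : ℝ} (hp : 1 < p)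
    (x₀ : EuclideanSpace ℝ (Fin n)) {r : ℝ} (hr : 0 < r) (x y : EuclideanSpace ℝ (Fin n)) :
    kernel h m s p x y * |cutoff h m x₀ r x - cutoff h m x₀ r y| ^ p ≤
      if ccDist h m x y < r then
        (2 / r) ^ p * ccDist h m x y ^ (-(homDim n h m) - s * p + p)
      else ccDist h m x y ^ (-(homDim n h m) - s * p) := by
  have hK := kernel_nonneg h m s p x y
  have hp0 : 0 ≤ p := by linarith
  have hx := cutoff_mem_Icc h m x₀ r x
  have hy := cutoff_mem_Icc h m x₀ r y
  split_ifs with hlt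
  · rcases (ccDist_nonneg h m x y).eq_or_lt with h0 | h0
    · have := abs_cutoff_sub_le m hh hn x₀ hr x y
      rw [← h0, mul_zero] at this
      rw [le_antisymm this (abs_nonneg _), Real.zero_rpow (by linarith), mul_zero, ← h0]
      positivity
    · calc _ ≤ kernel h m s p x y * (2 / r * ccDist h m x y) ^ p := by
            gcongr
            exact abs_cutoff_sub_le m hh hn x₀ hr x y
        _ = _ := by
            rw [Real.mul_rpow (by positivity) h0.le, Real.rpow_add h0, kernel]
            ring
  · refine mul_le_of_le_one_right hK (Real.rpow_le_one (abs_nonneg _) ?_ hp0)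
    rw [abs_le]
    constructor <;> linarith [hx.1, hx.2, hy.1, hy.2]

/-- The bound for the energy of the cutoff function. -/
theorem gagliardoEnergy_cutoff_le {h : ℕ} (m : ℕ) (hh : 1 ≤ h) (hn : h ≤ n) {s p : ℝ}
    (hp : 1 < p) (hs : 0 < s) (hsp : ((m * (n - h) : ℕ) : ℝ) < p * (1 - s)) :
    ∃ C : ℝ, 0 < C ∧ ∀ (x₀ : EuclideanSpace ℝ (Fin n)) (r : ℝ), 0 < r →
      gagliardoEnergy h m s p (cutoff h m x₀ r) ≤
        ENNReal.ofReal (C * (r ^ (-(homDim n h m) - s * p + n) *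
          (hNorm h x₀ + r) ^ (m * (n - h)) * (r ^ n * (hNorm h x₀ + r) ^ (m * (n - h))))) := by
  have hQ := homDim_eq (n := n) m hn
  have hn0 : (0 : ℝ) < n := by exact_mod_cast (hh.trans hn : 0 < n)
  set α := -(homDim n h m) - s * p with hα
  set μ := m * (n - h) with hμ
  -- Here `α + p + n = p (1 - s) - m (n - h)`, positive by `hsp`; for the complement, `α + n + m (n
  -- - h) = -s p`.
  obtain ⟨C₁, hC₁, H₁⟩ := lintegral_rpow_ball_le (α := α + p) m hh hn (by
    rw [hα, hQ]; nlinarith)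
  obtain ⟨C₂, hC₂, H₂⟩ := lintegral_rpow_compl_ball_le (α := α) m hh hn (by
    rw [hα, hQ]; nlinarith)
  set A : ℝ := 2 ^ n * (n : ℝ) ^ μ with hA
  refine ⟨2 * ((2 ^ p * C₁ + C₂) * (2 * n + 1) ^ μ * (A * (2 ^ n * 2 ^ μ))), by positivity,
    fun x₀ r hr => ?_⟩
  have hx₀ := hNorm_nonneg h x₀
  set G : EuclideanSpace ℝ (Fin n) → EuclideanSpace ℝ (Fin n) → ℝ≥0∞ := fun x y =>
    ENNReal.ofReal (if ccDist h m x y < r then (2 / r) ^ p * ccDist h m x y ^ (α + p)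
      else ccDist h m x y ^ α) with hG
  have hGcomm : ∀ x y, G x y = G y x := fun x y => by
    simp only [hG, ccDist_comm h m x y]
  have hmeasd := measurable_ccDist m hh hn
  have hGm : Measurable (Function.uncurry G) := by
    refine ENNReal.measurable_ofReal.comp (Measurable.ite
      (measurableSet_lt hmeasd measurable_const) ?_ ?_)
    · exact (hmeasd.pow_const _).const_mul _
    · exact hmeasd.pow_const _
  have hball := measurableSet_ccBall m hh hn x₀ (2 * r)
  have hGint : ∀ x ∈ ccBall h m x₀ (2 * r), ∫⁻ y, G x y ≤
      ENNReal.ofReal ((2 ^ p * C₁ + C₂) * (2 * n + 1) ^ μ *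
        (r ^ (α + n) * (hNorm h x₀ + r) ^ μ)) := by
    intro x hx
    have hxn := hNorm_nonneg h x
    -- In `B(x₀, 2 r)` the partial norm exceeds that of `x₀` by at most `2 n r`.
    have hle : hNorm h x + r ≤ (2 * n + 1) * (hNorm h x₀ + r) := by
      have := hNorm_le_of_mem_ccBall m hh hn hx
      nlinarith
    have hset : MeasurableSet {y | ccDist h m x y < r} := by
      have h1 := hmeasd.comp ((measurable_const (a := x)).prodMk measurable_id)
      exact measurableSet_lt h1 measurable_const
    have hcompl : {y | ccDist h m x y < r}ᶜ = {y | r ≤ ccDist h m x y} := by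
      ext y; simp
    rw [← lintegral_add_compl _ hset, hcompl]
    calc _ = (∫⁻ y in {y | ccDist h m x y < r},
              ENNReal.ofReal ((2 / r) ^ p) * ENNReal.ofReal (ccDist h m x y ^ (α + p))) +
            ∫⁻ y in {y | r ≤ ccDist h m x y}, ENNReal.ofReal (ccDist h m x y ^ α) := by
          congr 1
          · refine setLIntegral_congr_fun hset fun y hy => ?_
            have hy' : ccDist h m x y < r := hy
            simp only [hG, hy', if_true]
            rw [ENNReal.ofReal_mul (by positivity)]
          · refine setLIntegral_congr_fun (hcompl ▸ hset.compl) fun y hy => ?_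
            have hy' : ¬ ccDist h m x y < r := not_lt.mpr hy
            simp only [hG, hy', if_false]
      _ ≤ ENNReal.ofReal ((2 / r) ^ p) * ENNReal.ofReal
              (C₁ * (r ^ (α + p + n) * (hNorm h x + r) ^ μ)) +
            ENNReal.ofReal (C₂ * (r ^ (α + n) * (hNorm h x + r) ^ μ)) := by
          rw [lintegral_const_mul' _ _ ENNReal.ofReal_ne_top]
          gcongr
          · exact H₁ x r hr
          · exact H₂ x r hr
      _ = ENNReal.ofReal ((2 ^ p * C₁ + C₂) * (r ^ (α + n) * (hNorm h x + r) ^ μ)) := by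
          rw [← ENNReal.ofReal_mul (by positivity), ← ENNReal.ofReal_add (by positivity)
            (by positivity)]
          congr 1
          rw [Real.div_rpow zero_le_two hr.le, show α + p + n = p + (α + n) by ring,
            Real.rpow_add hr p]
          field_simp
      _ ≤ _ := by
          refine ENNReal.ofReal_le_ofReal ?_
          calc _ ≤ (2 ^ p * C₁ + C₂) *
                (r ^ (α + n) * ((2 * n + 1) * (hNorm h x₀ + r)) ^ μ) := by gcongr
            _ = _ := by rw [mul_pow]; ring
  -- The density vanishes unless one of the two points lies in `B(x₀, 2 r)`; by symmetry of `G` both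
  -- cases contribute equally.
  have hpt : ∀ x y, ENNReal.ofReal
      (kernel h m s p x y * |cutoff h m x₀ r x - cutoff h m x₀ r y| ^ p) ≤
      (ccBall h m x₀ (2 * r)).indicator (fun x => G x y) x +
        (ccBall h m x₀ (2 * r)).indicator (fun y => G x y) y := by
    intro x y
    have hle : ENNReal.ofReal
        (kernel h m s p x y * |cutoff h m x₀ r x - cutoff h m x₀ r y| ^ p) ≤ G x y :=
      ENNReal.ofReal_le_ofReal (cutoff_density_le m hh hn hp x₀ hr x y)
    have hsub : ∀ w, cutoff h m x₀ r w ≠ 0 → w ∈ ccBall h m x₀ (2 * r) := fun w hw => by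
      have : ccDist h m w x₀ < 3 / 2 * r := mem_ccBall_of_cutoff_ne_zero hr hw
      exact this.trans (by linarith)
    by_cases hx : cutoff h m x₀ r x = 0
    · by_cases hy : cutoff h m x₀ r y = 0
      · simp [hx, hy, Real.zero_rpow (by linarith : p ≠ 0)]
      · rw [Set.indicator_of_mem (hsub y hy)]
        exact hle.trans le_add_self
    · rw [Set.indicator_of_mem (hsub x hx)]
      exact hle.trans le_self_add
  have hswap : ∫⁻ x, ∫⁻ y, (ccBall h m x₀ (2 * r)).indicator (fun y => G x y) y =
      ∫⁻ x, ∫⁻ y, (ccBall h m x₀ (2 * r)).indicator (fun x => G x y) x := by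
    rw [lintegral_lintegral_swap]
    · refine lintegral_congr fun y => lintegral_congr fun x => ?_
      simp only [Set.indicator, hGcomm x y]
    · exact (hGm.indicator (hball.preimage measurable_snd)).aemeasurable
  have hmain : ∫⁻ x, ∫⁻ y, (ccBall h m x₀ (2 * r)).indicator (fun x => G x y) x ≤
      ENNReal.ofReal ((2 ^ p * C₁ + C₂) * (2 * n + 1) ^ μ *
        (r ^ (α + n) * (hNorm h x₀ + r) ^ μ)) * volume (ccBall h m x₀ (2 * r)) := by
    rw [← setLIntegral_const, ← lintegral_indicator hball]
    refine lintegral_mono fun x => ?_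
    by_cases hx : x ∈ ccBall h m x₀ (2 * r)
    · simp only [Set.indicator_of_mem hx]
      exact hGint x hx
    · simp [Set.indicator_of_notMem hx]
  calc gagliardoEnergy h m s p (cutoff h m x₀ r)
      ≤ ∫⁻ x, ∫⁻ y, ((ccBall h m x₀ (2 * r)).indicator (fun x => G x y) x +
          (ccBall h m x₀ (2 * r)).indicator (fun y => G x y) y) :=
        lintegral_mono fun x => lintegral_mono fun y => hpt x y
    _ = (∫⁻ x, ∫⁻ y, (ccBall h m x₀ (2 * r)).indicator (fun x => G x y) x) +
          ∫⁻ x, ∫⁻ y, (ccBall h m x₀ (2 * r)).indicator (fun y => G x y) y := by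
        have hm1 : Measurable fun z : EuclideanSpace ℝ (Fin n) × EuclideanSpace ℝ (Fin n) =>
            (ccBall h m x₀ (2 * r)).indicator (fun x => G x z.2) z.1 :=
          hGm.indicator (hball.preimage measurable_fst)
        rw [← lintegral_add_left hm1.lintegral_prod_right']
        exact lintegral_congr fun x =>
          lintegral_add_left (hm1.comp measurable_prodMk_left) _
    _ ≤ 2 * (ENNReal.ofReal ((2 ^ p * C₁ + C₂) * (2 * n + 1) ^ μ *
        (r ^ (α + n) * (hNorm h x₀ + r) ^ μ)) * ENNReal.ofReal (A * ((2 * r) ^ n *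
          (hNorm h x₀ + 2 * r) ^ μ))) := by
        rw [hswap, ← two_mul]
        gcongr
        exact hmain.trans (mul_le_mul_right (volume_ccBall_le m hh hn x₀ (by positivity)) _)
    _ = ENNReal.ofReal (2 * ((2 ^ p * C₁ + C₂) * (2 * n + 1) ^ μ *
        (r ^ (α + n) * (hNorm h x₀ + r) ^ μ) * (A * ((2 * r) ^ n *
          (hNorm h x₀ + 2 * r) ^ μ)))) := by
        rw [← ENNReal.ofReal_mul (by positivity), ENNReal.ofReal_mul zero_le_two,
          ENNReal.ofReal_ofNat]
    _ ≤ _ := by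
        refine ENNReal.ofReal_le_ofReal ?_
        calc _ ≤ 2 * ((2 ^ p * C₁ + C₂) * (2 * n + 1) ^ μ *
              (r ^ (α + n) * (hNorm h x₀ + r) ^ μ) * (A * ((2 * r) ^ n *
                (2 * (hNorm h x₀ + r)) ^ μ))) := by
              gcongr
              linarith
          _ = _ := by rw [mul_pow, mul_pow]; ring

/-! ### The logarithmic estimate -/

/-- Only `F` is known to be integrable, so the comparison runs in `ℝ≥0∞`: `∫ F⁺ + ∫ H ≤ ∫ F⁻ + ∫ G ≤
∫ F⁺ + ∫ G`, and the finite `∫ F⁺` cancels. -/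
theorem lintegral_le_of_add_le {α : Type*} [MeasurableSpace α] {μ : Measure α} {F H G : α → ℝ}
    (hF : Integrable F μ) (hF0 : 0 ≤ ∫ z, F z ∂μ)
    (hH : ∀ z, 0 ≤ H z) (hG : ∀ z, 0 ≤ G z) (hle : ∀ᵐ z ∂μ, F z + H z ≤ G z) :
    ∫⁻ z, ENNReal.ofReal (H z) ∂μ ≤ ∫⁻ z, ENNReal.ofReal (G z) ∂μ := by
  have hpos : AEMeasurable (fun z => ENNReal.ofReal (F z)) μ :=
    hF.1.aemeasurable.ennreal_ofReal
  have hneg : AEMeasurable (fun z => ENNReal.ofReal (-F z)) μ :=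
    hF.1.aemeasurable.neg.ennreal_ofReal
  have hposfin : ∫⁻ z, ENNReal.ofReal (F z) ∂μ ≠ ∞ := hF.lintegral_lt_top.ne
  have hnegfin : ∫⁻ z, ENNReal.ofReal (-F z) ∂μ ≠ ∞ := hF.neg.lintegral_lt_top.ne
  have h1 : ∫⁻ z, ENNReal.ofReal (-F z) ∂μ ≤ ∫⁻ z, ENNReal.ofReal (F z) ∂μ := by
    rw [integral_eq_lintegral_pos_part_sub_lintegral_neg_part hF, sub_nonneg] at hF0
    exact (ENNReal.toReal_le_toReal hnegfin hposfin).mp hF0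
  have h2 : ∫⁻ z, ENNReal.ofReal (F z) ∂μ + ∫⁻ z, ENNReal.ofReal (H z) ∂μ ≤
      ∫⁻ z, ENNReal.ofReal (-F z) ∂μ + ∫⁻ z, ENNReal.ofReal (G z) ∂μ := by
    rw [← lintegral_add_left' hpos, ← lintegral_add_left' hneg]
    refine lintegral_mono_ae ?_
    filter_upwards [hle] with z hz
    rcases le_total 0 (F z) with h0 | h0
    · rw [ENNReal.ofReal_of_nonpos (by linarith : -F z ≤ 0), zero_add,
        ← ENNReal.ofReal_add h0 (hH z)]
      exact ENNReal.ofReal_le_ofReal hz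
    · rw [ENNReal.ofReal_of_nonpos h0, zero_add, ← ENNReal.ofReal_add (by linarith) (hG z)]
      exact ENNReal.ofReal_le_ofReal (by linarith)
  exact (ENNReal.add_le_add_iff_left hposfin).mp (h2.trans (add_le_add_left h1 _))

/-- The test function `φ ^ p (u₊ + d) ^ (1 - p)`, where `φ` is the cutoff. -/
noncomputable def testFun (h m : ℕ) (p d : ℝ) (x₀ : EuclideanSpace ℝ (Fin n)) (r : ℝ)
    (u : EuclideanSpace ℝ (Fin n) → ℝ) (x : EuclideanSpace ℝ (Fin n)) : ℝ :=
  cutoff h m x₀ r x ^ p * (max (u x) 0 + d) ^ (1 - p)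

theorem testFun_nonneg (h m : ℕ) (p : ℝ) {d : ℝ} (hd : 0 < d) (x₀ : EuclideanSpace ℝ (Fin n))
    (r : ℝ) (u : EuclideanSpace ℝ (Fin n) → ℝ) (x : EuclideanSpace ℝ (Fin n)) :
    0 ≤ testFun h m p d x₀ r u x :=
  mul_nonneg (Real.rpow_nonneg (cutoff_mem_Icc h m x₀ r x).1 _)
    (Real.rpow_nonneg (by linarith [le_max_right (u x) 0]) _)

/-- Membership in `L^p` holds because the function is at most `d ^ (1 - p)` and lives on a ball of
finite volume; the energy is controlled by those of the cutoff and of `u`. -/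
theorem memW_testFun {h m : ℕ} (hh : 1 ≤ h) (hn : h ≤ n) {s p d : ℝ} (hp : 1 < p) (hd : 0 < d)
    {x₀ : EuclideanSpace ℝ (Fin n)} {r : ℝ} (hr : 0 < r) {u : EuclideanSpace ℝ (Fin n) → ℝ}
    (hu : MemW h m s p u) (hfin : gagliardoEnergy h m s p (cutoff h m x₀ r) < ∞) :
    MemW h m s p (testFun h m p d x₀ r u) := by
  have hφm := measurable_cutoff m hh hn x₀ r
  have hp0 : 0 ≤ p := by linarith
  have hmeas : AEMeasurable (testFun h m p d x₀ r u) volume :=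
    (hφm.pow_const p).aemeasurable.mul
      (((hu.aemeasurable.max aemeasurable_const).add aemeasurable_const).pow_const (1 - p))
  refine ⟨?_, ?_⟩
  · have hball := measurableSet_ccBall m hh hn x₀ (3 / 2 * r)
    have hvol := (volume_ccBall_lt_top m hh hn x₀ (show 0 < 3 / 2 * r by positivity)).ne
    refine (memLp_indicator_const (ENNReal.ofReal p) hball (d ^ (1 - p)) (Or.inr hvol)).mono
      hmeas.aestronglyMeasurable (Filter.Eventually.of_forall fun x => ?_)
    rw [Real.norm_eq_abs, abs_of_nonneg (testFun_nonneg h m p hd x₀ r u x)]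
    by_cases hx : x ∈ ccBall h m x₀ (3 / 2 * r)
    · rw [Set.indicator_of_mem hx, Real.norm_eq_abs, abs_of_pos (Real.rpow_pos_of_pos hd _)]
      have hφ := cutoff_mem_Icc h m x₀ r x
      calc testFun h m p d x₀ r u x ≤ 1 * d ^ (1 - p) := by
            refine mul_le_mul (Real.rpow_le_one hφ.1 hφ.2 hp0) ?_ (Real.rpow_nonneg
              (by linarith [le_max_right (u x) 0]) _) zero_le_one
            exact Real.rpow_le_rpow_of_nonpos hd (by linarith [le_max_right (u x) 0])
              (by linarith)
        _ = _ := one_mul _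
    · have h0 : cutoff h m x₀ r x = 0 := by
        by_contra h0
        exact hx (mem_ccBall_of_cutoff_ne_zero hr h0)
      rw [testFun, h0, Real.zero_rpow (by linarith), zero_mul]
      exact norm_nonneg _
  · have hint : Integrable (fun z =>
        2 ^ p * ((p * d ^ (1 - p)) ^ p * gagliardoDensity h m s p (cutoff h m x₀ r) z +
          ((p - 1) * d ^ (-p)) ^ p * gagliardoDensity h m s p u z)) (volume.prod volume) := by
      refine Integrable.const_mul (Integrable.add (Integrable.const_mul ?_ _)
        ((hu.integrable_density hh hn).const_mul _)) _
      refine ⟨(aemeasurable_gagliardoDensity m hh hn s p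
        hφm.aemeasurable).aestronglyMeasurable, ?_⟩
      rw [hasFiniteIntegral_iff_ofReal
        (Filter.Eventually.of_forall (gagliardoDensity_nonneg _ _ _ _ _)),
        ← gagliardoEnergy_eq m hh hn s p hφm.aemeasurable]
      exact hfin
    rw [gagliardoEnergy_eq m hh hn s p hmeas]
    refine (lintegral_mono fun z => ENNReal.ofReal_le_ofReal ?_).trans_lt hint.lintegral_lt_top
    have hK := kernel_nonneg h m s p z.1 z.2
    have h1 : 0 ≤ p * d ^ (1 - p) := mul_nonneg hp0 (Real.rpow_nonneg hd.le _)
    have h2 : 0 ≤ (p - 1) * d ^ (-p) := mul_nonneg (by linarith) (Real.rpow_nonneg hd.le _)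
    have h3 := abs_test_sub_test_le (U := u z.1) (V := u z.2) hp hd (cutoff_mem_Icc h m x₀ r z.1)
      (cutoff_mem_Icc h m x₀ r z.2)
    have h4 := (Real.rpow_le_rpow (abs_nonneg _) h3 hp0).trans
      (add_rpow_le_two_rpow_mul (mul_nonneg h1 (abs_nonneg _)) (mul_nonneg h2 (abs_nonneg _)) hp0)
    rw [Real.mul_rpow h1 (abs_nonneg _), Real.mul_rpow h2 (abs_nonneg _)] at h4
    have h5 := mul_le_mul_of_nonneg_left h4 hK
    simp only [gagliardoDensity, testFun]
    linarith

theorem memW₀_testFun {h m : ℕ} (hh : 1 ≤ h) (hn : h ≤ n) {s p d : ℝ} (hp : 1 < p) (hd : 0 < d)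
    {x₀ : EuclideanSpace ℝ (Fin n)} {r : ℝ} (hr : 0 < r) {u : EuclideanSpace ℝ (Fin n) → ℝ}
    (hu : MemW h m s p u) (hfin : gagliardoEnergy h m s p (cutoff h m x₀ r) < ∞)
    {Ω : Set (EuclideanSpace ℝ (Fin n))} (hΩ : ccBall h m x₀ (3 / 2 * r) ⊆ Ω) :
    MemW₀ h m s p Ω (testFun h m p d x₀ r u) := by
  refine ⟨memW_testFun hh hn hp hd hr hu hfin, Filter.Eventually.of_forall fun x hx => ?_⟩
  have h0 : cutoff h m x₀ r x = 0 := by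
    by_contra h0
    exact hx (hΩ (mem_ccBall_of_cutoff_ne_zero hr h0))
  rw [testFun, h0, Real.zero_rpow (by linarith), zero_mul]

/-- Integrate the pointwise inequalities against the kernel: `log_rpow_le` on `B_r × B_r`, where the
cutoff is 1, and Picone with the tail term elsewhere. The weak form is nonnegative and drops out;
swapping the variables gives the factor 2. -/
theorem log_estimate {h m : ℕ} (hh : 1 ≤ h) (hn : h ≤ n) {s p d : ℝ} (hp : 1 < p) (hd : 0 < d)
    {x₀ : EuclideanSpace ℝ (Fin n)} {r R : ℝ} (hr : 0 < r) (hrR : r ≤ R / 2)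
    {Ω : Set (EuclideanSpace ℝ (Fin n))} {g u : EuclideanSpace ℝ (Fin n) → ℝ}
    (hu : IsWeakSupersolution h m s p Ω g u) (hΩ : ccBall h m x₀ R ⊆ Ω)
    (hpos : ∀ᵐ x, x ∈ ccBall h m x₀ R → 0 ≤ u x)
    (hfin : gagliardoEnergy h m s p (cutoff h m x₀ r) < ∞) :
    ENNReal.ofReal (p - 1) * ∫⁻ z in ccBall h m x₀ r ×ˢ ccBall h m x₀ r,
        ENNReal.ofReal (kernel h m s p z.1 z.2 *
          |Real.log (u z.1 + d) - Real.log (u z.2 + d)| ^ p) ∂(volume.prod volume) ≤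
      ENNReal.ofReal (2 ^ (p - 1)) * gagliardoEnergy h m s p (cutoff h m x₀ r) +
        ENNReal.ofReal (2 ^ (p - 1) * d ^ (1 - p)) * (2 * ∫⁻ x, ∫⁻ y, ENNReal.ofReal
          (kernel h m s p x y * (cutoff h m x₀ r x ^ p * max (-u y) 0 ^ (p - 1)))) := by
  have hφm := measurable_cutoff m hh hn x₀ r
  have hKm := measurable_kernel m hh hn (n := n) s p
  have hsub : ccBall h m x₀ (3 / 2 * r) ⊆ ccBall h m x₀ R := fun x hx =>
    (show ccDist h m x x₀ < 3 / 2 * r from hx).trans_le (by linarith)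
  have hsub' : ccBall h m x₀ r ⊆ ccBall h m x₀ R := fun x hx =>
    (show ccDist h m x x₀ < r from hx).trans_le (by linarith)
  have hη := memW₀_testFun hh hn hp hd hr hu.memW hfin (hsub.trans hΩ)
  have hweak := hu.weak _ hη (testFun_nonneg h m p hd x₀ r u)
  rw [weakForm_eq hh hn hp hu.memW hη.1] at hweak
  set S := ccBall h m x₀ r ×ˢ ccBall h m x₀ r with hS
  have hSm : MeasurableSet S :=
    (measurableSet_ccBall m hh hn x₀ r).prod (measurableSet_ccBall m hh hn x₀ r)
  set T : EuclideanSpace ℝ (Fin n) × EuclideanSpace ℝ (Fin n) → ℝ := fun z =>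
    kernel h m s p z.1 z.2 * (cutoff h m x₀ r z.1 ^ p * max (-u z.2) 0 ^ (p - 1)) with hT
  have hT0 : ∀ z, 0 ≤ T z := fun z => mul_nonneg (kernel_nonneg _ _ _ _ _ _)
    (mul_nonneg (Real.rpow_nonneg (cutoff_mem_Icc h m x₀ r z.1).1 _)
      (Real.rpow_nonneg (le_max_right _ _) _))
  have hTm : AEMeasurable T (volume.prod volume) :=
    hKm.aemeasurable.mul (((hφm.comp measurable_fst).pow_const p).aemeasurable.mul
      ((hu.memW.aemeasurable.comp_snd.neg.max aemeasurable_const).pow_const (p - 1)))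
  set L : EuclideanSpace ℝ (Fin n) × EuclideanSpace ℝ (Fin n) → ℝ := fun z =>
    kernel h m s p z.1 z.2 * |Real.log (u z.1 + d) - Real.log (u z.2 + d)| ^ p with hL
  have hL0 : ∀ z, 0 ≤ L z := fun z => mul_nonneg (kernel_nonneg _ _ _ _ _ _)
    (Real.rpow_nonneg (abs_nonneg _) _)
  have h2p : (0 : ℝ) ≤ 2 ^ (p - 1) := by positivity
  have h2d : (0 : ℝ) ≤ 2 ^ (p - 1) * d ^ (1 - p) := by positivity
  have key := lintegral_le_of_add_le (F := weakDensity h m s p u (testFun h m p d x₀ r u))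
    (H := S.indicator fun z => (p - 1) * L z)
    (G := fun z => 2 ^ (p - 1) * gagliardoDensity h m s p (cutoff h m x₀ r) z +
      2 ^ (p - 1) * d ^ (1 - p) * (T z + T z.swap))
    (integrable_weakDensity hh hn hp hu.memW hη.1) hweak
    (fun z => Set.indicator_nonneg (fun z _ => mul_nonneg (by linarith) (hL0 z)) z)
    (fun z => add_nonneg (mul_nonneg h2p (gagliardoDensity_nonneg _ _ _ _ _ z))
      (mul_nonneg h2d (add_nonneg (hT0 z) (hT0 z.swap)))) ?_
  · calc _ = ∫⁻ z, ENNReal.ofReal (S.indicator (fun z => (p - 1) * L z) z)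
          ∂(volume.prod volume) := by
          rw [← lintegral_const_mul' _ _ ENNReal.ofReal_ne_top, ← lintegral_indicator hSm]
          refine lintegral_congr fun z => ?_
          by_cases hz : z ∈ S
          · rw [Set.indicator_of_mem hz, Set.indicator_of_mem hz,
              ← ENNReal.ofReal_mul (by linarith)]
          · rw [Set.indicator_of_notMem hz, Set.indicator_of_notMem hz, ENNReal.ofReal_zero]
      _ ≤ _ := key
      _ = ∫⁻ z, (ENNReal.ofReal (2 ^ (p - 1)) *
              ENNReal.ofReal (gagliardoDensity h m s p (cutoff h m x₀ r) z) +
            ENNReal.ofReal (2 ^ (p - 1) * d ^ (1 - p)) *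
              (ENNReal.ofReal (T z) + ENNReal.ofReal (T z.swap))) ∂(volume.prod volume) := by
          refine lintegral_congr fun z => ?_
          rw [ENNReal.ofReal_add (mul_nonneg h2p (gagliardoDensity_nonneg _ _ _ _ _ z))
            (mul_nonneg h2d (add_nonneg (hT0 z) (hT0 z.swap))), ENNReal.ofReal_mul h2p,
            ENNReal.ofReal_mul h2d, ENNReal.ofReal_add (hT0 z) (hT0 z.swap)]
      _ = _ := by
          rw [lintegral_add_left' ((aemeasurable_gagliardoDensity m hh hn s p
              hφm.aemeasurable).ennreal_ofReal.const_mul _),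
            lintegral_const_mul' _ _ ENNReal.ofReal_ne_top,
            lintegral_const_mul' _ _ ENNReal.ofReal_ne_top,
            lintegral_add_left' hTm.ennreal_ofReal,
            lintegral_prod_swap (fun z => ENNReal.ofReal (T z)), ← two_mul,
            gagliardoEnergy_eq m hh hn s p hφm.aemeasurable,
            lintegral_prod _ hTm.ennreal_ofReal]
  · filter_upwards [Measure.quasiMeasurePreserving_fst.ae hpos,
      Measure.quasiMeasurePreserving_snd.ae hpos] with z h1 h2
    have hK := kernel_nonneg h m s p z.1 z.2
    by_cases hz : z ∈ S
    · rw [Set.indicator_of_mem hz]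
      have h3 := mul_le_mul_of_nonneg_left
        (test_integrand_le_log (p := p) hp hd (h1 (hsub' hz.1)) (h2 (hsub' hz.2))) hK
      have h4 : weakDensity h m s p u (testFun h m p d x₀ r u) z + (p - 1) * L z ≤ 0 := by
        simp only [weakDensity, testFun, hL, cutoff_eq_one hr hz.1, cutoff_eq_one hr hz.2]
        linarith
      exact h4.trans (add_nonneg (mul_nonneg h2p (gagliardoDensity_nonneg _ _ _ _ _ z))
        (mul_nonneg h2d (add_nonneg (hT0 z) (hT0 z.swap))))
    · rw [Set.indicator_of_notMem hz, add_zero]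
      have h3 := mul_le_mul_of_nonneg_left (test_integrand_le (p := p) (d := d) hp hd
        (cutoff_mem_Icc h m x₀ r z.1).1 (cutoff_mem_Icc h m x₀ r z.2).1
        (fun h0 => h1 (hsub (mem_ccBall_of_cutoff_ne_zero hr h0)))
        (fun h0 => h2 (hsub (mem_ccBall_of_cutoff_ne_zero hr h0)))) hK
      simp only [weakDensity, testFun, hT, gagliardoDensity, Prod.fst_swap, Prod.snd_swap,
        kernel_comm h m s p z.2 z.1]
      linarith

/-! ### The tail term -/

/-- Needed because a nonintegrable tail would be 0 by convention. The integrand is at most `|u| ^ p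
+ K ^ p`, and `K ^ p` is integrable off the ball since `-(Q + s p) p + Q < 0`. -/
theorem integrableOn_tail {h m : ℕ} (hh : 1 ≤ h) (hn : h ≤ n) {s p : ℝ} (hp : 1 < p) (hs : 0 < s)
    (x₀ : EuclideanSpace ℝ (Fin n)) {R : ℝ} (hR : 0 < R) {u : EuclideanSpace ℝ (Fin n) → ℝ}
    (hu : MemLp u (ENNReal.ofReal p) volume) :
    IntegrableOn (fun x => |max (-u x) 0| ^ (p - 1) * kernel h m s p x x₀)
      (ccBall h m x₀ R)ᶜ volume := by
  have hd := (measurable_ccDist m hh hn).comp (measurable_id.prodMk (measurable_const (a := x₀)))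
  have hKm : Measurable fun x => kernel h m s p x x₀ := hd.pow_const _
  have hum := hu.1.aemeasurable
  have h1 : Integrable (fun x => |u x| ^ p) volume := by
    have := hu.integrable_norm_rpow (by simpa using (by linarith : 0 < p)) ENNReal.ofReal_ne_top
    simpa [ENNReal.toReal_ofReal (by linarith : 0 ≤ p), Real.norm_eq_abs] using this
  have hset : (ccBall h m x₀ R)ᶜ = {y | R ≤ ccDist h m x₀ y} := by
    ext y
    rw [Set.mem_compl_iff, Set.mem_ofPred_eq, ccDist_comm]
    exact not_lt (a := ccDist h m y x₀)
  have h2 : IntegrableOn (fun x => kernel h m s p x x₀ ^ p) (ccBall h m x₀ R)ᶜ volume := by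
    refine ⟨(hKm.pow_const p).aestronglyMeasurable, ?_⟩
    rw [hasFiniteIntegral_iff_ofReal (Filter.Eventually.of_forall fun x =>
      Real.rpow_nonneg (kernel_nonneg h m s p x x₀) p)]
    obtain ⟨C, _, hC⟩ := lintegral_rpow_compl_ball_le (n := n)
      (α := (-(homDim n h m) - s * p) * p) m hh hn (by
        have hQ := homDim_eq (n := n) m hn
        have h1 : (0 : ℝ) ≤ ((m * (n - h) : ℕ) : ℝ) := Nat.cast_nonneg _
        have h2 : (0 : ℝ) < n := by exact_mod_cast (hh.trans hn : 0 < n)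
        have h3 : 0 < s * p * p := by have : 0 < p := by linarith
                                      positivity
        rw [hQ]
        nlinarith)
    refine lt_of_eq_of_lt ?_ ((hC x₀ R hR).trans_lt ENNReal.ofReal_lt_top)
    rw [hset]
    refine lintegral_congr fun x => ?_
    rw [kernel, ← Real.rpow_mul (ccDist_nonneg _ _ _ _), ccDist_comm]
  refine (h1.integrableOn.add h2).mono' (AEMeasurable.aestronglyMeasurable ?_)
    (Filter.Eventually.of_forall fun x => ?_)
  · exact ((measurable_norm.comp_aemeasurable
      (hum.restrict.neg.max aemeasurable_const)).pow_const (p - 1)).mul hKm.aemeasurable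
  · have hK := kernel_nonneg h m s p x x₀
    have h3 := abs_abs_rpow_mul_mul_le hp |max (-u x) 0| (kernel h m s p x x₀)
    rw [abs_rpow_sub_two_mul_self hp (abs_nonneg _), abs_abs, abs_of_nonneg hK] at h3
    refine h3.trans (add_le_add (Real.rpow_le_rpow (abs_nonneg _) ?_ (by linarith)) le_rfl)
    rw [abs_of_nonneg (le_max_right _ _)]
    exact max_le (neg_le_abs _) (abs_nonneg _)

theorem setIntegral_tail_eq {h m : ℕ} {s p : ℝ} (hp : 1 < p) (x₀ : EuclideanSpace ℝ (Fin n))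
    {R : ℝ} (hR : 0 < R) (v : EuclideanSpace ℝ (Fin n) → ℝ) :
    ∫ x in (ccBall h m x₀ R)ᶜ, |v x| ^ (p - 1) * kernel h m s p x x₀ =
      R ^ (-(s * p)) * tail h m s p v x₀ R ^ (p - 1) := by
  have h0 : 0 ≤ ∫ x in (ccBall h m x₀ R)ᶜ, |v x| ^ (p - 1) * kernel h m s p x x₀ :=
    integral_nonneg fun x =>
      mul_nonneg (Real.rpow_nonneg (abs_nonneg _) _) (kernel_nonneg _ _ _ _ _ _)
  rw [tail, ← Real.rpow_mul (mul_nonneg (Real.rpow_nonneg hR.le _) h0),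
    one_div_mul_cancel (by linarith), Real.rpow_one, ← mul_assoc, ← Real.rpow_add hR]
  simp

theorem tail_nonneg (h m : ℕ) (s p : ℝ) (v : EuclideanSpace ℝ (Fin n) → ℝ)
    (x₀ : EuclideanSpace ℝ (Fin n)) {R : ℝ} (hR : 0 < R) : 0 ≤ tail h m s p v x₀ R :=
  Real.rpow_nonneg (mul_nonneg (Real.rpow_nonneg hR.le _) (integral_nonneg fun _ =>
      mul_nonneg (Real.rpow_nonneg (abs_nonneg _) _) (kernel_nonneg _ _ _ _ _ _))) _

theorem lintegral_tail_le {h m : ℕ} (hh : 1 ≤ h) (hn : h ≤ n) {s p : ℝ} (hp : 1 < p) (hs : 0 < s)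
    {x₀ : EuclideanSpace ℝ (Fin n)} {r R : ℝ} (hr : 0 < r) (hrR : r ≤ R / 2)
    {u : EuclideanSpace ℝ (Fin n) → ℝ} (hu : MemLp u (ENNReal.ofReal p) volume)
    (hpos : ∀ᵐ x, x ∈ ccBall h m x₀ R → 0 ≤ u x) :
    ∫⁻ x, ∫⁻ y, ENNReal.ofReal
        (kernel h m s p x y * (cutoff h m x₀ r x ^ p * max (-u y) 0 ^ (p - 1))) ≤
      ENNReal.ofReal (4 ^ (homDim n h m + s * p) *
        (R ^ (-(s * p)) * tail h m s p (fun x => max (-(u x)) 0) x₀ R ^ (p - 1))) *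
        volume (ccBall h m x₀ (3 / 2 * r)) := by
  have hR : 0 < R := by linarith
  have hball := measurableSet_ccBall m hh hn x₀ (3 / 2 * r)
  have hballR := measurableSet_ccBall m hh hn x₀ R
  have hα : 0 ≤ homDim n h m + s * p := by
    rw [homDim_eq m hn]
    have : 0 < s * p := mul_pos hs (by linarith)
    positivity
  rw [← setIntegral_tail_eq hp x₀ hR, ← setLIntegral_const, ← lintegral_indicator hball]
  refine lintegral_mono fun x => ?_
  by_cases hx : x ∈ ccBall h m x₀ (3 / 2 * r)
  · rw [Set.indicator_of_mem hx, ENNReal.ofReal_mul (by positivity),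
      ofReal_integral_eq_lintegral_ofReal (integrableOn_tail hh hn hp hs x₀ hR hu)
        (Filter.Eventually.of_forall fun y => mul_nonneg (Real.rpow_nonneg (abs_nonneg _) _)
          (kernel_nonneg _ _ _ _ _ _)), ← lintegral_const_mul' _ _ ENNReal.ofReal_ne_top,
      ← lintegral_indicator hballR.compl]
    refine lintegral_mono_ae ?_
    filter_upwards [hpos] with y hy
    by_cases hyR : y ∈ ccBall h m x₀ R
    · have h0 : max (-u y) 0 = 0 := max_eq_right (by linarith [hy hyR])
      rw [h0, Real.zero_rpow (by linarith), mul_zero, mul_zero, ENNReal.ofReal_zero]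
      exact zero_le
    · rw [Set.indicator_of_mem hyR, ← ENNReal.ofReal_mul (by positivity)]
      refine ENNReal.ofReal_le_ofReal ?_
      have h1 : ccDist h m x x₀ < 3 / 2 * r := hx
      have h2 : R ≤ ccDist h m y x₀ := not_lt.mp hyR
      have h3 := ccDist_triangle m hh hn y x x₀
      rw [ccDist_comm h m y x] at h3
      -- `d_C(x, x₀) < 3 r / 2 ≤ 3 R / 4 ≤ (3 / 4) d_C(y, x₀)`; this is the source of the constant
      -- `4 ^ (Q + s p)`.
      have h4 : ccDist h m y x₀ / 4 ≤ ccDist h m x y := by linarith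
      have h5 : 0 < ccDist h m y x₀ := hR.trans_le h2
      have h6 : kernel h m s p x y ≤ 4 ^ (homDim n h m + s * p) * kernel h m s p y x₀ := by
        calc kernel h m s p x y ≤ (ccDist h m y x₀ / 4) ^ (-(homDim n h m) - s * p) :=
              Real.rpow_le_rpow_of_nonpos (by positivity) h4 (by linarith)
          _ = _ := by
              rw [Real.div_rpow h5.le (by norm_num), kernel,
                show -(homDim n h m) - s * p = -(homDim n h m + s * p) by ring,
                Real.rpow_neg (by norm_num : (0 : ℝ) ≤ 4)]
              field_simp
      have hφ := cutoff_mem_Icc h m x₀ r x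
      have h7 : cutoff h m x₀ r x ^ p ≤ 1 := Real.rpow_le_one hφ.1 hφ.2 (by linarith)
      have h8 : 0 ≤ max (-u y) 0 ^ (p - 1) := Real.rpow_nonneg (le_max_right _ _) _
      have h9 := kernel_nonneg h m s p y x₀
      rw [abs_of_nonneg (le_max_right (-u y) 0)]
      calc _ ≤ 4 ^ (homDim n h m + s * p) * kernel h m s p y x₀ *
            (1 * max (-u y) 0 ^ (p - 1)) :=
            mul_le_mul h6 (mul_le_mul_of_nonneg_right h7 h8)
              (mul_nonneg (Real.rpow_nonneg hφ.1 _) h8) (by positivity)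
        _ = _ := by ring
  · have h0 : cutoff h m x₀ r x = 0 := by
      by_contra h0
      exact hx (mem_ccBall_of_cutoff_ne_zero hr h0)
    simp [h0, Real.zero_rpow (by linarith : p ≠ 0)]

/-! ### Functions of finite energy in the strongly singular range vanish -/

theorem ofReal_abs_rpow {p : ℝ} (hp : 0 ≤ p) (a : ℝ) : ENNReal.ofReal (|a| ^ p) = ‖a‖ₑ ^ p := by
  rw [Real.enorm_eq_ofReal_abs, ENNReal.ofReal_rpow_of_nonneg (abs_nonneg a) hp]

/-- The half-space is open, nonempty and invariant under dilation by 2, so a finite volume would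
equal `2 ^ (-n)` times itself. -/
theorem volume_halfSpace (i : Fin n) {σ : ℝ} (hσ : σ ≠ 0) :
    volume {z : EuclideanSpace ℝ (Fin n) | 0 < σ * z i} = ∞ := by
  set Z := {z : EuclideanSpace ℝ (Fin n) | 0 < σ * z i} with hZ
  have hpos : volume Z ≠ 0 := by
    refine (IsOpen.measure_pos volume (isOpen_lt continuous_const (by fun_prop))
      ⟨EuclideanSpace.single i σ, ?_⟩).ne'
    simp only [Set.mem_ofPred_eq, PiLp.single_apply, if_true]
    exact mul_self_pos.mpr hσ
  have hpre : (fun z : EuclideanSpace ℝ (Fin n) => (2 : ℝ) • z) ⁻¹' Z = Z := by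
    ext z
    simp only [hZ, Set.mem_preimage, Set.mem_ofPred_eq, PiLp.smul_apply, smul_eq_mul]
    rw [mul_left_comm]
    exact mul_pos_iff_of_pos_left two_pos
  have h1 := Measure.addHaar_preimage_smul (volume : Measure (EuclideanSpace ℝ (Fin n)))
    (two_ne_zero (α := ℝ)) Z
  rw [hpre, finrank_euclideanSpace_fin] at h1
  by_contra htop
  have h2 := congrArg ENNReal.toReal h1
  rw [ENNReal.toReal_mul, ENNReal.toReal_ofReal (abs_nonneg _)] at h2
  have h3 : 0 < (volume Z).toReal := ENNReal.toReal_pos hpos htop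
  have hn : n ≠ 0 := fun h => by subst h; exact i.elim0
  have h4 : |((2 : ℝ) ^ n)⁻¹| < 1 := by
    rw [abs_of_pos (by positivity)]
    exact inv_lt_one_of_one_lt₀ (one_lt_pow₀ one_lt_two hn)
  nlinarith

theorem volume_hyperplane (i : Fin n) :
    volume {z : EuclideanSpace ℝ (Fin n) | z i = 0} = 0 := by
  let φ : EuclideanSpace ℝ (Fin n) →L[ℝ] ℝ := EuclideanSpace.proj i
  have h1 := Measure.addHaar_submodule (volume : Measure (EuclideanSpace ℝ (Fin n)))
    (LinearMap.ker φ.toLinearMap) (fun htop => by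
      have h2 : EuclideanSpace.single i (1 : ℝ) ∈ LinearMap.ker φ.toLinearMap := by
        rw [htop]; trivial
      simp [φ] at h2)
  exact h1

/-- Moving the first coordinates first keeps `|x|_h ≥ ε`, so the last coordinates can then be moved
at bounded cost. -/
theorem ccDist_add_le_of_halfSpace {h : ℕ} (m : ℕ)
    {i₀ : Fin n} (hi₀ : (i₀ : ℕ) < h) {σ ε : ℝ} (hσ : |σ| = 1) (hε : 0 < ε)
    {x z : EuclideanSpace ℝ (Fin n)} (hx : ε < σ * x i₀) (hz : 0 < σ * z i₀) :
    ccDist h m x (x + z) ≤ (∑ i : Fin n, 1 / weight h m ε i) * ‖z‖ := by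
  set z₁ : EuclideanSpace ℝ (Fin n) :=
    WithLp.toLp 2 fun i : Fin n => if (i : ℕ) < h then z i else 0 with hz₁
  set z₂ : EuclideanSpace ℝ (Fin n) :=
    WithLp.toLp 2 fun i : Fin n => if (i : ℕ) < h then 0 else z i with hz₂
  have hsum : x + z₁ + z₂ = x + z := by
    ext i
    simp only [PiLp.add_apply, hz₁, hz₂]
    split_ifs <;> ring
  have hle : ε ≤ hNorm h (x + z₁) := by
    have h1 := abs_apply_le_hNorm h (x + z₁) hi₀
    have h2 : σ * (x + z₁) i₀ ≤ |(x + z₁) i₀| := by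
      refine (le_abs_self _).trans (le_of_eq ?_)
      rw [abs_mul, hσ, one_mul]
    have h3 : σ * (x + z₁) i₀ = σ * x i₀ + σ * z i₀ := by
      simp only [PiLp.add_apply, hz₁, hi₀, if_true]
      ring
    linarith
  have b1 := ccEDist_add_le_of_first h m x z₁ fun i hi => by simp [hz₁, hi]
  have b2 := ccEDist_add_le_of_last h m (x + z₁) z₂ (hε.trans_le hle)
    fun i hi => by simp [hz₂, hi]
  rw [hsum] at b2
  have hnn : 0 ≤ (∑ i : Fin n, 1 / weight h m ε i) * ‖z‖ :=
    mul_nonneg (Finset.sum_nonneg fun i _ => one_div_nonneg.mpr (weight_pos h m hε i).le)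
      (norm_nonneg z)
  refine ENNReal.toReal_le_of_le_ofReal hnn
    ((ccEDist_triangle h m x (x + z₁) (x + z)).trans ((add_le_add b1 b2).trans ?_))
  rw [← ENNReal.ofReal_add (Finset.sum_nonneg fun i _ => abs_nonneg _)
    (Finset.sum_nonneg fun i _ => div_nonneg (abs_nonneg _)
      (weight_pos h m (hε.trans_le hle) i).le), ← Finset.sum_add_distrib, Finset.sum_mul]
  refine ENNReal.ofReal_le_ofReal (Finset.sum_le_sum fun i _ => ?_)
  have hzi : |z i| ≤ ‖z‖ := PiLp.norm_apply_le z i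
  by_cases hi : (i : ℕ) < h
  · simpa [hz₁, hz₂, hi, weight] using hzi
  · simp only [hz₁, hz₂, hi, if_false, abs_zero, zero_add]
    rw [one_div_mul_eq_div]
    exact div_le_div₀ (norm_nonneg z) hzi (weight_pos h m hε i) (weight_mono h m hε.le hle i)

theorem lintegral_eq_mul_lintegral_smul {g : EuclideanSpace ℝ (Fin n) → ℝ≥0∞} (hg : Measurable g) :
    ∫⁻ z, g z = ENNReal.ofReal (2 ^ n) * ∫⁻ z, g ((2 : ℝ) • z) := by
  have h1 : ∫⁻ z, g ((2 : ℝ) • z) = ENNReal.ofReal ((2 ^ n)⁻¹) * ∫⁻ z, g z := by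
    rw [← lintegral_map hg (measurable_const_smul (2 : ℝ)),
      Measure.map_addHaar_smul _ (two_ne_zero (α := ℝ)), lintegral_smul_measure,
      finrank_euclideanSpace_fin, abs_of_pos (by positivity), smul_eq_mul]
  rw [h1, ← mul_assoc, ← ENNReal.ofReal_mul (by positivity),
    mul_inv_cancel₀ (by positivity), ENNReal.ofReal_one, one_mul]

/-- The `p`-th power of the `L^p` norm on `U` of the increment of `u` by `z`. -/
noncomputable def increment (p : ℝ) (U : Set (EuclideanSpace ℝ (Fin n)))
    (u : EuclideanSpace ℝ (Fin n) → ℝ) (z : EuclideanSpace ℝ (Fin n)) : ℝ≥0∞ :=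
  ∫⁻ x in U, ‖u (x + z) - u x‖ₑ ^ p

theorem measurable_increment_integrand (p : ℝ) {u : EuclideanSpace ℝ (Fin n) → ℝ}
    (hu : Measurable u) :
    Measurable fun w : EuclideanSpace ℝ (Fin n) × EuclideanSpace ℝ (Fin n) =>
      ‖u (w.1 + w.2) - u w.1‖ₑ ^ p :=
  (((hu.comp (measurable_fst.add measurable_snd)).sub (hu.comp measurable_fst)).enorm).pow_const p

theorem measurable_increment (p : ℝ) (U : Set (EuclideanSpace ℝ (Fin n)))
    {u : EuclideanSpace ℝ (Fin n) → ℝ} (hu : Measurable u) : Measurable (increment p U u) :=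
  (measurable_increment_integrand p hu).lintegral_prod_left'

/-- An increment by `2 z` is two increments by `z`; the second is the first translated, and the
translation stays in `U`. -/
theorem increment_two_smul_le {p : ℝ} (hp : 1 ≤ p) {U : Set (EuclideanSpace ℝ (Fin n))}
    (hU : MeasurableSet U) {u : EuclideanSpace ℝ (Fin n) → ℝ} (hu : Measurable u)
    {z : EuclideanSpace ℝ (Fin n)} (hz : ∀ x ∈ U, x + z ∈ U) :
    increment p U u ((2 : ℝ) • z) ≤ 2 ^ p * increment p U u z := by
  have hm : Measurable fun x => ‖u (x + z) - u x‖ₑ ^ p :=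
    (((hu.comp (measurable_add_const z)).sub hu).enorm).pow_const p
  have hshift : ∫⁻ x in U, ‖u (x + z + z) - u (x + z)‖ₑ ^ p ≤ increment p U u z := by
    unfold increment
    rw [← lintegral_indicator hU, ← lintegral_indicator hU]
    calc _ ≤ ∫⁻ x, U.indicator (fun x => ‖u (x + z) - u x‖ₑ ^ p) (x + z) := by
          refine lintegral_mono fun x => ?_
          by_cases hx : x ∈ U
          · rw [Set.indicator_of_mem hx, Set.indicator_of_mem (hz x hx)]
          · rw [Set.indicator_of_notMem hx]
            exact zero_le
      _ = _ := lintegral_add_right_eq_self _ z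
  calc increment p U u ((2 : ℝ) • z)
      ≤ ∫⁻ x in U, 2 ^ (p - 1) *
          (‖u (x + z + z) - u (x + z)‖ₑ ^ p + ‖u (x + z) - u x‖ₑ ^ p) := by
        refine lintegral_mono fun x => ?_
        refine le_trans ?_ (ENNReal.rpow_add_le_mul_rpow_add_rpow _ _ hp)
        refine ENNReal.rpow_le_rpow ?_ (by linarith)
        rw [two_smul, ← add_assoc]
        refine le_trans (le_of_eq ?_) (enorm_add_le _ _)
        congr 1
        ring
    _ = 2 ^ (p - 1) * ((∫⁻ x in U, ‖u (x + z + z) - u (x + z)‖ₑ ^ p) + increment p U u z) := by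
        rw [lintegral_const_mul' _ _ (ENNReal.rpow_ne_top_of_nonneg (by linarith) (by simp)),
          lintegral_add_right _ hm]
        rfl
    _ ≤ 2 ^ (p - 1) * (increment p U u z + increment p U u z) := by gcongr
    _ = 2 ^ p * increment p U u z := by
        rw [← two_mul, ← mul_assoc]
        congr 1
        conv_lhs => rw [← ENNReal.rpow_one 2, ← ENNReal.rpow_mul, one_mul]
        rw [← ENNReal.rpow_add _ _ (by simp) (by simp)]
        congr 1
        ring

/-- With `f` the increment, put `W a = |z|^(-N) e^(-a |z|) f` on `Z`. Substituting `2 z` and using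
`f(2 z) ≤ 2^p f(z)` gives `∫ W 1 ≤ 2^(n + p - N) ∫ W 2 ≤ ∫ W 2`, while `W 2 < W 1` wherever `0 < f <
∞`. The exponential weight supplies the strictness that pure scaling lacks in the borderline case `N
= n + p`. -/
theorem increment_ae_eq_zero {p N : ℝ} (hp : 1 ≤ p) (hN : n + p ≤ N)
    {U Z : Set (EuclideanSpace ℝ (Fin n))} (hU : MeasurableSet U) (hZ : MeasurableSet Z)
    (hZ2 : ∀ z, (2 : ℝ) • z ∈ Z ↔ z ∈ Z) (hZ0 : (0 : EuclideanSpace ℝ (Fin n)) ∉ Z)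
    (hUZ : ∀ x ∈ U, ∀ z ∈ Z, x + z ∈ U) {u : EuclideanSpace ℝ (Fin n) → ℝ} (hu : Measurable u)
    (hfin : ∫⁻ z in Z, ENNReal.ofReal (‖z‖ ^ (-N)) * increment p U u z ≠ ∞) :
    ∀ᵐ z, z ∈ Z → increment p U u z = 0 := by
  set f := increment p U u with hf
  have hfm : Measurable f := measurable_increment p U hu
  set W : ℝ → EuclideanSpace ℝ (Fin n) → ℝ≥0∞ := fun a =>
    Z.indicator fun z => ENNReal.ofReal (‖z‖ ^ (-N) * Real.exp (-a * ‖z‖)) * f z with hW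
  have hWm : ∀ a, Measurable (W a) := fun a =>
    ((((measurable_norm.pow_const _).mul
      (Real.measurable_exp.comp (measurable_norm.const_mul _))).ennreal_ofReal).mul hfm).indicator hZ
  have hle : ∀ z, W 2 z ≤ W 1 z := fun z => by
    refine Set.indicator_le_indicator ?_
    gcongr
    norm_num
  have hfin1 : ∫⁻ z, W 1 z ≠ ∞ := by
    refine ne_top_of_le_ne_top hfin ?_
    rw [← lintegral_indicator hZ]
    refine lintegral_mono fun z => Set.indicator_le_indicator ?_
    gcongr
    refine mul_le_of_le_one_right (Real.rpow_nonneg (norm_nonneg z) _) ?_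
    rw [Real.exp_le_one_iff]
    linarith [norm_nonneg z]
  have hscale : ∫⁻ z, W 1 z ≤ ∫⁻ z, W 2 z := by
    rw [lintegral_eq_mul_lintegral_smul (hWm 1)]
    calc ENNReal.ofReal (2 ^ n) * ∫⁻ z, W 1 ((2 : ℝ) • z)
        ≤ ENNReal.ofReal (2 ^ n) * ∫⁻ z, ENNReal.ofReal (2 ^ (-N + p)) * W 2 z := by
          gcongr with z
          by_cases hz : z ∈ Z
          · simp only [hW, Set.indicator_of_mem hz, Set.indicator_of_mem ((hZ2 z).mpr hz)]
            have h1 := increment_two_smul_le hp hU hu fun x hx => hUZ x hx z hz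
            calc _ ≤ ENNReal.ofReal (‖(2 : ℝ) • z‖ ^ (-N) * Real.exp (-1 * ‖(2 : ℝ) • z‖)) *
                  (2 ^ p * f z) := by gcongr
              _ = ENNReal.ofReal (‖(2 : ℝ) • z‖ ^ (-N) * Real.exp (-1 * ‖(2 : ℝ) • z‖)) *
                  ENNReal.ofReal (2 ^ p) * f z := by
                  rw [← ENNReal.ofReal_rpow_of_pos two_pos, ENNReal.ofReal_ofNat, mul_assoc]
              _ = _ := by
                  rw [← ENNReal.ofReal_mul (by positivity), ← mul_assoc,
                    ← ENNReal.ofReal_mul (by positivity), norm_smul, Real.norm_two,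
                    Real.mul_rpow zero_le_two (norm_nonneg z), Real.rpow_add two_pos]
                  congr 2
                  rw [show -1 * (2 * ‖z‖) = -2 * ‖z‖ by ring]
                  ring
          · have hz' : (2 : ℝ) • z ∉ Z := fun h => hz ((hZ2 z).mp h)
            simp [hW, Set.indicator_of_notMem hz']
      _ = ENNReal.ofReal (2 ^ ((n : ℝ) + (-N + p))) * ∫⁻ z, W 2 z := by
          rw [lintegral_const_mul' _ _ ENNReal.ofReal_ne_top, ← mul_assoc,
            ← ENNReal.ofReal_mul (by positivity), Real.rpow_add two_pos (n : ℝ),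
            Real.rpow_natCast]
      _ ≤ 1 * ∫⁻ z, W 2 z := by
          gcongr
          rw [ENNReal.ofReal_le_one]
          exact Real.rpow_le_one_of_one_le_of_nonpos one_le_two (by linarith)
      _ = _ := one_mul _
  have heq := ae_eq_of_ae_le_of_lintegral_le (Filter.Eventually.of_forall hle)
    (ne_top_of_le_ne_top hfin1 (lintegral_mono hle)) (hWm 1).aemeasurable hscale
  filter_upwards [heq, ae_lt_top (hWm 1) hfin1] with z hz hlt hzZ
  simp only [hW, Set.indicator_of_mem hzZ] at hz hlt
  have hz0 : 0 < ‖z‖ := norm_pos_iff.mpr fun h => hZ0 (h ▸ hzZ)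
  have hlt' : ‖z‖ ^ (-N) * Real.exp (-2 * ‖z‖) < ‖z‖ ^ (-N) * Real.exp (-1 * ‖z‖) := by
    have := Real.rpow_pos_of_pos hz0 (-N)
    gcongr
    norm_num
  by_contra hf0
  have hftop : f z ≠ ∞ := by
    intro htop
    rw [htop, ENNReal.mul_top] at hlt
    · exact lt_irrefl _ hlt
    · rw [ne_eq, ENNReal.ofReal_eq_zero, not_le]
      have := Real.rpow_pos_of_pos hz0 (-N)
      positivity
  refine absurd hz (ne_of_lt ?_)
  refine ENNReal.mul_lt_mul_left hf0 hftop ?_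
  exact (ENNReal.ofReal_lt_ofReal_iff (by
    have := Real.rpow_pos_of_pos hz0 (-N)
    positivity)).mpr hlt'

/-- By Tonelli, for a.e. `x ∈ U` the value `u x` is repeated at `x + z` for almost every `z` in a
set of infinite volume; a nonzero value would contradict `L^p` integrability. -/
theorem ae_eq_zero_of_increment {p : ℝ} (hp : 0 < p) {U Z : Set (EuclideanSpace ℝ (Fin n))}
    (hU : MeasurableSet U) (hZ : MeasurableSet Z) (hZvol : volume Z = ∞)
    {u : EuclideanSpace ℝ (Fin n) → ℝ} (hu : Measurable u)
    (hLp : ∫⁻ x, ‖u x‖ₑ ^ p ≠ ∞) (hinc : ∀ᵐ z, z ∈ Z → increment p U u z = 0) :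
    ∀ᵐ x, x ∈ U → u x = 0 := by
  have hm := measurable_increment_integrand p hu
  have h0 : ∫⁻ x in U, ∫⁻ z in Z, ‖u (x + z) - u x‖ₑ ^ p = 0 := by
    rw [lintegral_lintegral_swap hm.aemeasurable]
    rw [lintegral_eq_zero_iff hm.lintegral_prod_left']
    rw [Filter.EventuallyEq, ae_restrict_iff' hZ]
    exact hinc
  rw [lintegral_eq_zero_iff hm.lintegral_prod_right', Filter.EventuallyEq,
    ae_restrict_iff' hU] at h0
  filter_upwards [h0] with x hx hxU
  have h1 := hx hxU
  simp only [Pi.zero_apply] at h1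
  have hmx : Measurable fun z => ‖u (x + z) - u x‖ₑ ^ p :=
    (((hu.comp (measurable_const_add x)).sub measurable_const).enorm).pow_const p
  rw [lintegral_eq_zero_iff hmx] at h1
  by_contra hne
  have h2 : ∫⁻ z in Z, ‖u (x + z)‖ₑ ^ p = ∞ := by
    calc ∫⁻ z in Z, ‖u (x + z)‖ₑ ^ p = ∫⁻ _z in Z, ‖u x‖ₑ ^ p := by
          refine lintegral_congr_ae ?_
          filter_upwards [h1] with z hz
          simp only [Pi.zero_apply, ENNReal.rpow_eq_zero_iff_of_pos hp,
            enorm_eq_zero] at hz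
          rw [sub_eq_zero.mp hz]
      _ = ∞ := by
          rw [setLIntegral_const, hZvol, ENNReal.mul_top]
          rw [ne_eq, ENNReal.rpow_eq_zero_iff_of_pos hp, enorm_eq_zero]
          exact hne
  refine hLp (top_le_iff.mp ?_)
  rw [← h2, ← lintegral_add_left_eq_self (fun y => ‖u y‖ₑ ^ p) x]
  exact setLIntegral_le_lintegral _ _

/-- Where `d_C ≤ C |z|`, the Euclidean kernel is at most `C ^ N` times the given one; the
substitution `y = x + z` does the rest. -/
theorem lintegral_increment_ne_top {h : ℕ} {m : ℕ} (hh : 1 ≤ h) (hn : h ≤ n) {s p : ℝ}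
    (hp : 0 ≤ p) {U Z : Set (EuclideanSpace ℝ (Fin n))} (hN : 0 ≤ homDim n h m + s * p)
    (hU : MeasurableSet U) (hZ : MeasurableSet Z)
    (hZ0 : (0 : EuclideanSpace ℝ (Fin n)) ∉ Z) {C : ℝ} (hC : 0 < C)
    (hd : ∀ x ∈ U, ∀ z ∈ Z, ccDist h m x (x + z) ≤ C * ‖z‖)
    {u : EuclideanSpace ℝ (Fin n) → ℝ} (hu : Measurable u)
    (hfin : gagliardoEnergy h m s p u < ∞) :
    ∫⁻ z in Z, ENNReal.ofReal (‖z‖ ^ (-(homDim n h m + s * p))) * increment p U u z ≠ ∞ := by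
  set N := homDim n h m + s * p with hNdef
  have hm := measurable_increment_integrand p hu
  have hm2 : Measurable fun w : EuclideanSpace ℝ (Fin n) × EuclideanSpace ℝ (Fin n) =>
      ENNReal.ofReal (‖w.2‖ ^ (-N)) * ‖u (w.1 + w.2) - u w.1‖ₑ ^ p :=
    ((measurable_snd.norm.pow_const _).ennreal_ofReal).mul hm
  have hle : ∫⁻ z in Z, ENNReal.ofReal (‖z‖ ^ (-N)) * increment p U u z ≤
      ENNReal.ofReal (C ^ N) * gagliardoEnergy h m s p u := by
    calc _ = ∫⁻ z in Z, ∫⁻ x in U, ENNReal.ofReal (‖z‖ ^ (-N)) * ‖u (x + z) - u x‖ₑ ^ p := by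
          refine lintegral_congr fun z => ?_
          rw [increment, lintegral_const_mul' _ _ ENNReal.ofReal_ne_top]
      _ = ∫⁻ x in U, ∫⁻ z in Z, ENNReal.ofReal (‖z‖ ^ (-N)) * ‖u (x + z) - u x‖ₑ ^ p :=
          (lintegral_lintegral_swap hm2.aemeasurable).symm
      _ ≤ ∫⁻ x in U, ∫⁻ z in Z, ENNReal.ofReal (C ^ N) *
            ENNReal.ofReal (kernel h m s p x (x + z) * |u x - u (x + z)| ^ p) := by
          refine setLIntegral_mono' hU fun x hx => setLIntegral_mono' hZ fun z hz => ?_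
          have hz0 : z ≠ 0 := fun h => hZ0 (h ▸ hz)
          have hzn : 0 < ‖z‖ := norm_pos_iff.mpr hz0
          have hdpos : 0 < ccDist h m x (x + z) := ccDist_pos m hh hn (by simpa using hz0)
          have h1 : (C * ‖z‖) ^ (-N) ≤ kernel h m s p x (x + z) := by
            rw [kernel, show -(homDim n h m) - s * p = -N by rw [hNdef]; ring]
            exact Real.rpow_le_rpow_of_nonpos hdpos (hd x hx z hz) (by linarith)
          have h2 : ‖z‖ ^ (-N) ≤ C ^ N * kernel h m s p x (x + z) := by
            rw [Real.mul_rpow hC.le hzn.le, Real.rpow_neg hC.le,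
              inv_mul_le_iff₀ (Real.rpow_pos_of_pos hC N)] at h1
            exact h1
          rw [← ofReal_abs_rpow hp, ← ENNReal.ofReal_mul (by positivity),
            ← ENNReal.ofReal_mul (by positivity), abs_sub_comm, ← mul_assoc]
          exact ENNReal.ofReal_le_ofReal (by gcongr)
      _ ≤ ∫⁻ x, ∫⁻ z, ENNReal.ofReal (C ^ N) *
            ENNReal.ofReal (kernel h m s p x (x + z) * |u x - u (x + z)| ^ p) :=
          (setLIntegral_le_lintegral _ _).trans
            (lintegral_mono fun x => setLIntegral_le_lintegral _ _)
      _ = _ := by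
          rw [gagliardoEnergy, ← lintegral_const_mul' _ _ ENNReal.ofReal_ne_top]
          refine lintegral_congr fun x => ?_
          rw [lintegral_const_mul' _ _ ENNReal.ofReal_ne_top, lintegral_add_left_eq_self
            (fun y => ENNReal.ofReal (kernel h m s p x y * |u x - u y| ^ p)) x]
  exact ne_top_of_le_ne_top (ENNReal.mul_ne_top ENNReal.ofReal_ne_top hfin.ne) hle

theorem ae_eq_zero_of_measurable {h : ℕ} {m : ℕ} (hh : 1 ≤ h) (hn : h ≤ n) {s p : ℝ}
    (hp : 1 < p) (hs : 0 < s) (hsp : p * (1 - s) ≤ ((m * (n - h) : ℕ) : ℝ))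
    {u : EuclideanSpace ℝ (Fin n) → ℝ} (hu : Measurable u) (hLp : ∫⁻ x, ‖u x‖ₑ ^ p ≠ ∞)
    (hfin : gagliardoEnergy h m s p u < ∞) : u =ᵐ[volume] 0 := by
  set i₀ : Fin n := ⟨0, by omega⟩ with hi₀
  have hi₀h : (i₀ : ℕ) < h := by simp [hi₀]; omega
  have hp0 : 0 < p := by linarith
  have hQ := homDim_eq (n := n) m hn
  have hN0 : 0 ≤ homDim n h m + s * p := by rw [hQ]; positivity
  have key : ∀ σ : ℝ, |σ| = 1 → ∀ ε : ℝ, 0 < ε → ∀ᵐ x : EuclideanSpace ℝ (Fin n),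
      ε < σ * x i₀ → u x = 0 := by
    intro σ hσ ε hε
    have hσ0 : σ ≠ 0 := by rintro rfl; simp at hσ
    have hlin : Continuous fun x : EuclideanSpace ℝ (Fin n) => σ * x i₀ := by fun_prop
    have hU : MeasurableSet {x : EuclideanSpace ℝ (Fin n) | ε < σ * x i₀} :=
      (isOpen_lt continuous_const hlin).measurableSet
    have hZ : MeasurableSet {x : EuclideanSpace ℝ (Fin n) | 0 < σ * x i₀} :=
      (isOpen_lt continuous_const hlin).measurableSet
    have hZ0 : (0 : EuclideanSpace ℝ (Fin n)) ∉ {x : EuclideanSpace ℝ (Fin n) | 0 < σ * x i₀} := by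
      simp
    refine ae_eq_zero_of_increment hp0 hU hZ (volume_halfSpace i₀ hσ0) hu hLp ?_
    -- The requirement `n + p ≤ Q + s p` is exactly `p (1 - s) ≤ m (n - h)`.
    refine increment_ae_eq_zero (N := homDim n h m + s * p) hp.le (by rw [hQ]; linarith) hU hZ
      (fun z => ?_) hZ0 (fun x hx z hz => ?_) hu ?_
    · simp only [Set.mem_ofPred_eq, PiLp.smul_apply, smul_eq_mul]
      rw [mul_left_comm]
      exact mul_pos_iff_of_pos_left two_pos
    · simp only [Set.mem_ofPred_eq, PiLp.add_apply] at hx hz ⊢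
      linarith
    · refine lintegral_increment_ne_top (C := ∑ i : Fin n, 1 / weight h m ε i) hh hn hp0.le hN0
        hU hZ hZ0 ?_ (fun x hx z hz => ccDist_add_le_of_halfSpace m hi₀h hσ hε hx hz) hu hfin
      exact Finset.sum_pos (fun i _ => one_div_pos.mpr (weight_pos h m hε i)) ⟨i₀, Finset.mem_univ _⟩
  -- Countably many half-spaces, on both sides, exhaust the complement of a null hyperplane.
  have h1 := ae_all_iff.mpr fun k : ℕ => key 1 abs_one (1 / ((k : ℝ) + 1)) (by positivity)
  have h2 := ae_all_iff.mpr fun k : ℕ => key (-1) (by simp) (1 / ((k : ℝ) + 1)) (by positivity)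
  have h3 : ∀ᵐ x : EuclideanSpace ℝ (Fin n), x i₀ ≠ 0 := by
    rw [ae_iff]
    simpa using volume_hyperplane i₀
  filter_upwards [h1, h2, h3] with x hx1 hx2 hx3
  rcases lt_or_gt_of_ne hx3 with hlt | hgt
  · obtain ⟨k, hk⟩ := exists_nat_one_div_lt (show 0 < -1 * x i₀ by linarith)
    exact hx2 k hk
  · obtain ⟨k, hk⟩ := exists_nat_one_div_lt (show 0 < 1 * x i₀ by linarith)
    exact hx1 k hk

/-- If `p (1 - s) ≤ m (n - h)`, then the space `W^{s,p}` is trivial. -/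
theorem MemW.ae_eq_zero {h : ℕ} {m : ℕ} (hh : 1 ≤ h) (hn : h ≤ n) {s p : ℝ}
    (hp : 1 < p) (hs : 0 < s) (hsp : p * (1 - s) ≤ ((m * (n - h) : ℕ) : ℝ))
    {u : EuclideanSpace ℝ (Fin n) → ℝ} (hu : MemW h m s p u) : u =ᵐ[volume] 0 := by
  have hum := hu.aemeasurable
  have hae : u =ᵐ[volume] hum.mk u := hum.ae_eq_mk
  refine hae.trans (ae_eq_zero_of_measurable hh hn hp hs hsp hum.measurable_mk ?_ ?_)
  · have h1 : ∫⁻ x, ‖hum.mk u x‖ₑ ^ p = ∫⁻ x, ‖u x‖ₑ ^ p :=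
      lintegral_congr_ae (by filter_upwards [hae] with x hx; rw [hx])
    rw [h1]
    have h2 := lintegral_rpow_enorm_lt_top_of_eLpNorm_lt_top
      (by simpa using (by linarith : 0 < p)) ENNReal.ofReal_ne_top hu.1.2
    rw [ENNReal.toReal_ofReal (by linarith)] at h2
    exact h2.ne
  · refine lt_of_eq_of_lt ?_ hu.2
    refine lintegral_congr_ae ?_
    filter_upwards [hae] with x hx
    refine lintegral_congr_ae ?_
    filter_upwards [hae] with y hy
    rw [hx, hy]

/-! ### Mean oscillation -/

/-- Jensen: `f x` minus the mean is the average of `f x - f y`, and the `p`-th power passes inside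
by convexity. -/
theorem average_abs_sub_average_rpow_le {α : Type*} [MeasurableSpace α] {μ : Measure α}
    [IsFiniteMeasure μ] [NeZero μ] {p M : ℝ} (hp : 1 ≤ p) {f : α → ℝ} (hf : AEMeasurable f μ)
    (hM : ∀ x, |f x| ≤ M) :
    ⨍ x, |f x - ⨍ y, f y ∂μ| ^ p ∂μ ≤
      (μ.real Set.univ)⁻¹ ^ 2 *
        (∫⁻ z, ENNReal.ofReal (|f z.1 - f z.2| ^ p) ∂(μ.prod μ)).toReal := by
  have hp0 : 0 ≤ p := by linarith
  have hfi : Integrable f μ := Integrable.of_bound hf.aestronglyMeasurable M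
    (Filter.Eventually.of_forall hM)
  have hbound : ∀ x y, ‖|f x - f y| ^ p‖ ≤ (2 * M) ^ p := fun x y => by
    rw [Real.norm_eq_abs, abs_of_nonneg (Real.rpow_nonneg (abs_nonneg _) _)]
    refine Real.rpow_le_rpow (abs_nonneg _) ((abs_sub _ _).trans ?_) hp0
    linarith [hM x, hM y]
  have hprodm : AEMeasurable (fun z : α × α => |f z.1 - f z.2| ^ p) (μ.prod μ) :=
    (measurable_norm.comp_aemeasurable (hf.comp_fst.sub hf.comp_snd)).pow_const p
  have hprod : Integrable (fun z : α × α => |f z.1 - f z.2| ^ p) (μ.prod μ) :=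
    Integrable.of_bound hprodm.aestronglyMeasurable ((2 * M) ^ p)
      (Filter.Eventually.of_forall fun z => hbound z.1 z.2)
  have hjensen : ∀ x, |f x - ⨍ y, f y ∂μ| ^ p ≤ ⨍ y, |f x - f y| ^ p ∂μ := fun x => by
    have hsub : AEMeasurable (fun y => f x - f y) μ := aemeasurable_const.sub hf
    have h1 : f x - ⨍ y, f y ∂μ = ⨍ y, (f x - f y) ∂μ := by
      conv_lhs => rw [← average_const μ (f x)]
      simp only [average_eq]
      rw [integral_sub (integrable_const _) hfi, smul_sub]
    have h2 : |⨍ y, (f x - f y) ∂μ| ≤ ⨍ y, |f x - f y| ∂μ := by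
      simp only [average_eq, smul_eq_mul]
      rw [abs_mul, abs_of_nonneg (inv_nonneg.mpr measureReal_nonneg)]
      exact mul_le_mul_of_nonneg_left abs_integral_le_integral_abs
        (inv_nonneg.mpr measureReal_nonneg)
    have h3 : (⨍ y, |f x - f y| ∂μ) ^ p ≤ ⨍ y, |f x - f y| ^ p ∂μ := by
      refine (convexOn_rpow hp).map_average_le
        (Real.continuous_rpow_const hp0).continuousOn isClosed_Ici
        (Filter.Eventually.of_forall fun y => Set.mem_Ici.mpr (abs_nonneg _)) ?_ ?_
      · exact ((integrable_const (f x)).sub hfi).abs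
      · exact Integrable.of_bound
          ((measurable_norm.comp_aemeasurable hsub).pow_const p).aestronglyMeasurable ((2 * M) ^ p)
          (Filter.Eventually.of_forall fun y => hbound x y)
    rw [h1]
    exact (Real.rpow_le_rpow (abs_nonneg _) h2 hp0).trans h3
  have hlhs : Integrable (fun x => |f x - ⨍ y, f y ∂μ| ^ p) μ := by
    refine Integrable.of_bound ((measurable_norm.comp_aemeasurable
      (hf.sub aemeasurable_const)).pow_const p).aestronglyMeasurable
      ((M + |⨍ y, f y ∂μ|) ^ p) (Filter.Eventually.of_forall fun x => ?_)
    rw [Real.norm_eq_abs, abs_of_nonneg (Real.rpow_nonneg (abs_nonneg _) _)]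
    refine Real.rpow_le_rpow (abs_nonneg _) ((abs_sub _ _).trans ?_) hp0
    linarith [hM x]
  have hint : ∫ x, |f x - ⨍ y, f y ∂μ| ^ p ∂μ ≤
      (μ.real Set.univ)⁻¹ * ∫ x, ∫ y, |f x - f y| ^ p ∂μ ∂μ := by
    rw [← integral_const_mul]
    refine integral_mono hlhs (hprod.integral_prod_left.const_mul _) fun x => ?_
    refine (hjensen x).trans (le_of_eq ?_)
    rw [average_eq, smul_eq_mul]
  have h4 : ∫ x, ∫ y, |f x - f y| ^ p ∂μ ∂μ =
      (∫⁻ z, ENNReal.ofReal (|f z.1 - f z.2| ^ p) ∂(μ.prod μ)).toReal := by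
    rw [← integral_prod _ hprod]
    exact integral_eq_lintegral_of_nonneg_ae (Filter.Eventually.of_forall fun z =>
      Real.rpow_nonneg (abs_nonneg _) _) hprodm.aestronglyMeasurable
  rw [← h4, average_eq, smul_eq_mul, sq, mul_assoc]
  exact mul_le_mul_of_nonneg_left hint (inv_nonneg.mpr measureReal_nonneg)

theorem truncLog_mem_Icc (a d : ℝ) {b : ℝ} (hb : 1 < b) (u : EuclideanSpace ℝ (Fin n) → ℝ)
    (x : EuclideanSpace ℝ (Fin n)) : truncLog a b d u x ∈ Set.Icc 0 (Real.log b) :=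
  ⟨le_min (le_max_right _ _) (Real.log_pos hb).le, min_le_right _ _⟩

theorem abs_truncLog_sub_le (a b d : ℝ) (u : EuclideanSpace ℝ (Fin n) → ℝ)
    (x y : EuclideanSpace ℝ (Fin n)) :
    |truncLog a b d u x - truncLog a b d u y| ≤ |Real.log (u x + d) - Real.log (u y + d)| := by
  unfold truncLog
  calc _ ≤ |max (Real.log (a + d) - Real.log (u x + d)) 0 -
          max (Real.log (a + d) - Real.log (u y + d)) 0| :=
        (abs_min_sub_min_le_max _ _ _ _).trans (by simp)
    _ ≤ |Real.log (a + d) - Real.log (u x + d) - (Real.log (a + d) - Real.log (u y + d))| :=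
        (abs_max_sub_max_le_max _ _ _ _).trans (by simp)
    _ = _ := by rw [sub_sub_sub_cancel_left, abs_sub_comm]

theorem aemeasurable_truncLog (a b d : ℝ) {u : EuclideanSpace ℝ (Fin n) → ℝ}
    (hu : AEMeasurable u volume) : AEMeasurable (truncLog a b d u) volume :=
  (((aemeasurable_const.sub (Real.measurable_log.comp_aemeasurable
    (hu.add aemeasurable_const))).max aemeasurable_const).min aemeasurable_const)

theorem volume_ccBall_pos {h : ℕ} (m : ℕ) (hh : 1 ≤ h) (hn : h ≤ n)
    (x₀ : EuclideanSpace ℝ (Fin n)) {r : ℝ} (hr : 0 < r) : 0 < volume (ccBall h m x₀ r) := by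
  refine lt_of_lt_of_le ?_ (volume_ccBall_ge m hh hn x₀ hr)
  have hn0 : (0 : ℝ) < n := by exact_mod_cast (hh.trans hn : 0 < n)
  have := hNorm_nonneg h x₀
  rw [ENNReal.ofReal_pos]
  positivity

/-- The mean oscillation of the truncated logarithm is controlled by the energy of the
logarithm. -/
theorem oscillation_truncLog_le {h : ℕ} (m : ℕ) (hh : 1 ≤ h) (hn : h ≤ n) {s p a b d : ℝ}
    (hp : 1 < p) (hs : 0 < s) (hb : 1 < b) {u : EuclideanSpace ℝ (Fin n) → ℝ}
    (hu : AEMeasurable u volume) (x₀ : EuclideanSpace ℝ (Fin n)) {r : ℝ} (hr : 0 < r)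
    (hfin : ∫⁻ z in ccBall h m x₀ r ×ˢ ccBall h m x₀ r,
        ENNReal.ofReal (kernel h m s p z.1 z.2 *
          |Real.log (u z.1 + d) - Real.log (u z.2 + d)| ^ p) ∂(volume.prod volume) ≠ ∞) :
    (⨍ x in ccBall h m x₀ r,
        |truncLog a b d u x - ⨍ y in ccBall h m x₀ r, truncLog a b d u y| ^ p) ≤
      ((volume (ccBall h m x₀ r)).toReal)⁻¹ ^ 2 * ((2 * r) ^ (homDim n h m + s * p) *
        (∫⁻ z in ccBall h m x₀ r ×ˢ ccBall h m x₀ r,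
          ENNReal.ofReal (kernel h m s p z.1 z.2 *
            |Real.log (u z.1 + d) - Real.log (u z.2 + d)| ^ p) ∂(volume.prod volume)).toReal) := by
  set B := ccBall h m x₀ r with hB
  set N := homDim n h m + s * p with hN
  have hN0 : 0 ≤ N := by
    have : 0 < p := by linarith
    rw [hN, homDim_eq m hn]
    positivity
  have hBm : MeasurableSet B := measurableSet_ccBall m hh hn x₀ r
  have hBfin : IsFiniteMeasure (volume.restrict B) :=
    ⟨by simpa using volume_ccBall_lt_top m hh hn x₀ hr⟩
  have hBpos : NeZero (volume.restrict B) :=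
    ⟨fun h0 => (volume_ccBall_pos m hh hn x₀ hr).ne' (Measure.restrict_eq_zero.mp h0)⟩
  have h1 := average_abs_sub_average_rpow_le (μ := volume.restrict B) (p := p) hp.le
    (aemeasurable_truncLog a b d hu).restrict (M := Real.log b) (fun x => by
      have := truncLog_mem_Icc a d hb u x
      rw [abs_of_nonneg this.1]
      exact this.2)
  have hreal : (volume.restrict B).real Set.univ = (volume B).toReal := by
    simp [Measure.real]
  rw [hreal, Measure.prod_restrict] at h1
  refine h1.trans (mul_le_mul_of_nonneg_left ?_ (by positivity))
  rw [← ENNReal.toReal_ofReal (show 0 ≤ (2 * r) ^ N by positivity), ← ENNReal.toReal_mul]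
  refine ENNReal.toReal_mono (ENNReal.mul_ne_top ENNReal.ofReal_ne_top hfin) ?_
  rw [← lintegral_const_mul' _ _ ENNReal.ofReal_ne_top]
  refine setLIntegral_mono' (hBm.prod hBm) fun z hz => ?_
  rw [← ENNReal.ofReal_mul (by positivity)]
  refine ENNReal.ofReal_le_ofReal ?_
  have hK := kernel_nonneg h m s p z.1 z.2
  -- On the diagonal the kernel is a power of 0 and has no useful lower bound, but the difference
  -- vanishes there.
  by_cases hzz : z.1 = z.2
  · rw [hzz, sub_self, abs_zero, Real.zero_rpow (by linarith)]
    have := kernel_nonneg h m s p z.2 z.2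
    positivity
  · have hd := ccDist_pos m hh hn hzz
    have hlt : ccDist h m z.1 z.2 ≤ 2 * r := by
      have t := ccDist_triangle m hh hn z.1 x₀ z.2
      have t1 : ccDist h m z.1 x₀ < r := hz.1
      have t2 : ccDist h m z.2 x₀ < r := hz.2
      rw [ccDist_comm h m x₀ z.2] at t
      linarith
    have h2 : 1 ≤ (2 * r) ^ N * kernel h m s p z.1 z.2 := by
      have h3 : (2 * r) ^ (-N) ≤ kernel h m s p z.1 z.2 := by
        rw [kernel, show -(homDim n h m) - s * p = -N by rw [hN]; ring]
        exact Real.rpow_le_rpow_of_nonpos hd hlt (by linarith)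
      rw [Real.rpow_neg (by positivity)] at h3
      exact (inv_le_iff_one_le_mul₀' (by positivity)).mp h3
    have h4 : |truncLog a b d u z.1 - truncLog a b d u z.2| ^ p ≤
        |Real.log (u z.1 + d) - Real.log (u z.2 + d)| ^ p :=
      Real.rpow_le_rpow (abs_nonneg _) (abs_truncLog_sub_le a b d u z.1 z.2) (by linarith)
    calc _ ≤ 1 * |Real.log (u z.1 + d) - Real.log (u z.2 + d)| ^ p := by rwa [one_mul]
      _ ≤ (2 * r) ^ N * kernel h m s p z.1 z.2 *
          |Real.log (u z.1 + d) - Real.log (u z.2 + d)| ^ p := by gcongr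
      _ = _ := mul_assoc _ _ _

theorem oscillation_truncLog_eq_zero {h : ℕ} (m : ℕ) (hh : 1 ≤ h) (hn : h ≤ n) {p a b d : ℝ}
    (hp : 1 < p) {u : EuclideanSpace ℝ (Fin n) → ℝ} (hu : u =ᵐ[volume] 0)
    (x₀ : EuclideanSpace ℝ (Fin n)) {r : ℝ} (hr : 0 < r) :
    (⨍ x in ccBall h m x₀ r,
        |truncLog a b d u x - ⨍ y in ccBall h m x₀ r, truncLog a b d u y| ^ p) = 0 := by
  have hBfin : IsFiniteMeasure (volume.restrict (ccBall h m x₀ r)) :=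
    ⟨by simpa using volume_ccBall_lt_top m hh hn x₀ hr⟩
  have hBpos : NeZero (volume.restrict (ccBall h m x₀ r)) :=
    ⟨fun h0 => (volume_ccBall_pos m hh hn x₀ hr).ne' (Measure.restrict_eq_zero.mp h0)⟩
  set k := min (max (Real.log (a + d) - Real.log (0 + d)) 0) (Real.log b) with hk
  have hv : truncLog a b d u =ᵐ[volume.restrict (ccBall h m x₀ r)] fun _ => k := by
    refine ae_restrict_of_ae ?_
    filter_upwards [hu] with x hx
    simp [truncLog, hx, hk]
  have havg : ⨍ y in ccBall h m x₀ r, truncLog a b d u y = k := by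
    rw [average_congr hv, average_const]
  rw [havg, average_congr (g := fun _ => (0 : ℝ)), average_const]
  filter_upwards [hv] with x hx
  rw [hx, sub_self, abs_zero, Real.zero_rpow (by linarith)]

/-- Inserts the cutoff and tail bounds into `log_estimate`. The factor `r ^ n (|x₀|_h + r) ^ (m (n -
h))`, comparable to `|B_r|`, is kept separate, to cancel later. -/
theorem log_energy_le {h : ℕ} (m : ℕ) (hh : 1 ≤ h) (hn : h ≤ n) {s p : ℝ} (hp : 1 < p)
    (hs : 0 < s) (hsp : ((m * (n - h) : ℕ) : ℝ) < p * (1 - s)) :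
    ∃ C : ℝ, 0 < C ∧ ∀ (Ω : Set (EuclideanSpace ℝ (Fin n))) (g u : EuclideanSpace ℝ (Fin n) → ℝ)
      (x₀ : EuclideanSpace ℝ (Fin n)) (R r d : ℝ), 0 < r → r ≤ R / 2 → 0 < d →
      IsWeakSupersolution h m s p Ω g u → ccBall h m x₀ R ⊆ Ω →
      (∀ᵐ x, x ∈ ccBall h m x₀ R → 0 ≤ u x) →
      ∫⁻ z in ccBall h m x₀ r ×ˢ ccBall h m x₀ r,
        ENNReal.ofReal (kernel h m s p z.1 z.2 *
          |Real.log (u z.1 + d) - Real.log (u z.2 + d)| ^ p) ∂(volume.prod volume) ≤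
      ENNReal.ofReal (C * (r ^ n * (hNorm h x₀ + r) ^ (m * (n - h))) *
        (r ^ (-(homDim n h m) - s * p + n) * (hNorm h x₀ + r) ^ (m * (n - h)) +
          d ^ (1 - p) * (R ^ (-(s * p)) *
            tail h m s p (fun x => max (-(u x)) 0) x₀ R ^ (p - 1)))) := by
  obtain ⟨C₁, hC₁, hcut⟩ := gagliardoEnergy_cutoff_le m hh hn hp hs hsp
  set μ := m * (n - h) with hμ
  have hn0 : (0 : ℝ) < n := by exact_mod_cast (hh.trans hn : 0 < n)
  set C₂ : ℝ := 2 ^ n * (n : ℝ) ^ μ * (2 ^ n * 2 ^ μ) with hC₂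
  set C₃ : ℝ := 2 * (4 ^ (homDim n h m + s * p) * C₂) with hC₃
  have hp1 : 0 < p - 1 := by linarith
  have hC₂0 : 0 < C₂ := by positivity
  have hC₃0 : 0 < C₃ := by positivity
  refine ⟨(p - 1)⁻¹ * (2 ^ (p - 1) * (C₁ + C₃)), by positivity,
    fun Ω g u x₀ R r d hr hrR hd hu hΩ hpos => ?_⟩
  have hR : 0 < R := by linarith
  have hx₀ := hNorm_nonneg h x₀
  have hEfin : gagliardoEnergy h m s p (cutoff h m x₀ r) < ∞ :=
    (hcut x₀ r hr).trans_lt ENNReal.ofReal_lt_top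
  set Y := r ^ n * (hNorm h x₀ + r) ^ μ with hY
  set P := r ^ (-(homDim n h m) - s * p + n) * (hNorm h x₀ + r) ^ μ with hP
  set T := R ^ (-(s * p)) * tail h m s p (fun x => max (-(u x)) 0) x₀ R ^ (p - 1) with hT
  have hT0 : 0 ≤ T := mul_nonneg (Real.rpow_nonneg hR.le _)
    (Real.rpow_nonneg (tail_nonneg h m s p _ x₀ hR) _)
  have hY0 : 0 < Y := by positivity
  have hP0 : 0 < P := by positivity
  have hvol : volume (ccBall h m x₀ (3 / 2 * r)) ≤ ENNReal.ofReal (C₂ * Y) := by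
    refine (volume_ccBall_le m hh hn x₀ (by positivity)).trans (ENNReal.ofReal_le_ofReal ?_)
    calc _ ≤ 2 ^ n * (n : ℝ) ^ μ * ((2 * r) ^ n * (2 * (hNorm h x₀ + r)) ^ μ) := by
          gcongr <;> linarith
      _ = C₂ * Y := by rw [hC₂, hY, mul_pow, mul_pow]; ring
  have hJ := (lintegral_tail_le hh hn hp hs hr hrR hu.memW.1 hpos).trans
    (mul_le_mul_right hvol _)
  have hlog := log_estimate hh hn hp hd hr hrR hu hΩ hpos hEfin
  set I := ∫⁻ z in ccBall h m x₀ r ×ˢ ccBall h m x₀ r,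
        ENNReal.ofReal (kernel h m s p z.1 z.2 *
          |Real.log (u z.1 + d) - Real.log (u z.2 + d)| ^ p) ∂(volume.prod volume) with hI
  have hfinal : ENNReal.ofReal (p - 1) * I ≤
      ENNReal.ofReal (2 ^ (p - 1) * (C₁ * (P * Y)) + 2 ^ (p - 1) * d ^ (1 - p) *
        (2 * (4 ^ (homDim n h m + s * p) * T * (C₂ * Y)))) := by
    have h2p : (0 : ℝ) ≤ 2 ^ (p - 1) := by positivity
    have h2d : 0 ≤ 2 ^ (p - 1) * d ^ (1 - p) := by positivity
    have h4T : 0 ≤ 4 ^ (homDim n h m + s * p) * T := by positivity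
    rw [ENNReal.ofReal_add (by positivity) (by positivity), ENNReal.ofReal_mul h2p,
      ENNReal.ofReal_mul h2d, ENNReal.ofReal_mul zero_le_two, ENNReal.ofReal_mul h4T,
      ENNReal.ofReal_ofNat]
    refine hlog.trans (add_le_add (mul_le_mul_right (hcut x₀ r hr) _)
      (mul_le_mul_right (mul_le_mul_right hJ _) _))
  have hle : 2 ^ (p - 1) * (C₁ * (P * Y)) + 2 ^ (p - 1) * d ^ (1 - p) *
        (2 * (4 ^ (homDim n h m + s * p) * T * (C₂ * Y))) ≤
      2 ^ (p - 1) * (C₁ + C₃) * Y * (P + d ^ (1 - p) * T) := by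
    have e : 2 ^ (p - 1) * (C₁ + C₃) * Y * (P + d ^ (1 - p) * T) -
        (2 ^ (p - 1) * (C₁ * (P * Y)) + 2 ^ (p - 1) * d ^ (1 - p) *
        (2 * (4 ^ (homDim n h m + s * p) * T * (C₂ * Y)))) =
        2 ^ (p - 1) * Y * (C₁ * (d ^ (1 - p) * T) + C₃ * P) := by
      rw [hC₃]; ring
    have : 0 ≤ 2 ^ (p - 1) * Y * (C₁ * (d ^ (1 - p) * T) + C₃ * P) := by positivity
    linarith
  have hmul := mul_le_mul_right (hfinal.trans (ENNReal.ofReal_le_ofReal hle))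
    (ENNReal.ofReal (p - 1)⁻¹)
  rw [← mul_assoc, ← ENNReal.ofReal_mul (by positivity), inv_mul_cancel₀ hp1.ne',
    ENNReal.ofReal_one, one_mul, ← ENNReal.ofReal_mul (by positivity)] at hmul
  refine hmul.trans (le_of_eq ?_)
  congr 1
  ring

/-- The mean oscillation estimate in the range where the space `W^{s,p}` is nontrivial. -/
theorem exists_oscillation_bound {h : ℕ} (m : ℕ) (hh : 1 ≤ h) (hn : h ≤ n) {s p : ℝ} (hp : 1 < p)
    (hs : 0 < s) (hsp : ((m * (n - h) : ℕ) : ℝ) < p * (1 - s)) :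
    ∃ C : ℝ, 0 < C ∧ ∀ (Ω : Set (EuclideanSpace ℝ (Fin n))) (g u : EuclideanSpace ℝ (Fin n) → ℝ)
      (x₀ : EuclideanSpace ℝ (Fin n)) (R r a b d : ℝ), 0 < r → r ≤ R / 2 → 1 < b → 0 < d →
      IsWeakSupersolution h m s p Ω g u → ccBall h m x₀ R ⊆ Ω →
      (∀ᵐ x, x ∈ ccBall h m x₀ R → 0 ≤ u x) →
      (⨍ x in ccBall h m x₀ r,
        |truncLog a b d u x - ⨍ y in ccBall h m x₀ r, truncLog a b d u y| ^ p) ≤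
      C * (1 + ((hNorm h x₀ + r) ^ (m * (n - h)))⁻¹ * (d ^ (1 - p) * (r / R) ^ (s * p) *
        r ^ (homDim n h m - n) * tail h m s p (fun x => max (-(u x)) 0) x₀ R ^ (p - 1))) := by
  obtain ⟨C, hC, H⟩ := log_energy_le m hh hn hp hs hsp
  set μ := m * (n - h) with hμ
  have hn0 : (0 : ℝ) < n := by exact_mod_cast (hh.trans hn : 0 < n)
  set c₀ : ℝ := (1 / (n : ℝ)) ^ n * (1 / 16) ^ μ with hc₀
  have hc₀0 : 0 < c₀ := by positivity
  refine ⟨c₀⁻¹ ^ 2 * (2 ^ (homDim n h m + s * p) * C), by positivity,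
    fun Ω g u x₀ R r a b d hr hrR hb hd hu hΩ hpos => ?_⟩
  have hR : 0 < R := by linarith
  have hx₀ := hNorm_nonneg h x₀
  have hI := H Ω g u x₀ R r d hr hrR hd hu hΩ hpos
  refine (oscillation_truncLog_le m hh hn hp hs hb hu.memW.aemeasurable x₀ hr
    (ne_top_of_le_ne_top ENNReal.ofReal_ne_top hI)).trans ?_
  set A := (hNorm h x₀ + r) ^ μ with hA
  have hA0 : 0 < A := by positivity
  set t := tail h m s p (fun x => max (-(u x)) 0) x₀ R ^ (p - 1) with ht
  have ht0 : 0 ≤ t := Real.rpow_nonneg (tail_nonneg h m s p _ x₀ hR) _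
  have hV : c₀ * (r ^ n * A) ≤ (volume (ccBall h m x₀ r)).toReal :=
    (ENNReal.ofReal_le_iff_le_toReal (volume_ccBall_lt_top m hh hn x₀ hr).ne).mp
      (volume_ccBall_ge m hh hn x₀ hr)
  have hIr := ENNReal.toReal_le_of_le_ofReal (by positivity) hI
  -- One of the two inverse volumes cancels the factor `r ^ n * A`. In the cutoff term the other
  -- cancels `A` and all powers of `r`, leaving a constant.
  calc _ ≤ (c₀ * (r ^ n * A))⁻¹ ^ 2 * ((2 * r) ^ (homDim n h m + s * p) *
        (C * (r ^ n * A) * (r ^ (-(homDim n h m) - s * p + n) * A +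
          d ^ (1 - p) * (R ^ (-(s * p)) * t)))) := by gcongr
    _ = c₀⁻¹ ^ 2 * (2 ^ (homDim n h m + s * p) * C) *
        ((r ^ (homDim n h m + s * p) * r ^ (-(homDim n h m) - s * p + n)) / r ^ n +
          A⁻¹ * (d ^ (1 - p) * (r ^ (homDim n h m + s * p) / r ^ n * R ^ (-(s * p))) * t)) := by
        rw [Real.mul_rpow zero_le_two hr.le]
        field_simp
    _ = _ := by
        have e1 : r ^ (homDim n h m + s * p) * r ^ (-(homDim n h m) - s * p + n) = r ^ n := by
          rw [← Real.rpow_add hr, ← Real.rpow_natCast r n]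
          congr 1
          ring
        have e2 : r ^ (homDim n h m + s * p) / r ^ n * R ^ (-(s * p)) =
            (r / R) ^ (s * p) * r ^ (homDim n h m - n) := by
          rw [Real.div_rpow hr.le hR.le, Real.rpow_neg hR.le, ← Real.rpow_natCast r n,
            Real.rpow_add hr, Real.rpow_sub hr]
          field_simp
        rw [e1, e2, div_self (by positivity)]
        ring

end Grushin

/-! ### The theorem: the two ranges of `p (1 - s)` -/

theorem mainTheorem6 (n h m : ℕ) (hh : 1 ≤ h) (hn : h ≤ n)
    (hQ : Grushin.homDim n h m < 2 * (n : ℝ))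
    (p s : ℝ) (hp : 1 < p) (hs₀ : 0 < s) (hs₁ : s < 1) :
    ∃ c : ℝ, 0 < c ∧
      ∀ (Ω : Set (EuclideanSpace ℝ (Fin n))) (g u : EuclideanSpace ℝ (Fin n) → ℝ)
        (x₀ : EuclideanSpace ℝ (Fin n)) (R r a b d : ℝ),
        IsOpen Ω → Bornology.IsBounded Ω →
        Grushin.MemW h m s p g →
        Grushin.IsWeakSolution h m s p Ω g u →
        0 < R → Grushin.ccBall h m x₀ R ⊆ Ω →
        (∀ᵐ x, x ∈ Grushin.ccBall h m x₀ R → 0 ≤ u x) →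
        0 < r → Grushin.ccBall h m x₀ r ⊆ Grushin.ccBall h m x₀ (R / 2) →
        0 < a → 1 < b → 0 < d →
        (⨍ x in Grushin.ccBall h m x₀ r,
            |Grushin.truncLog a b d u x
              - ⨍ y in Grushin.ccBall h m x₀ r, Grushin.truncLog a b d u y| ^ p)
          ≤ c * (Grushin.hNorm h x₀ + r) ^ (-((m : ℝ) * ((n : ℝ) - (h : ℝ)))) *
            (d ^ (1 - p) * (r / R) ^ (s * p) * r ^ (Grushin.homDim n h m - (n : ℝ))
                * Grushin.tail h m s p (fun x => max (-(u x)) 0) x₀ R ^ (p - 1)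
              + (Grushin.hNorm h x₀ + 2 * r) ^ ((m : ℝ) * ((n : ℝ) - (h : ℝ)))) := by
  have hμ : (m : ℝ) * ((n : ℝ) - (h : ℝ)) = ((m * (n - h) : ℕ) : ℝ) := by
    push_cast [Nat.cast_sub hn]
    ring
  rw [hμ]
  rcases lt_or_ge (((m * (n - h) : ℕ) : ℝ)) (p * (1 - s)) with hsp | hsp
  · obtain ⟨C, hC, H⟩ := Grushin.exists_oscillation_bound (n := n) m hh hn hp hs₀ hsp
    refine ⟨C, hC, fun Ω g u x₀ R r a b d _ _ _ hu hR hΩ hpos hr hsub _ hb hd => ?_⟩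
    have hrR := Grushin.le_of_ccBall_subset m hh hn (by positivity) hsub
    refine (H Ω g u x₀ R r a b d hr hrR hb hd hu.2 hΩ hpos).trans ?_
    have hx₀ := Grushin.hNorm_nonneg h x₀
    have hA : 0 < Grushin.hNorm h x₀ + r := by positivity
    rw [Real.rpow_neg hA.le, Real.rpow_natCast, Real.rpow_natCast, mul_assoc C]
    refine mul_le_mul_of_nonneg_left ?_ hC.le
    rw [mul_add, add_comm]
    refine add_le_add le_rfl ?_
    -- The constant term is absorbed because `(|x₀|_h + 2 r) ^ μ / (|x₀|_h + r) ^ μ ≥ 1`.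
    rw [inv_mul_eq_div, one_le_div (by positivity)]
    gcongr
    linarith
  -- Any positive constant works: `u = 0` a.e., so the oscillation is 0 and the right side is
  -- nonnegative.
  · refine ⟨1, one_pos, fun Ω g u x₀ R r a b d _ _ _ hu hR _ _ hr _ _ _ hd => ?_⟩
    rw [Grushin.oscillation_truncLog_eq_zero m hh hn hp
      (Grushin.MemW.ae_eq_zero hh hn hp hs₀ hsp hu.1.memW) x₀ hr]
    have hx₀ := Grushin.hNorm_nonneg h x₀
    have ht := Grushin.tail_nonneg h m s p (fun x => max (-(u x)) 0) x₀ hR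
    positivity
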